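/- **Setting.** Let $a,b\in C^2([0,1])$ with $a(x)\ge\alpha>0$ on $[0,1]$. For $\varepsilon>0$ and $f\in L^2([0,1])$, a weak solution of $$-\varepsilon u''+a u'+b u=f\ \text{ on }(0,1),\qquad u(0)=u(1)=0,$$ is a function $u\in H_0^1(0,1)$ with $\varepsilon\int_0^1u'v'\,dx+\int_0^1a u'v\,dx+\int_0^1b uv\,dx=\int_0^1fv\,dx$ for all $v\in H_0^1(0,1)$. If every $f\in L^2([0,1])$ has exactly one weak solution $u$, the map $\mathscr G:L^2([0,1])\to L^2([0,1])$, $f\mapsto u$, is called the solution operator. For $l>0$, let $\mu=\mu_l$ be the Gaussian measure on $L^2([0,1])$ with mean $0$ whose covariance operator is the integral operator with kernel $$k(x,y)=\sum_{n\in\mathbb Z}\exp\bigl(-|x-y-n|^2/(2l^2)\bigr).$$ A ReLU network is a map $A_L\circ\sigma\circ A_{L-1}\circ\cdots\circ\sigma\circ A_1$ with affine maps $A_i$ and $\sigma(t)=\max\{0,t\}$ acting componentwise; its depth is the number $L-1$ of hidden layers, and its width is the largest dimension of a layer (input and output included). A trunk net $\boldsymbol\tau=(\tau_0,\dots,\tau_p)$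 is a ReLU network $\mathbb R\to\mathbb R^{p+1}$, and a branch net $\boldsymbol\beta$ is a ReLU network $\mathbb R^m\to\mathbb R^p$. They define the DeepONet $$\mathscr N(f)=\tau_0+\sum_{k=1}^p\boldsymbol\beta_k\bigl(f(x_1),\dots,f(x_m)\bigr)\,\tau_k\in L^2([0,1]),\qquad x_j=j/m .$$ Here $f(x_j)$ is the value of the continuous representative of $f$; on the ($\mu$-null) set of those $f\in L^2([0,1])$ that have no continuous representative the point values are set to $0$. **Theorem 3.1.** Let $a,b,\alpha$ be as above, and let $\Lambda\ge0$, $\gamma\in(0,1)$ and $l_{\max}>0$. There is a constant $C>0$, depending only on $a,b,\alpha,\Lambda,\gamma$ and $l_{\max}$, such that the following holds for every $\varepsilon>0$ for which the solution operator $\mathscr G$ exists and is Lipschitz continuous on $L^2([0,1])$ with constant $\Lambda$, for all $0<l\le l_{\max}$, all integers $m,p\ge1$ and all $\eta>0$. There are a ReLU trunk net $\boldsymbol\tau$ of depth at most $1$ and a ReLU branch net $\boldsymbol\beta$ of depth at most $1$ with $$\mathrm{width}(\boldsymbol\tau)\le C\max\bigl\{p,(\eta/p)^{1/(\gamma-2)}\bigr\},\qquad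 \mathrm{width}(\boldsymbol\beta)\le C\max\{m,p\},$$ such that $\mathscr G-\mathscr N$ belongs to $L^2(\mu;L^2([0,1]))$ and $$\|\mathscr G-\mathscr N\|_{L^2(\mu)}=\left(\int\|\mathscr G(f)-\mathscr N(f)\|_{L^2([0,1])}^2\,d\mu(f)\right)^{1/2}\le C\left(\eta+e^{-\pi^2l^2K^2}+e^{-\pi^2l^2M^2}\right),$$ where $K=(p-1)/2$ and $M=(m-1)/2$. In particular, $C$ does not depend on $\varepsilon$, $m$, $p$, $\eta$, nor on $l\in(0,l_{\max}]$. -/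

import Mathlib

open MeasureTheory ProbabilityTheory
open scoped ContDiff NNReal Matrix

noncomputable section

namespace DeepONetSPP

/-! ### The space `L²([0,1])` -/

/-- Lebesgue measure on `[0,1]`, as a measure on `ℝ`. -/
abbrev unitVol : Measure ℝ := volume.restrict (Set.Icc (0 : ℝ) 1)

/-- The real Hilbert space `L²([0,1])`. -/
abbrev L2 : Type := Lp ℝ 2 unitVol

instance : MeasurableSpace L2 := borel L2

instance : BorelSpace L2 := ⟨rfl⟩

/-! ### The boundary value problem -/

/-- The pairs `(φ, φ')` with `φ ∈ C_c^∞(0,1)`, as elements of `L² × L²`. -/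
def testPairs : Set (L2 × L2) :=
  {w | ∃ φ : ℝ → ℝ, ContDiff ℝ ∞ φ ∧ HasCompactSupport φ ∧ tsupport φ ⊆ Set.Ioo 0 1 ∧
    w.1 =ᵐ[unitVol] φ ∧ w.2 =ᵐ[unitVol] deriv φ}

/-- `H_0^1(0,1)`, the closure of `C_c^∞(0,1)` in the `H¹` norm. An element `v` is recorded as the
pair `(v, v')` of the function and its weak derivative, so that the `H¹` topology is that of
`L² × L²`. -/
def H01 : Set (L2 × L2) := closure testPairs

/-- `u ∈ H_0^1` is a weak solution of `-ε u'' + a u' + b u = f`, `u(0) = u(1) = 0`. -/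
def IsWeakSolution (ε : ℝ) (a b : ℝ → ℝ) (f u : L2) : Prop :=
  ∃ du : L2, (u, du) ∈ H01 ∧ ∀ v dv : L2, (v, dv) ∈ H01 →
    ε * (∫ x in Set.Icc (0 : ℝ) 1, du x * dv x) + (∫ x in Set.Icc (0 : ℝ) 1, a x * du x * v x)
      + (∫ x in Set.Icc (0 : ℝ) 1, b x * u x * v x) = ∫ x in Set.Icc (0 : ℝ) 1, f x * v x

/-- `G` is the solution operator `f ↦ u`: for every `f ∈ L²` the problem has exactly one weak
solution, and `G f` is that solution. -/
def IsSolutionOperator (ε : ℝ) (a b : ℝ → ℝ) (G : L2 → L2) : Prop :=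
  ∀ f u : L2, IsWeakSolution ε a b f u ↔ u = G f

/-! ### The input measure -/

/-- The periodization of the kernel `exp (-|x - y|² / (2 l²))`. -/
def periodicRBF (l x y : ℝ) : ℝ :=
  ∑' n : ℤ, Real.exp (-(x - y - n) ^ 2 / (2 * l ^ 2))

/-- `μ` is the Gaussian measure on `L²([0,1])` with mean `0` whose covariance operator is the
integral operator with kernel `periodicRBF l`. -/
structure IsRBFGaussian (l : ℝ) (μ : Measure L2) : Prop where
  gaussian : IsGaussian μ
  mean : ∫ f : L2, f ∂μ = 0
  covariance : ∀ g h : L2, ∫ f : L2, (inner ℝ g f : ℝ) * (inner ℝ f h : ℝ) ∂μ =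
    ∫ x in Set.Icc (0 : ℝ) 1, g x * ∫ y in Set.Icc (0 : ℝ) 1, periodicRBF l x y * h y

/-! ### ReLU networks -/

/-- Feedforward ReLU networks `ℝ^m → ℝ^n`, that is `A_L ∘ σ ∘ ⋯ ∘ σ ∘ A_1` with affine maps `A_i`
and `σ = max 0 ·` acting componentwise. -/
inductive ReLUNet : ℕ → ℕ → Type
  | affine {m n : ℕ} (W : Matrix (Fin n) (Fin m) ℝ) (c : Fin n → ℝ) : ReLUNet m n
  | layer {m k n : ℕ} (W : Matrix (Fin k) (Fin m) ℝ) (c : Fin k → ℝ) (rest : ReLUNet k n) :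
      ReLUNet m n

namespace ReLUNet

/-- The function computed by a network. -/
def eval : {m n : ℕ} → ReLUNet m n → (Fin m → ℝ) → (Fin n → ℝ)
  | _, _, affine W c, x => W *ᵥ x + c
  | _, _, layer W c rest, x => rest.eval (fun i => max 0 ((W *ᵥ x + c) i))

/-- The number of hidden layers. -/
def depth : {m n : ℕ} → ReLUNet m n → ℕ
  | _, _, affine _ _ => 0
  | _, _, layer _ _ rest => rest.depth + 1

/-- The largest dimension of a layer, the input and the output layer included. -/
def width : {m n : ℕ} → ReLUNet m n → ℕ
  | m, n, affine _ _ => max m n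
  | m, _, layer _ _ rest => max m rest.width

theorem continuous_eval : {m n : ℕ} → (N : ReLUNet m n) → Continuous N.eval
  | _, _, affine W c => by
      change Continuous fun x => W *ᵥ x + c
      fun_prop
  | _, _, layer W c rest => by
      change Continuous fun x => rest.eval (fun i => max 0 ((W *ᵥ x + c) i))
      refine rest.continuous_eval.comp (continuous_pi fun i => continuous_const.max ?_)
      have h : Continuous fun x => W *ᵥ x + c := by fun_prop
      exact (continuous_apply i).comp h

end ReLUNet

/-! ### DeepONets -/

open Classical in
/-- The value at `x ∈ [0,1]` of the continuous representative of `f ∈ L²([0,1])`; it is set to `0`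
on the complement of `C([0,1])`. -/
def pointEval (f : L2) (x : ℝ) : ℝ :=
  if h : ∃ g : ℝ → ℝ, ContinuousOn g (Set.Icc 0 1) ∧ f =ᵐ[unitVol] g then h.choose x else 0

theorem pointEval_eq {f : L2} {g : ℝ → ℝ} (hg : ContinuousOn g (Set.Icc 0 1))
    (hfg : f =ᵐ[unitVol] g) {x : ℝ} (hx : x ∈ Set.Icc (0 : ℝ) 1) : pointEval f x = g x := by
  have h : ∃ g : ℝ → ℝ, ContinuousOn g (Set.Icc 0 1) ∧ f =ᵐ[unitVol] g := ⟨g, hg, hfg⟩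
  rw [pointEval, dif_pos h]
  exact Measure.eqOn_Icc_of_ae_eq volume zero_ne_one
    (h.choose_spec.2.symm.trans hfg) h.choose_spec.1 hg hx

/-- The encoder `f ↦ (f(x_1), …, f(x_m))` with the equidistant sensors `x_j = j / m`. -/
def encoder (m : ℕ) (f : L2) : Fin m → ℝ := fun j => pointEval f (((j : ℝ) + 1) / m)

/-- The function `τ_0 + ∑ k, α_k τ_k` formed from a trunk net `τ = (τ_0, …, τ_P)`. -/
def trunkSum {P : ℕ} (τ : ReLUNet 1 (P + 1)) (α : Fin P → ℝ) (x : ℝ) : ℝ :=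
  τ.eval (fun _ => x) 0 + ∑ k : Fin P, α k * τ.eval (fun _ => x) k.succ

theorem memLp_trunkSum {P : ℕ} (τ : ReLUNet 1 (P + 1)) (α : Fin P → ℝ) :
    MemLp (trunkSum τ α) 2 unitVol := by
  have h0 : Continuous fun x : ℝ => τ.eval (fun _ => x) :=
    τ.continuous_eval.comp (continuous_pi fun _ => continuous_id)
  have h : Continuous (trunkSum τ α) := by
    unfold trunkSum
    refine ((continuous_apply 0).comp h0).add (continuous_finsetSum _ fun k _ => ?_)
    exact continuous_const.mul ((continuous_apply k.succ).comp h0)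
  obtain ⟨C, hC⟩ := (isCompact_Icc (a := (0 : ℝ)) (b := 1)).exists_bound_of_continuousOn
    h.continuousOn
  refine MemLp.of_bound h.aestronglyMeasurable C ?_
  filter_upwards [ae_restrict_mem measurableSet_Icc] with x hx using hC x hx

/-- The reconstructor `ℝ^P → L²([0,1])` induced by a trunk net. -/
def reconstructor {P : ℕ} (τ : ReLUNet 1 (P + 1)) (α : Fin P → ℝ) : L2 :=
  (memLp_trunkSum τ α).toLp (trunkSum τ α)

/-- The DeepONet `reconstructor ∘ β ∘ encoder` with trunk net `τ` and branch net `β`. -/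
def deepONet {m P : ℕ} (τ : ReLUNet 1 (P + 1)) (β : ReLUNet m P) (f : L2) : L2 :=
  reconstructor τ (β.eval (encoder m f))

end DeepONetSPP

end

/-! The covariance kernel is a periodized Gaussian, so the real trigonometric system `cas k`
diagonalizes it, with eigenvalues `l √(2π) exp(-2π²l²k²)`. They decay so fast that almost every `f`
is an absolutely convergent Hartley series, which gives meaning to the sensor values. Let `S f` be
the trigonometric polynomial of degree `n` built from the discrete Hartley coefficients of the
sensor values. For `2n + 1 ≤ m` it reproduces all frequencies up to `n` and is bounded on the
others, so the mean square of `f - S f` is controlled by a tail of the eigenvalues, at most a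
constant times `exp(-2π²l²κ²)` with `κ = min K M`, uniformly in `l`
(`memLp_sub_sampleProj_encoder`).

Uniqueness of weak solutions makes `G` linear. The network replaces each `G (casL i)`, `|i| ≤ n`, by
its piecewise linear interpolant on one mesh: the branch net is affine and yields the discrete
coefficients, and the hidden layer of the trunk net consists of the ReLUs at the mesh nodes. The
error is `(G f - G (S f)) + (G (S f) - N f)`. The Lipschitz bound handles the first part; the second
is an interpolation error for a single boundary value problem, whose right-hand side is the
polynomial `S f`.

The core is to bound this interpolation error uniformly in `ε`. By `exists_bound_second_deriv`,
`|u''|` is at most a layer term `δ⁻² exp(-α(1-x)/δ)`, `δ = min ε 1`, plus a function bounded in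
`L²`, both linear in the `H¹` size of the data. The sign of `b` is arbitrary: the term `b u` is
moved to the right-hand side, where the Lipschitz constant of `G` controls it in `L²`. What remains
is a first-order equation for `u'`, and after differentiation one for `u''`, and both obey a
comparison principle. A Shishkin mesh with `2N` cells resolves the layer up to `N ^ (γ - 2)`
(`integral_layerBound_shishkin_le`), where `γ` absorbs a logarithm. The derivative of a polynomial
of degree at most `P` costs a factor `2πP`, so the second part is of order `P * N ^ (γ - 2)`
(`exists_interpolated_solutions`), and choosing `N` so that this is at most `η` gives the trunk
width. -/

noncomputable section

namespace DeepONetSPP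

/-! ### The Hartley basis -/

/-- The Hartley function `cos (2πkx) + sin (2πkx)`. -/
def cas (k : ℤ) (x : ℝ) : ℝ := Real.cos (2 * Real.pi * k * x) + Real.sin (2 * Real.pi * k * x)

@[fun_prop]
theorem continuous_cas (k : ℤ) : Continuous (cas k) := by
  unfold cas; fun_prop

theorem abs_cas_le (k : ℤ) (x : ℝ) : |cas k x| ≤ 2 := by
  unfold cas
  have h1 := Real.abs_cos_le_one (2 * Real.pi * k * x)
  have h2 := Real.abs_sin_le_one (2 * Real.pi * k * x)
  exact (abs_add_le _ _).trans (by linarith)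

/-- Differentiation permutes the system up to the factors `2πk`, so Parseval also computes norms of
derivatives of trigonometric polynomials. -/
theorem hasDerivAt_cas (k : ℤ) (x : ℝ) :
    HasDerivAt (cas k) (2 * Real.pi * k * cas (-k) x) x := by
  have h : HasDerivAt (fun x : ℝ => 2 * Real.pi * k * x) (2 * Real.pi * k) x := by
    simpa using (hasDerivAt_id x).const_mul (2 * Real.pi * (k : ℝ))
  refine (h.cos.add h.sin).congr_deriv ?_
  simp only [cas, Int.cast_neg, mul_neg, neg_mul, Real.cos_neg, Real.sin_neg]
  ring

/-- Source of both orthogonality relations: the sine drops out when integrated over a period or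
summed over the sensors, and the cosine only sees `k - j`. -/
theorem cas_mul_cas (k j : ℤ) (x : ℝ) : cas k x * cas j x =
    Real.cos (2 * Real.pi * ((k - j : ℤ) : ℝ) * x) +
      Real.sin (2 * Real.pi * ((k + j : ℤ) : ℝ) * x) := by
  have h1 : 2 * Real.pi * ((k - j : ℤ) : ℝ) * x =
      2 * Real.pi * k * x - 2 * Real.pi * j * x := by push_cast; ring
  have h2 : 2 * Real.pi * ((k + j : ℤ) : ℝ) * x =
      2 * Real.pi * k * x + 2 * Real.pi * j * x := by push_cast; ring
  rw [h1, h2, Real.cos_sub, Real.sin_add]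
  unfold cas
  ring

theorem integral_cos_two_pi_int (n : ℤ) :
    ∫ x in (0 : ℝ)..1, Real.cos (2 * Real.pi * n * x) = if n = 0 then 1 else 0 := by
  split_ifs with h
  · simp [h]
  · have hn : 2 * Real.pi * (n : ℝ) ≠ 0 := by
      have : (n : ℝ) ≠ 0 := by exact_mod_cast h
      positivity
    rw [intervalIntegral.integral_comp_mul_left _ hn, integral_cos]
    have : Real.sin (2 * Real.pi * n) = 0 := by
      have := Real.sin_int_mul_pi (2 * n)
      rw [← this]; congr 1; push_cast; ring
    simp [this]

theorem integral_sin_two_pi_int (n : ℤ) :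
    ∫ x in (0 : ℝ)..1, Real.sin (2 * Real.pi * n * x) = 0 := by
  by_cases h : n = 0
  · simp [h]
  · have hn : 2 * Real.pi * (n : ℝ) ≠ 0 := by
      have : (n : ℝ) ≠ 0 := by exact_mod_cast h
      positivity
    rw [intervalIntegral.integral_comp_mul_left _ hn, integral_sin]
    have : Real.cos (2 * Real.pi * n) = 1 := by
      rw [mul_comm]; exact Real.cos_int_mul_two_pi n
    simp [this]

theorem integral_cas_mul_cas (k j : ℤ) :
    ∫ x in (0 : ℝ)..1, cas k x * cas j x = if k = j then 1 else 0 := by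
  simp_rw [cas_mul_cas]
  rw [intervalIntegral.integral_add (Continuous.intervalIntegrable (by fun_prop) _ _)
    (Continuous.intervalIntegrable (by fun_prop) _ _), integral_cos_two_pi_int,
    integral_sin_two_pi_int]
  simp [sub_eq_zero]

/-- The Hartley function as a bounded continuous function. -/
def casB (k : ℤ) : BoundedContinuousFunction ℝ ℝ :=
  BoundedContinuousFunction.ofNormedAddCommGroup (cas k) (continuous_cas k) 2 (abs_cas_le k)

@[simp] theorem casB_apply (k : ℤ) (x : ℝ) : casB k x = cas k x := rfl

theorem norm_casB_le (k : ℤ) : ‖casB k‖ ≤ 2 :=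
  BoundedContinuousFunction.norm_ofNormedAddCommGroup_le _ (by norm_num) _

/-- The restriction of bounded continuous functions to `L²([0,1])`. -/
def bcfToL2 : BoundedContinuousFunction ℝ ℝ →L[ℝ] L2 :=
  BoundedContinuousFunction.toLp 2 unitVol ℝ

theorem coeFn_bcfToL2 (g : BoundedContinuousFunction ℝ ℝ) : bcfToL2 g =ᵐ[unitVol] g :=
  BoundedContinuousFunction.coeFn_toLp 2 unitVol ℝ g

/-- The Hartley function as an element of `L²([0,1])`. -/
def casL (k : ℤ) : L2 := bcfToL2 (casB k)

theorem coeFn_casL (k : ℤ) : casL k =ᵐ[unitVol] cas k := coeFn_bcfToL2 (casB k)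

theorem integral_unitVol (h : ℝ → ℝ) : ∫ x, h x ∂unitVol = ∫ x in (0 : ℝ)..1, h x := by
  rw [intervalIntegral.integral_of_le zero_le_one, integral_Icc_eq_integral_Ioc]

theorem inner_L2_eq {f g : L2} {u v : ℝ → ℝ} (hu : f =ᵐ[unitVol] u) (hv : g =ᵐ[unitVol] v) :
    (inner ℝ f g : ℝ) = ∫ x in (0 : ℝ)..1, u x * v x := by
  rw [MeasureTheory.L2.inner_def, ← integral_unitVol]
  refine integral_congr_ae ?_
  filter_upwards [hu, hv] with x h1 h2
  simp [h1, h2, mul_comm]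

theorem norm_sq_L2_eq {f : L2} {u : ℝ → ℝ} (hu : f =ᵐ[unitVol] u) :
    ‖f‖ ^ 2 = ∫ x in (0 : ℝ)..1, u x ^ 2 := by
  rw [← real_inner_self_eq_norm_sq, inner_L2_eq hu hu]
  simp_rw [sq]

theorem orthonormal_casL : Orthonormal ℝ casL := by
  rw [orthonormal_iff_ite]
  intro k j
  rw [inner_L2_eq (coeFn_casL k) (coeFn_casL j), integral_cas_mul_cas]

/-- The coefficients at `k` and `-k` are the sum and the difference of a cosine and a sine
coefficient, so both of these vanish. Hence all complex Fourier coefficients vanish, and Parseval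
applies. -/
theorem eq_zero_of_inner_casL_eq_zero (f : L2) (h : ∀ k, (inner ℝ (casL k) f : ℝ) = 0) :
    f = 0 := by
  have hf := Lp.memLp f
  have hIoc : MemLp (fun x => (f x : ℂ)) 2 (volume.restrict (Set.Ioc (0 : ℝ) 1)) := by
    rw [restrict_Ioc_eq_restrict_Icc]
    exact hf.ofReal (K := ℂ)
  have hfi : IntervalIntegrable f volume 0 1 := by
    rw [intervalIntegrable_iff_integrableOn_Icc_of_le zero_le_one]
    exact hf.integrable (by norm_num)
  have hmul : ∀ (c : ℝ → ℝ), Continuous c → IntervalIntegrable (fun x => c x * f x) volume 0 1 :=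
    fun c hc => hfi.continuousOn_mul hc.continuousOn
  have hint : ∀ k : ℤ, (∫ x in (0 : ℝ)..1, Real.cos (2 * Real.pi * k * x) * f x) +
      ∫ x in (0 : ℝ)..1, Real.sin (2 * Real.pi * k * x) * f x = 0 := fun k => by
    refine Eq.trans ?_ (h k)
    rw [inner_L2_eq (coeFn_casL k) (Filter.EventuallyEq.refl _ _),
      ← intervalIntegral.integral_add (hmul _ (by fun_prop)) (hmul _ (by fun_prop))]
    refine intervalIntegral.integral_congr fun x _ => ?_
    simp only [cas]
    ring
  have hcs : ∀ k : ℤ, (∫ x in (0 : ℝ)..1, Real.cos (2 * Real.pi * k * x) * f x) = 0 ∧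
      (∫ x in (0 : ℝ)..1, Real.sin (2 * Real.pi * k * x) * f x) = 0 := fun k => by
    have h1 := hint k
    have h2 := hint (-k)
    simp only [Int.cast_neg, mul_neg, neg_mul, Real.cos_neg, Real.sin_neg,
      intervalIntegral.integral_neg] at h2
    constructor <;> linarith
  have hcoef : ∀ n, fourierCoeffOn zero_lt_one (fun x => (f x : ℂ)) n = 0 := fun n => by
    rw [fourierCoeffOn_eq_integral]
    have : ∀ x : ℝ, fourier (-n) (x : AddCircle ((1 : ℝ) - 0)) • (f x : ℂ) =
        ((Real.cos (2 * Real.pi * n * x) * f x : ℝ) : ℂ) -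
          ((Real.sin (2 * Real.pi * n * x) * f x : ℝ) : ℂ) * Complex.I := fun x => by
      rw [fourier_coe_apply]
      have : 2 * (Real.pi : ℂ) * Complex.I * ((-n : ℤ) : ℂ) * (x : ℂ) / (((1 : ℝ) - 0 : ℝ) : ℂ) =
          ((-(2 * Real.pi * n * x) : ℝ) : ℂ) * Complex.I := by
        push_cast; simp; ring
      rw [this, Complex.exp_mul_I, ← Complex.ofReal_cos, ← Complex.ofReal_sin, Real.cos_neg,
        Real.sin_neg]
      push_cast
      simp only [smul_eq_mul]
      ring
    simp_rw [this]
    rw [intervalIntegral.integral_sub, intervalIntegral.integral_mul_const,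
      intervalIntegral.integral_ofReal, intervalIntegral.integral_ofReal, (hcs n).1, (hcs n).2]
    · simp
    · have := hmul (fun x => Real.cos (2 * Real.pi * n * x)) (by fun_prop)
      exact ⟨this.1.ofReal, this.2.ofReal⟩
    · have := hmul (fun x => Real.sin (2 * Real.pi * n * x)) (by fun_prop)
      exact IntervalIntegrable.mul_const ⟨this.1.ofReal, this.2.ofReal⟩ _
  have hpars := hasSum_sq_fourierCoeffOn zero_lt_one hIoc
  simp only [hcoef, norm_zero, ne_eq, OfNat.ofNat_ne_zero, not_false_eq_true, zero_pow] at hpars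
  have hz := hpars.unique hasSum_zero
  have hn : ‖f‖ ^ 2 = 0 := by
    rw [norm_sq_L2_eq (Filter.EventuallyEq.refl _ _)]
    simpa using hz
  simpa using hn

/-- The Hartley functions as a Hilbert basis of `L²([0,1])`. -/
def casBasis : HilbertBasis ℤ ℝ L2 :=
  HilbertBasis.mkOfOrthogonalEqBot orthonormal_casL (by
    rw [Submodule.eq_bot_iff]
    intro f hf
    refine eq_zero_of_inner_casL_eq_zero f fun k => ?_
    exact (Submodule.mem_orthogonal _ _).1 hf _ (Submodule.subset_span ⟨k, rfl⟩))

theorem hasSum_casL (f : L2) : HasSum (fun k => (inner ℝ (casL k) f : ℝ) • casL k) f := by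
  have := casBasis.hasSum_repr f
  simpa [HilbertBasis.repr_apply_apply, casBasis] using this

/-- If the Hartley coefficients of `f` are absolutely summable, then the point values of `f` are
those of its Hartley series. -/
theorem pointEval_eq_tsum (f : L2) (h : Summable fun k => |(inner ℝ (casL k) f : ℝ)|) {x : ℝ}
    (hx : x ∈ Set.Icc (0 : ℝ) 1) :
    HasSum (fun k => (inner ℝ (casL k) f : ℝ) * cas k x) (pointEval f x) := by
  -- The series converges uniformly to a continuous function, which must be the representative of
  -- `f` because the same series converges to `f` in `L²`.
  have hs : Summable fun k => (inner ℝ (casL k) f : ℝ) • casB k := by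
    refine Summable.of_norm_bounded (h.mul_right 2) fun k => ?_
    rw [norm_smul, Real.norm_eq_abs]
    exact mul_le_mul_of_nonneg_left (norm_casB_le k) (abs_nonneg _)
  obtain ⟨g, hg⟩ := hs
  have h1 : bcfToL2 g = f := by
    have := hg.mapL bcfToL2
    simp only [map_smul] at this
    exact this.unique (hasSum_casL f)
  rw [pointEval_eq (g := g) g.continuous.continuousOn (h1 ▸ coeFn_bcfToL2 g) hx]
  simpa using hg.mapL (BoundedContinuousFunction.evalCLM ℝ x)

/-! ### Discrete orthogonality -/

/-- A geometric sum over powers of an `m`-th root of unity `z`. The sensors start at `1 / m`, which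
only contributes an extra factor `z`. -/
theorem sum_exp_sensor (m : ℕ) (hm : 1 ≤ m) (n : ℤ) :
    ∑ j : Fin m, Complex.exp ((2 * Real.pi * n * (((j : ℝ) + 1) / m) : ℝ) * Complex.I) =
      if (m : ℤ) ∣ n then (m : ℂ) else 0 := by
  have hm0 : (m : ℂ) ≠ 0 := by exact_mod_cast (by lia : m ≠ 0)
  set z : ℂ := Complex.exp (2 * Real.pi * Complex.I * n / m) with hz
  have hterm : ∀ j : ℕ, Complex.exp ((2 * Real.pi * n * (((j : ℝ) + 1) / m) : ℝ) * Complex.I) =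
      z * z ^ j := fun j => by
    rw [← pow_succ', hz, ← Complex.exp_nat_mul]
    congr 1
    push_cast
    field_simp
  have hzm : z ^ m = 1 := by
    rw [hz, ← Complex.exp_nat_mul, Complex.exp_eq_one_iff]
    exact ⟨n, by field_simp⟩
  have hz1 : z = 1 ↔ (m : ℤ) ∣ n := by
    rw [hz, Complex.exp_eq_one_iff]
    have hpi : (Real.pi : ℂ) ≠ 0 := by exact_mod_cast Real.pi_ne_zero
    constructor
    · rintro ⟨q, hq⟩
      refine ⟨q, ?_⟩
      field_simp at hq
      exact_mod_cast hq
    · rintro ⟨q, rfl⟩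
      exact ⟨q, by push_cast; field_simp⟩
  rw [Finset.sum_congr rfl fun (j : Fin m) _ => hterm j, ← Finset.mul_sum,
    Fin.sum_univ_eq_sum_range (fun j => z ^ j) m]
  split_ifs with h
  · rw [hz1.2 h]; simp
  · have h1 : z - 1 ≠ 0 := sub_ne_zero.2 fun h' => h (hz1.1 h')
    have := geom_sum_mul z m
    rw [hzm, sub_self] at this
    rw [(mul_eq_zero.1 this).resolve_right h1, mul_zero]

theorem sum_cas_mul_cas_sensor (m : ℕ) (hm : 1 ≤ m) (k i : ℤ) :
    ∑ j : Fin m, cas k (((j : ℝ) + 1) / m) * cas i (((j : ℝ) + 1) / m) =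
      if (m : ℤ) ∣ k - i then (m : ℝ) else 0 := by
  simp_rw [cas_mul_cas]
  rw [Finset.sum_add_distrib]
  have h1 := congrArg Complex.re (sum_exp_sensor m hm (k - i))
  have h2 := congrArg Complex.im (sum_exp_sensor m hm (k + i))
  rw [Complex.re_sum] at h1
  rw [Complex.im_sum] at h2
  simp only [Complex.exp_ofReal_mul_I_re] at h1
  simp only [Complex.exp_ofReal_mul_I_im] at h2
  rw [h1, h2]
  split_ifs <;> simp

/-! ### The eigenvalues of the covariance operator -/

/-- The eigenvalue of the covariance operator that belongs to the frequency `k`. -/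
def covEigenvalue (l : ℝ) (k : ℤ) : ℝ :=
  l * √(2 * Real.pi) * Real.exp (-(2 * Real.pi ^ 2 * l ^ 2 * (k : ℝ) ^ 2))

theorem covEigenvalue_nonneg {l : ℝ} (hl : 0 < l) (k : ℤ) : 0 ≤ covEigenvalue l k := by
  unfold covEigenvalue; positivity

theorem integrable_gaussian_mul_cas {l : ℝ} (hl : 0 < l) (x : ℝ) (j : ℤ) :
    Integrable fun y => Real.exp (-(x - y) ^ 2 / (2 * l ^ 2)) * cas j y := by
  have hb : 0 < 1 / (2 * l ^ 2) := by positivity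
  have h := (integrable_exp_neg_mul_sq hb).comp_sub_left x
  refine (h.mul_bdd (c := 2) (continuous_cas j).aestronglyMeasurable
    (Filter.Eventually.of_forall fun y => abs_cas_le j y)).congr ?_
  filter_upwards with y
  congr 2
  ring

theorem integral_cos_mul_gaussian {b : ℝ} (hb : 0 < b) (t : ℝ) :
    ∫ x : ℝ, Real.cos (t * x) * Real.exp (-b * x ^ 2) =
      √(Real.pi / b) * Real.exp (-t ^ 2 / (4 * b)) ∧
    ∫ x : ℝ, Real.sin (t * x) * Real.exp (-b * x ^ 2) = 0 := by
  have h := fourierIntegral_gaussian (b := (b : ℂ)) (by simpa using hb) t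
  have hrhs : ((Real.pi : ℂ) / b) ^ (1 / 2 : ℂ) * Complex.exp (-(t : ℂ) ^ 2 / (4 * b)) =
      ((√(Real.pi / b) * Real.exp (-t ^ 2 / (4 * b)) : ℝ) : ℂ) := by
    rw [Real.sqrt_eq_rpow, Complex.ofReal_mul, Complex.ofReal_cpow (by positivity),
      Complex.ofReal_exp]
    push_cast
    rfl
  have hlhs : ∀ x : ℝ, Complex.exp (Complex.I * t * x) * Complex.exp (-b * (x : ℂ) ^ 2) =
      ((Real.cos (t * x) * Real.exp (-b * x ^ 2) : ℝ) : ℂ) +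
        ((Real.sin (t * x) * Real.exp (-b * x ^ 2) : ℝ) : ℂ) * Complex.I := fun x => by
    have : Complex.I * t * x = ((t * x : ℝ) : ℂ) * Complex.I := by push_cast; ring
    rw [this, Complex.exp_mul_I]
    push_cast
    ring
  have hi1 : Integrable fun x : ℝ => Real.cos (t * x) * Real.exp (-b * x ^ 2) :=
    (integrable_exp_neg_mul_sq hb).bdd_mul (c := 1) (by fun_prop)
      (Filter.Eventually.of_forall fun x => Real.abs_cos_le_one _)
  have hi2 : Integrable fun x : ℝ => Real.sin (t * x) * Real.exp (-b * x ^ 2) :=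
    (integrable_exp_neg_mul_sq hb).bdd_mul (c := 1) (by fun_prop)
      (Filter.Eventually.of_forall fun x => Real.abs_sin_le_one _)
  simp_rw [hlhs] at h
  rw [hrhs, integral_add hi1.ofReal (hi2.ofReal.mul_const _), integral_mul_const,
    integral_complex_ofReal, integral_complex_ofReal] at h
  constructor
  · have := congrArg Complex.re h
    rwa [Complex.add_re, Complex.re_ofReal_mul, Complex.ofReal_re, Complex.ofReal_re, Complex.I_re,
      mul_zero, add_zero] at this
  · have := congrArg Complex.im h
    rwa [Complex.add_im, Complex.im_ofReal_mul, Complex.ofReal_im, Complex.ofReal_im, Complex.I_im,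
      mul_one, zero_add] at this

/-- The Gaussian is even, so its sine transform vanishes, and expanding `cas j (x - t)` leaves only
a multiple of `cas j x`. -/
theorem integral_gaussian_mul_cas {l : ℝ} (hl : 0 < l) (x : ℝ) (j : ℤ) :
    ∫ y, Real.exp (-(x - y) ^ 2 / (2 * l ^ 2)) * cas j y = covEigenvalue l j * cas j x := by
  have hb : 0 < 1 / (2 * l ^ 2) := by positivity
  rw [← integral_sub_left_eq_self _ volume x]
  have h : ∀ t : ℝ, Real.exp (-(x - (x - t)) ^ 2 / (2 * l ^ 2)) * cas j (x - t) =
      cas j x * (Real.cos (2 * Real.pi * j * t) * Real.exp (-(1 / (2 * l ^ 2)) * t ^ 2)) +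
      (Real.sin (2 * Real.pi * j * x) - Real.cos (2 * Real.pi * j * x)) *
        (Real.sin (2 * Real.pi * j * t) * Real.exp (-(1 / (2 * l ^ 2)) * t ^ 2)) := fun t => by
    have : -(x - (x - t)) ^ 2 / (2 * l ^ 2) = -(1 / (2 * l ^ 2)) * t ^ 2 := by ring
    rw [this]
    unfold cas
    rw [mul_sub, Real.cos_sub, Real.sin_sub]
    ring
  simp_rw [h]
  obtain ⟨h1, h2⟩ := integral_cos_mul_gaussian hb (2 * Real.pi * j)
  rw [integral_add, integral_const_mul, integral_const_mul, h1, h2]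
  · have e1 : √(Real.pi / (1 / (2 * l ^ 2))) = l * √(2 * Real.pi) := by
      have : Real.pi / (1 / (2 * l ^ 2)) = l ^ 2 * (2 * Real.pi) := by field_simp
      rw [this, Real.sqrt_mul (by positivity), Real.sqrt_sq hl.le]
    have e2 : -(2 * Real.pi * (j : ℝ)) ^ 2 / (4 * (1 / (2 * l ^ 2))) =
        -(2 * Real.pi ^ 2 * l ^ 2 * (j : ℝ) ^ 2) := by field_simp; ring
    rw [e1, e2, covEigenvalue]
    ring
  · exact ((integrable_exp_neg_mul_sq hb).bdd_mul (c := 1) (by fun_prop)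
      (Filter.Eventually.of_forall fun x => Real.abs_cos_le_one _)).const_mul _
  · exact ((integrable_exp_neg_mul_sq hb).bdd_mul (c := 1) (by fun_prop)
      (Filter.Eventually.of_forall fun x => Real.abs_sin_le_one _)).const_mul _

theorem cas_add_int (j n : ℤ) (y : ℝ) : cas j (y + n) = cas j y := by
  have : 2 * Real.pi * j * (y + n) = 2 * Real.pi * j * y + ((j * n : ℤ) : ℝ) * (2 * Real.pi) := by
    push_cast; ring
  unfold cas
  rw [this, Real.cos_add_int_mul_two_pi, Real.sin_add_int_mul_two_pi]

/-- Unfolding: since `cas j` has period `1`, the periodized kernel on the unit interval integrates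
like the Gaussian on the line. -/
theorem integral_periodicRBF_mul_cas {l : ℝ} (hl : 0 < l) (x : ℝ) (j : ℤ) :
    ∫ y in Set.Icc (0 : ℝ) 1, periodicRBF l x y * cas j y = covEigenvalue l j * cas j x := by
  rw [← integral_gaussian_mul_cas hl]
  set F : ℝ → ℝ := fun y => Real.exp (-(x - y) ^ 2 / (2 * l ^ 2)) * cas j y with hF
  have hFi : Integrable F := integrable_gaussian_mul_cas hl x j
  have h1 := hFi.hasSum_intervalIntegral_comp_add_int
  have h2 := hFi.norm.hasSum_intervalIntegral_comp_add_int
  simp only [intervalIntegral.integral_of_le zero_le_one, ← integral_Icc_eq_integral_Ioc] at h1 h2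
  have h3 := hasSum_integral_of_summable_integral_norm
    (F := fun (n : ℤ) y => F (y + n)) (μ := unitVol)
    (fun n => (hFi.comp_add_right (n : ℝ)).restrict) h2.summable
  rw [← h3.unique h1]
  refine setIntegral_congr_fun measurableSet_Icc fun y _ => ?_
  simp only [periodicRBF, ← tsum_mul_right]
  refine tsum_congr fun n => ?_
  simp only [hF, cas_add_int]
  congr 4
  ring

theorem integral_inner_casL_mul {l : ℝ} {μ : Measure L2} (hl : 0 < l) (hμ : IsRBFGaussian l μ)
    (k j : ℤ) : ∫ f : L2, (inner ℝ (casL k) f : ℝ) * (inner ℝ (casL j) f : ℝ) ∂μ =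
      if k = j then covEigenvalue l k else 0 := by
  have h := hμ.covariance (casL k) (casL j)
  simp_rw [real_inner_comm (casL j)] at h
  rw [h]
  have h1 : ∀ x, ∫ y in Set.Icc (0 : ℝ) 1, periodicRBF l x y * casL j y =
      covEigenvalue l j * cas j x := fun x => by
    rw [← integral_periodicRBF_mul_cas hl]
    refine integral_congr_ae ?_
    filter_upwards [coeFn_casL j] with y hy
    rw [hy]
  simp_rw [h1]
  have h2 : ∫ x in Set.Icc (0 : ℝ) 1, casL k x * (covEigenvalue l j * cas j x) =
      ∫ x in Set.Icc (0 : ℝ) 1, covEigenvalue l j * (cas k x * cas j x) := by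
    refine integral_congr_ae ?_
    filter_upwards [coeFn_casL k] with y hy
    rw [hy]
    ring
  rw [h2, integral_unitVol, intervalIntegral.integral_const_mul, integral_cas_mul_cas]
  split_ifs with hkj
  · rw [hkj, mul_one]
  · simp

/-! ### Sums of eigenvalues -/

theorem sum_exp_neg_mul_sq_le {c : ℝ} (hc : 0 < c) (n : ℕ) :
    ∑ j ∈ Finset.range n, Real.exp (-c * ((j : ℝ) + 1) ^ 2) ≤ √(Real.pi / c) := by
  have hanti : AntitoneOn (fun x : ℝ => Real.exp (-c * x ^ 2)) (Set.Icc 0 (0 + (n : ℝ))) := by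
    intro x hx y hy hxy
    simp only [Real.exp_le_exp]
    have : x ^ 2 ≤ y ^ 2 := pow_le_pow_left₀ hx.1 hxy 2
    nlinarith
  have h := hanti.sum_le_integral
  simp only [zero_add, Nat.cast_add, Nat.cast_one] at h
  refine h.trans ?_
  rw [← integral_gaussian, intervalIntegral.integral_of_le (Nat.cast_nonneg n)]
  exact setIntegral_le_integral (integrable_exp_neg_mul_sq hc)
    (Filter.Eventually.of_forall fun x => (Real.exp_pos _).le)

theorem summable_exp_neg_mul_sq_int {c : ℝ} (hc : 0 < c) :
    Summable fun k : ℤ => Real.exp (-c * (k : ℝ) ^ 2) := by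
  have h : Summable fun n : ℕ => Real.exp (-c * (n : ℝ) ^ 2) := by
    rw [← summable_nat_add_iff 1]
    refine summable_of_sum_range_le (fun n => (Real.exp_pos _).le) (c := √(Real.pi / c)) fun n => ?_
    simpa using sum_exp_neg_mul_sq_le hc n
  exact Summable.of_nat_of_neg (by simpa using h) (by simpa using h)

theorem summable_covEigenvalue {l : ℝ} (hl : 0 < l) : Summable (covEigenvalue l) := by
  have h : 0 < 2 * Real.pi ^ 2 * l ^ 2 := by positivity
  refine ((summable_exp_neg_mul_sq_int h).mul_left (l * √(2 * Real.pi))).congr fun k => ?_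
  rw [covEigenvalue, neg_mul]

/-- Half of each exponent gap is kept to sum a shifted Gaussian by its integral. That integral is of
order `1 / l` and cancels the prefactor `l √(2π)`, so the constant does not degenerate as `l → 0`.
-/
theorem tsum_covEigenvalue_tail_le {l : ℝ} (hl : 0 < l) {κ : ℝ} (hκ : 0 ≤ κ) (n : ℕ)
    (hn : κ ≤ n + 1 / 2) :
    ∑' k : ℤ, (if n < k.natAbs then covEigenvalue l k else 0) ≤
      4 * Real.exp (-(2 * Real.pi ^ 2 * l ^ 2 * κ ^ 2)) := by
  set F : ℤ → ℝ := fun k => if n < k.natAbs then covEigenvalue l k else 0 with hF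
  have hFs : Summable F := by
    refine Summable.of_nonneg_of_le (fun k => ?_) (fun k => ?_) (summable_covEigenvalue hl)
    · simp only [hF]; split_ifs
      exacts [covEigenvalue_nonneg hl k, le_rfl]
    · simp only [hF]; split_ifs
      exacts [le_rfl, covEigenvalue_nonneg hl k]
  have h0 : F 0 = 0 := by simp [hF]
  have heven : ∀ j : ℤ, F (-j) = F j := fun j => by simp [hF, covEigenvalue]
  have h1 := hFs.hasSum.nat_add_neg
  simp only [heven, h0, add_zero] at h1
  have hNs : Summable fun j : ℕ => F j := by
    have := h1.summable.mul_left (1 / 2)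
    refine this.congr fun j => by ring
  have h2 : ∑' k, F k = 2 * ∑' j : ℕ, F (j + (n + 1) : ℕ) := by
    have h3 := hNs.sum_add_tsum_nat_add (n + 1)
    have h4 : ∑ j ∈ Finset.range (n + 1), F (j : ℤ) = 0 := Finset.sum_eq_zero fun j hj => by
      have : ¬ n < j := by have := Finset.mem_range.1 hj; lia
      simp [hF, this]
    rw [← h1.tsum_eq, hNs.tsum_add hNs, ← h3, h4]
    ring
  have hc : 0 < Real.pi ^ 2 * l ^ 2 / 2 := by positivity
  set c := Real.pi ^ 2 * l ^ 2 / 2 with hcdef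
  set A := l * √(2 * Real.pi) * Real.exp (-(2 * Real.pi ^ 2 * l ^ 2 * κ ^ 2)) with hA
  have hterm : ∀ j : ℕ, F (j + (n + 1) : ℕ) ≤ A * Real.exp (-c * ((j : ℝ) + 1) ^ 2) := fun j => by
    have : n < ((j + (n + 1) : ℕ) : ℤ).natAbs := by rw [Int.natAbs_natCast]; lia
    simp only [hF, this, if_true, covEigenvalue, hA]
    rw [mul_assoc _ (Real.exp _), ← Real.exp_add]
    refine mul_le_mul_of_nonneg_left (Real.exp_le_exp.2 ?_) (by positivity)
    have hj : (0 : ℝ) ≤ j := Nat.cast_nonneg j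
    -- From `κ ≤ n + 1/2` one gets `j + n + 1 ≥ κ + (j + 1) / 2`; now square and drop the mixed
    -- term.
    have h5 : κ ^ 2 + ((j : ℝ) + 1) ^ 2 / 4 ≤ (((j + (n + 1) : ℕ) : ℤ) : ℝ) ^ 2 := by
      push_cast
      nlinarith
    have h6 : c * ((j : ℝ) + 1) ^ 2 = 2 * Real.pi ^ 2 * l ^ 2 * (((j : ℝ) + 1) ^ 2 / 4) := by
      rw [hcdef]; ring
    rw [neg_mul, h6]
    have := mul_le_mul_of_nonneg_left h5 (by positivity : 0 ≤ 2 * Real.pi ^ 2 * l ^ 2)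
    linarith
  have h7 : ∑' j : ℕ, F (j + (n + 1) : ℕ) ≤ A * √(Real.pi / c) := by
    refine Real.tsum_le_of_sum_range_le (fun j => ?_) fun N => ?_
    · simp only [hF]; split_ifs
      exacts [covEigenvalue_nonneg hl _, le_rfl]
    · refine (Finset.sum_le_sum fun j _ => hterm j).trans ?_
      rw [← Finset.mul_sum]
      exact mul_le_mul_of_nonneg_left (sum_exp_neg_mul_sq_le hc N) (by positivity)
  have h8 : l * √(2 * Real.pi) * √(Real.pi / c) = 2 := by
    rw [mul_assoc, ← Real.sqrt_mul (by positivity)]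
    have : 2 * Real.pi * (Real.pi / c) = (2 / l) ^ 2 := by rw [hcdef]; field_simp
    rw [this, Real.sqrt_sq (by positivity)]
    field_simp
  rw [h2]
  calc 2 * ∑' j : ℕ, F (j + (n + 1) : ℕ) ≤ 2 * (A * √(Real.pi / c)) := by gcongr
    _ = 2 * (l * √(2 * Real.pi) * √(Real.pi / c)) *
        Real.exp (-(2 * Real.pi ^ 2 * l ^ 2 * κ ^ 2)) := by rw [hA]; ring
    _ = _ := by rw [h8]; ring

/-- The eigenvalue at frequency `0` is `l √(2π) ≤ 3 l`, and the others sum to at most `4`. The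
linear term is why the final constant involves `lmax`. -/
theorem tsum_covEigenvalue_le {l : ℝ} (hl : 0 < l) :
    ∑' k, covEigenvalue l k ≤ 3 * l + 4 := by
  have h := tsum_covEigenvalue_tail_le hl le_rfl 0 (by norm_num)
  have h0 : ∀ k : ℤ, (if 0 < k.natAbs then covEigenvalue l k else 0) =
      if k = 0 then 0 else covEigenvalue l k := fun k => by
    by_cases hk : k = 0 <;> simp [hk]
  simp_rw [h0] at h
  rw [(summable_covEigenvalue hl).tsum_eq_add_tsum_ite 0]
  have h1 : covEigenvalue l 0 ≤ 3 * l := by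
    have : √(2 * Real.pi) ≤ 3 := by
      rw [Real.sqrt_le_left (by norm_num)]
      linarith [Real.pi_lt_four]
    simp only [covEigenvalue, Int.cast_zero, ne_eq, OfNat.ofNat_ne_zero, not_false_eq_true,
      zero_pow, mul_zero, neg_zero, Real.exp_zero, mul_one]
    nlinarith
  simp only [ne_eq, OfNat.ofNat_ne_zero, not_false_eq_true, zero_pow, mul_zero, neg_zero,
      Real.exp_zero, mul_one] at h
  linarith

/-! ### The Gaussian measure -/

instance secondCountableTopology_L2 : SecondCountableTopology L2 :=
  have : Fact ((2 : ENNReal) ≠ ⊤) := ⟨by norm_num⟩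
  Lp.SecondCountableTopology

theorem memLp_inner_casL {l : ℝ} {μ : Measure L2} (hμ : IsRBFGaussian l μ) (k : ℤ) :
    MemLp (fun f : L2 => (inner ℝ (casL k) f : ℝ)) 2 μ := by
  have := hμ.gaussian
  exact IsGaussian.memLp_dual μ (innerSL ℝ (casL k)) 2 (by simp)

/-- The Hartley coefficients of `f` are uncorrelated under `μ`, so all cross terms vanish in the
mean. -/
theorem integral_norm_sq_sum {l : ℝ} {μ : Measure L2} (hl : 0 < l) (hμ : IsRBFGaussian l μ)
    (s : Finset ℤ) (h : ℤ → L2) :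
    ∫ f : L2, ‖∑ k ∈ s, (inner ℝ (casL k) f : ℝ) • h k‖ ^ 2 ∂μ =
      ∑ k ∈ s, covEigenvalue l k * ‖h k‖ ^ 2 := by
  have hexp : ∀ f : L2, ‖∑ k ∈ s, (inner ℝ (casL k) f : ℝ) • h k‖ ^ 2 =
      ∑ k ∈ s, ∑ j ∈ s, (inner ℝ (casL k) f : ℝ) * (inner ℝ (casL j) f : ℝ) *
        (inner ℝ (h k) (h j) : ℝ) := fun f => by
    rw [← real_inner_self_eq_norm_sq, sum_inner]
    refine Finset.sum_congr rfl fun k _ => ?_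
    rw [inner_sum]
    refine Finset.sum_congr rfl fun j _ => ?_
    rw [real_inner_smul_left, real_inner_smul_right]
    ring
  have hi : ∀ k j : ℤ, Integrable (fun f : L2 => (inner ℝ (casL k) f : ℝ) *
      (inner ℝ (casL j) f : ℝ) * (inner ℝ (h k) (h j) : ℝ)) μ := fun k j =>
    ((memLp_inner_casL hμ k).integrable_mul (memLp_inner_casL hμ j)).mul_const _
  simp_rw [hexp]
  rw [integral_finsetSum _ fun k _ => integrable_finsetSum _ fun j _ => hi k j]
  refine Finset.sum_congr rfl fun k hk => ?_
  rw [integral_finsetSum _ fun j _ => hi k j]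
  simp_rw [integral_mul_const, integral_inner_casL_mul hl hμ]
  simp [hk]

/-- Fatou along a sequence of finite sets tending to `atTop`. It also gives measurability of `F`,
which is not evident when `F` is defined through point values. -/
theorem memLp_of_ae_hasSum {l : ℝ} {μ : Measure L2} (hl : 0 < l) (hμ : IsRBFGaussian l μ)
    {h : ℤ → L2} {F : L2 → L2}
    (hF : ∀ᵐ f ∂μ, HasSum (fun k => (inner ℝ (casL k) f : ℝ) • h k) (F f))
    (hs : Summable fun k => covEigenvalue l k * ‖h k‖ ^ 2) :
    MemLp F 2 μ ∧ ∫ f, ‖F f‖ ^ 2 ∂μ ≤ ∑' k, covEigenvalue l k * ‖h k‖ ^ 2 := by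
  obtain ⟨s, hsT⟩ := Filter.exists_seq_tendsto (Filter.atTop : Filter (Finset ℤ))
  set S : ℕ → L2 → L2 := fun n f => ∑ k ∈ s n, (inner ℝ (casL k) f : ℝ) • h k with hS
  have hSc : ∀ n, Continuous (S n) := fun n => by simp only [hS]; fun_prop
  have hlim : ∀ᵐ f ∂μ, Filter.Tendsto (fun n => S n f) Filter.atTop (nhds (F f)) := by
    filter_upwards [hF] with f hf
    have hf' : Filter.Tendsto (fun t : Finset ℤ => ∑ k ∈ t, (inner ℝ (casL k) f : ℝ) • h k)
      Filter.atTop (nhds (F f)) := by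
      simpa only [HasSum, SummationFilter.unconditional_filter] using hf
    exact hf'.comp hsT
  set T := ∑' k, covEigenvalue l k * ‖h k‖ ^ 2 with hT
  have hT0 : 0 ≤ T := tsum_nonneg fun k => mul_nonneg (covEigenvalue_nonneg hl k) (sq_nonneg _)
  have hSm : ∀ n, MemLp (S n) 2 μ := fun n => by
    simp only [hS]
    refine memLp_finsetSum _ fun k _ => ?_
    refine MemLp.of_le_mul (c := ‖h k‖) (memLp_inner_casL hμ k)
      (Continuous.aestronglyMeasurable (by fun_prop)) (Filter.Eventually.of_forall fun f => ?_)
    rw [norm_smul, mul_comm]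
  have hbound : ∀ n, eLpNorm (S n) 2 μ ≤ ENNReal.ofReal (√T) := fun n => by
    rw [(hSm n).eLpNorm_eq_integral_rpow_norm (by norm_num) (by norm_num)]
    refine ENNReal.ofReal_le_ofReal ?_
    simp only [ENNReal.toReal_ofNat, Real.rpow_ofNat]
    rw [Real.sqrt_eq_rpow, ← one_div]
    refine Real.rpow_le_rpow (by positivity) ?_ (by norm_num)
    rw [integral_norm_sq_sum hl hμ]
    exact hs.sum_le_tsum _ fun k _ => mul_nonneg (covEigenvalue_nonneg hl k) (sq_nonneg _)
  have hmeas : AEStronglyMeasurable F μ :=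
    aestronglyMeasurable_of_tendsto_ae Filter.atTop (fun n => (hSc n).aestronglyMeasurable) hlim
  have hle : eLpNorm F 2 μ ≤ ENNReal.ofReal (√T) :=
    (Lp.eLpNorm_lim_le_liminf_eLpNorm (fun n => (hSc n).aestronglyMeasurable) F hlim).trans
      (Filter.liminf_le_of_frequently_le' (Filter.Frequently.of_forall hbound))
  have hm : MemLp F 2 μ := ⟨hmeas, hle.trans_lt ENNReal.ofReal_lt_top⟩
  refine ⟨hm, ?_⟩
  rw [hm.eLpNorm_eq_integral_rpow_norm (by norm_num) (by norm_num),
    ENNReal.ofReal_le_ofReal_iff (Real.sqrt_nonneg _)] at hle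
  simp only [ENNReal.toReal_ofNat, Real.rpow_ofNat] at hle
  rw [← one_div, ← Real.sqrt_eq_rpow] at hle
  exact (Real.sqrt_le_sqrt_iff hT0).1 hle

theorem ae_summable_of_summable_integral {Ω : Type*} [MeasurableSpace Ω] {μ : Measure Ω}
    {F : ℤ → Ω → ℝ} (hi : ∀ k, Integrable (F k) μ) (h0 : ∀ k v, 0 ≤ F k v)
    (hs : Summable fun k => ∫ v, F k v ∂μ) : ∀ᵐ v ∂μ, Summable fun k => F k v := by
  have hm : ∀ k, AEMeasurable (fun v => ENNReal.ofReal (F k v)) μ :=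
    fun k => (hi k).aestronglyMeasurable.aemeasurable.ennreal_ofReal
  have h1 : ∫⁻ v, ∑' k, ENNReal.ofReal (F k v) ∂μ ≠ ⊤ := by
    rw [lintegral_tsum hm]
    simp_rw [← fun k => ofReal_integral_eq_lintegral_ofReal (hi k)
      (Filter.Eventually.of_forall (h0 k))]
    exact hs.tsum_ofReal_ne_top
  filter_upwards [ae_lt_top' (AEMeasurable.tsum hm) h1] with v hv
  have := ENNReal.summable_toReal hv.ne
  simpa [ENNReal.toReal_ofReal (h0 _ v)] using this

/-- The eigenvalues are proportional to `w k ^ 2` with `w` summable. Hence the sum of `ξ k ^ 2 / w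
k` over the coefficients `ξ k` of `f` has finite mean, and `|ξ k| ≤ w k + ξ k ^ 2 / w k`. -/
theorem ae_summable_inner_casL {l : ℝ} {μ : Measure L2} (hl : 0 < l) (hμ : IsRBFGaussian l μ) :
    ∀ᵐ f ∂μ, Summable fun k => |(inner ℝ (casL k) f : ℝ)| := by
  set w : ℤ → ℝ := fun k => Real.exp (-(Real.pi ^ 2 * l ^ 2) * (k : ℝ) ^ 2) with hw
  have hw0 : ∀ k, 0 < w k := fun k => Real.exp_pos _
  have hws : Summable w := summable_exp_neg_mul_sq_int (by positivity)
  have hlam : ∀ k, covEigenvalue l k = l * √(2 * Real.pi) * w k ^ 2 := fun k => by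
    rw [covEigenvalue, hw, ← Real.exp_nat_mul]
    congr 2
    push_cast
    ring
  have h1 : ∀ᵐ f ∂μ, Summable fun k => (w k)⁻¹ * (inner ℝ (casL k) f : ℝ) ^ 2 := by
    refine ae_summable_of_summable_integral
      (fun k => (memLp_inner_casL hμ k).integrable_sq.const_mul _)
      (fun k f => mul_nonneg (inv_nonneg.2 (hw0 k).le) (sq_nonneg _)) ?_
    refine (hws.mul_left (l * √(2 * Real.pi))).congr fun k => ?_
    have := integral_inner_casL_mul hl hμ k k
    simp only [if_true, ← sq] at this
    rw [integral_const_mul, this, hlam]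
    field_simp [(hw0 k).ne']
  filter_upwards [h1] with f hf
  refine Summable.of_nonneg_of_le (fun k => abs_nonneg _) (fun k => ?_) (hws.add hf)
  have hk := hw0 k
  set x : ℝ := inner ℝ (casL k) f
  have : w k * ((w k)⁻¹ * x ^ 2) = |x| ^ 2 := by rw [sq_abs]; field_simp
  have h2 : 0 ≤ (w k)⁻¹ * x ^ 2 := by positivity
  nlinarith [sq_nonneg (w k - (w k)⁻¹ * x ^ 2), abs_nonneg x,
    abs_le_of_sq_le_sq' (a := |x|) (b := w k + (w k)⁻¹ * x ^ 2) (by nlinarith) (by positivity)]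

/-! ### Trigonometric projection from the sensor values -/

/-- The discrete Hartley coefficient of the sensor values `v`. -/
def sampleCoeff (m : ℕ) (i : ℤ) (v : Fin m → ℝ) : ℝ :=
  (1 / m) * ∑ j : Fin m, cas i (((j : ℝ) + 1) / m) * v j

/-- The trigonometric polynomial of degree `n` with the discrete Hartley coefficients of `v`. -/
def sampleProj (m n : ℕ) : (Fin m → ℝ) →ₗ[ℝ] L2 where
  toFun v := ∑ i ∈ Finset.Icc (-(n : ℤ)) n, sampleCoeff m i v • casL i
  map_add' v w := by
    rw [← Finset.sum_add_distrib]
    refine Finset.sum_congr rfl fun i _ => ?_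
    rw [← add_smul]
    simp only [sampleCoeff, Pi.add_apply, mul_add, Finset.sum_add_distrib]
  map_smul' c v := by
    rw [RingHom.id_apply, Finset.smul_sum]
    refine Finset.sum_congr rfl fun i _ => ?_
    rw [smul_smul]
    simp only [sampleCoeff, Pi.smul_apply, smul_eq_mul, Finset.mul_sum]
    congr 1
    exact Finset.sum_congr rfl fun j _ => by ring

theorem sampleProj_apply (m n : ℕ) (v : Fin m → ℝ) :
    sampleProj m n v = ∑ i ∈ Finset.Icc (-(n : ℤ)) n, sampleCoeff m i v • casL i := rfl

/-- The values of a function at the sensors `j / m`. -/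
def sensorValues (m : ℕ) (g : ℝ → ℝ) : Fin m → ℝ := fun j => g (((j : ℝ) + 1) / m)

/-- Two frequencies in the range differ by at most `2n < m`, so they cannot alias. -/
theorem sampleCoeff_sensorValues_cas {m n : ℕ} (hm : 2 * n + 1 ≤ m) {i k : ℤ}
    (hi : i ∈ Finset.Icc (-(n : ℤ)) n) (hk : k ∈ Finset.Icc (-(n : ℤ)) n) :
    sampleCoeff m i (sensorValues m (cas k)) = if i = k then 1 else 0 := by
  have hm0 : (m : ℝ) ≠ 0 := by exact_mod_cast (by lia : m ≠ 0)
  simp only [sampleCoeff, sensorValues]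
  rw [sum_cas_mul_cas_sensor m (by lia) i k]
  have : (m : ℤ) ∣ i - k ↔ i = k := by
    rw [Finset.mem_Icc] at hi hk
    constructor
    · intro hd
      have := Int.eq_zero_of_abs_lt_dvd hd (by rw [abs_lt]; constructor <;> lia)
      lia
    · rintro rfl; simp
  simp only [this]
  split_ifs
  · field_simp
  · simp

theorem sampleProj_sensorValues_cas {m n : ℕ} (hm : 2 * n + 1 ≤ m) {k : ℤ}
    (hk : k ∈ Finset.Icc (-(n : ℤ)) n) : sampleProj m n (sensorValues m (cas k)) = casL k := by
  rw [sampleProj_apply, Finset.sum_congr rfl fun i hi => by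
    rw [sampleCoeff_sensorValues_cas hm hi hk]]
  simp only [ite_smul, one_smul, zero_smul, Finset.sum_ite_eq', hk, if_true]

theorem norm_sq_sum_casL (s : Finset ℤ) (c : ℤ → ℝ) :
    ‖∑ i ∈ s, c i • casL i‖ ^ 2 = ∑ i ∈ s, c i ^ 2 := by
  rw [← real_inner_self_eq_norm_sq, orthonormal_casL.inner_sum]
  simp [sq]

/-- Bessel's inequality for the discrete inner product: the residual of `v` after projection has
nonnegative squared norm. -/
theorem norm_sq_sampleProj_le {m n : ℕ} (hm : 2 * n + 1 ≤ m) (v : Fin m → ℝ) :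
    ‖sampleProj m n v‖ ^ 2 ≤ (1 / m) * ∑ j, v j ^ 2 := by
  have hm0 : (0 : ℝ) < m := by exact_mod_cast (by lia : 0 < m)
  rw [sampleProj_apply, norm_sq_sum_casL]
  set s := Finset.Icc (-(n : ℤ)) n
  set c : ℤ → ℝ := fun i => sampleCoeff m i v with hc
  set x : Fin m → ℝ := fun j => ((j : ℝ) + 1) / m with hx
  have h1 : ∀ i, ∑ j, cas i (x j) * v j = m * c i := fun i => by
    simp only [hc, sampleCoeff, hx]
    field_simp
  have h2 : ∀ i ∈ s, ∀ k ∈ s, ∑ j, cas i (x j) * cas k (x j) = m * if i = k then 1 else 0 :=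
    fun i hi k hk => by
      have := sampleCoeff_sensorValues_cas hm hi hk
      simp only [sampleCoeff, sensorValues] at this
      rw [← this]
      field_simp
      rfl
  have h3 : ∑ j, (∑ i ∈ s, c i * cas i (x j)) * v j = m * ∑ i ∈ s, c i ^ 2 := by
    simp_rw [Finset.sum_mul]
    rw [Finset.sum_comm, Finset.mul_sum]
    refine Finset.sum_congr rfl fun i _ => ?_
    simp_rw [mul_assoc]
    rw [← Finset.mul_sum, h1]
    ring
  have h4 : ∑ j, (∑ i ∈ s, c i * cas i (x j)) * (∑ i ∈ s, c i * cas i (x j)) =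
      m * ∑ i ∈ s, c i ^ 2 := by
    simp_rw [Finset.sum_mul_sum]
    rw [Finset.sum_comm, Finset.mul_sum]
    refine Finset.sum_congr rfl fun i hi => ?_
    rw [Finset.sum_comm]
    have : ∀ k ∈ s, ∑ j, c i * cas i (x j) * (c k * cas k (x j)) =
        c i * c k * (m * if i = k then 1 else 0) := fun k hk => by
      rw [← h2 i hi k hk, Finset.mul_sum]
      exact Finset.sum_congr rfl fun j _ => by ring
    rw [Finset.sum_congr rfl this]
    simp only [mul_ite, mul_one, mul_zero, Finset.sum_ite_eq, hi, if_true]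
    ring
  have h5 : 0 ≤ ∑ j, (v j - ∑ i ∈ s, c i * cas i (x j)) ^ 2 :=
    Finset.sum_nonneg fun j _ => sq_nonneg _
  have h6 : ∑ j, (v j - ∑ i ∈ s, c i * cas i (x j)) ^ 2 = ∑ j, v j ^ 2 -
      2 * (∑ j, (∑ i ∈ s, c i * cas i (x j)) * v j) +
      ∑ j, (∑ i ∈ s, c i * cas i (x j)) * (∑ i ∈ s, c i * cas i (x j)) := by
    rw [Finset.mul_sum, ← Finset.sum_sub_distrib, ← Finset.sum_add_distrib]
    exact Finset.sum_congr rfl fun j _ => by ring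
  rw [h6, h3, h4] at h5
  rw [one_div, ← div_eq_inv_mul, le_div_iff₀ hm0]
  linarith

/-- Used for the high frequencies, which may alias onto low ones: only boundedness of the result is
needed. -/
theorem norm_sampleProj_cas_le {m n : ℕ} (hm : 2 * n + 1 ≤ m) (k : ℤ) :
    ‖sampleProj m n (sensorValues m (cas k))‖ ≤ 2 := by
  have hm0 : (0 : ℝ) < m := by exact_mod_cast (by lia : 0 < m)
  refine abs_le_of_sq_le_sq' ?_ (by norm_num) |>.2
  refine (norm_sq_sampleProj_le hm _).trans ?_
  have : ∑ j, sensorValues m (cas k) j ^ 2 ≤ ∑ _j : Fin m, (2 : ℝ) ^ 2 :=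
    Finset.sum_le_sum fun j _ => sq_le_sq' (abs_le.1 (abs_cas_le _ _)).1 (abs_le.1 (abs_cas_le _ _)).2
  rw [Finset.sum_const, Finset.card_univ, Fintype.card_fin, nsmul_eq_mul] at this
  calc 1 / (m : ℝ) * ∑ j, sensorValues m (cas k) j ^ 2 ≤ 1 / (m : ℝ) * (m * 2 ^ 2) := by gcongr
    _ = 2 ^ 2 := by field_simp

/-! ### Random Hartley series at the sensors and the mean-square projection error. -/

theorem hasSum_encoder {m : ℕ} {f : L2}
    (h : Summable fun k => |(inner ℝ (casL k) f : ℝ)|) :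
    HasSum (fun k => (inner ℝ (casL k) f : ℝ) • sensorValues m (cas k)) (encoder m f) := by
  rw [Pi.hasSum]
  intro j
  have hm : (0 : ℝ) < m := by exact_mod_cast j.pos
  have hj : ((j : ℝ) + 1) ≤ m := by exact_mod_cast j.isLt
  refine pointEval_eq_tsum f h ⟨by positivity, ?_⟩
  rwa [div_le_one hm]

theorem hasSum_sampleProj_encoder {m : ℕ} (n : ℕ) {f : L2}
    (h : Summable fun k => |(inner ℝ (casL k) f : ℝ)|) :
    HasSum (fun k => (inner ℝ (casL k) f : ℝ) • sampleProj m n (sensorValues m (cas k)))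
      (sampleProj m n (encoder m f)) := by
  simpa using (hasSum_encoder h).mapL (LinearMap.toContinuousLinearMap (sampleProj m n))

variable {l : ℝ} {μ : Measure L2}

theorem memLp_sampleProj_encoder (hl : 0 < l) (hμ : IsRBFGaussian l μ) {m n : ℕ}
    (hm : 2 * n + 1 ≤ m) :
    MemLp (fun f => sampleProj m n (encoder m f)) 2 μ ∧
      ∫ f, ‖sampleProj m n (encoder m f)‖ ^ 2 ∂μ ≤ 4 * (3 * l + 4) := by
  have hle : ∀ k, covEigenvalue l k * ‖sampleProj m n (sensorValues m (cas k))‖ ^ 2 ≤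
      4 * covEigenvalue l k := fun k => by
    have h1 := norm_sampleProj_cas_le hm k
    have h2 := covEigenvalue_nonneg hl k
    have h3 : ‖sampleProj m n (sensorValues m (cas k))‖ ^ 2 ≤ 2 ^ 2 :=
      pow_le_pow_left₀ (norm_nonneg _) h1 2
    nlinarith
  have hs4 := (summable_covEigenvalue hl).mul_left 4
  have hs : Summable fun k => covEigenvalue l k *
      ‖sampleProj m n (sensorValues m (cas k))‖ ^ 2 :=
    Summable.of_nonneg_of_le (fun k => mul_nonneg (covEigenvalue_nonneg hl k) (sq_nonneg _)) hle hs4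
  obtain ⟨h1, h2⟩ := memLp_of_ae_hasSum hl hμ (F := fun f => sampleProj m n (encoder m f))
    ((ae_summable_inner_casL hl hμ).mono fun f hf => hasSum_sampleProj_encoder n hf) hs
  refine ⟨h1, h2.trans ((hs.tsum_le_tsum hle hs4).trans ?_)⟩
  rw [tsum_mul_left]
  have := tsum_covEigenvalue_le hl
  linarith

/-- Frequencies up to `n` are reproduced and contribute nothing. The others contribute at most `(1 +
2)²` times their eigenvalue, and `36 = 9 * 4`. -/
theorem memLp_sub_sampleProj_encoder (hl : 0 < l) (hμ : IsRBFGaussian l μ) {m n : ℕ}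
    (hm : 2 * n + 1 ≤ m) {κ : ℝ} (hκ : 0 ≤ κ) (hn : κ ≤ n + 1 / 2) :
    MemLp (fun f => f - sampleProj m n (encoder m f)) 2 μ ∧
      ∫ f, ‖f - sampleProj m n (encoder m f)‖ ^ 2 ∂μ ≤
        36 * Real.exp (-(2 * Real.pi ^ 2 * l ^ 2 * κ ^ 2)) := by
  set h : ℤ → L2 := fun k => casL k - sampleProj m n (sensorValues m (cas k)) with hh
  have hle : ∀ k, covEigenvalue l k * ‖h k‖ ^ 2 ≤
      9 * if n < k.natAbs then covEigenvalue l k else 0 := fun k => by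
    have h2 := covEigenvalue_nonneg hl k
    split_ifs with hk
    · have h1 : ‖h k‖ ≤ 3 := by
        refine (norm_sub_le _ _).trans ?_
        rw [orthonormal_casL.1 k]
        linarith [norm_sampleProj_cas_le hm k]
      have h3 : ‖h k‖ ^ 2 ≤ 3 ^ 2 := pow_le_pow_left₀ (norm_nonneg _) h1 2
      nlinarith
    · have : h k = 0 := by
        rw [hh]
        simp only
        rw [sampleProj_sensorValues_cas hm (Finset.mem_Icc.2 ⟨by lia, by lia⟩), sub_self]
      simp [this]
  have hs9 : Summable fun k : ℤ => 9 * if n < k.natAbs then covEigenvalue l k else 0 := by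
    refine Summable.mul_left 9 (Summable.of_nonneg_of_le (fun k => ?_) (fun k => ?_)
      (summable_covEigenvalue hl))
    · split_ifs
      exacts [covEigenvalue_nonneg hl k, le_rfl]
    · split_ifs
      exacts [le_rfl, covEigenvalue_nonneg hl k]
  have hs : Summable fun k => covEigenvalue l k * ‖h k‖ ^ 2 :=
    Summable.of_nonneg_of_le (fun k => mul_nonneg (covEigenvalue_nonneg hl k) (sq_nonneg _)) hle hs9
  obtain ⟨h1, h2⟩ := memLp_of_ae_hasSum hl hμ (F := fun f => f - sampleProj m n (encoder m f))
    (h := h) ((ae_summable_inner_casL hl hμ).mono fun f hf => by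
      simpa only [hh, smul_sub] using (hasSum_casL f).sub (hasSum_sampleProj_encoder n hf)) hs
  refine ⟨h1, h2.trans ((hs.tsum_le_tsum hle hs9).trans ?_)⟩
  rw [tsum_mul_left]
  have := tsum_covEigenvalue_tail_le hl hκ n hn
  linarith

/-! ### The first-order terminal value problem -/

/-- The solution of `-ε T' + a T = r`, `T 1 = 0`. -/
def transport (ε : ℝ) (a r : ℝ → ℝ) (x : ℝ) : ℝ :=
  ε⁻¹ * Real.exp ((∫ s in (0 : ℝ)..x, a s) / ε) *
    ∫ t in x..1, Real.exp (-((∫ s in (0 : ℝ)..t, a s) / ε)) * r t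

section Transport

variable {ε α : ℝ} {a r : ℝ → ℝ}

theorem hasDerivAt_primitive (ha : Continuous a) (x : ℝ) :
    HasDerivAt (fun x => ∫ s in (0 : ℝ)..x, a s) (a x) x :=
  intervalIntegral.integral_hasDerivAt_right (ha.intervalIntegrable _ _)
    (ha.stronglyMeasurableAtFilter _ _) ha.continuousAt

@[fun_prop]
theorem continuous_primitive (ha : Continuous a) :
    Continuous fun x => ∫ s in (0 : ℝ)..x, a s :=
  continuous_iff_continuousAt.2 fun x => (hasDerivAt_primitive ha x).continuousAt

theorem hasDerivAt_transport (hε : 0 < ε) (ha : Continuous a) (hr : Continuous r) (x : ℝ) :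
    HasDerivAt (transport ε a r) ((a x * transport ε a r x - r x) / ε) x := by
  have hA := hasDerivAt_primitive ha x
  have hc : Continuous fun t => Real.exp (-((∫ s in (0 : ℝ)..t, a s) / ε)) * r t := by fun_prop
  have h1 : HasDerivAt (fun x => ∫ t in x..1, Real.exp (-((∫ s in (0 : ℝ)..t, a s) / ε)) * r t)
      (-(Real.exp (-((∫ s in (0 : ℝ)..x, a s) / ε)) * r x)) x :=
    intervalIntegral.integral_hasDerivAt_left (hc.intervalIntegrable _ _)
      (hc.stronglyMeasurableAtFilter _ _) hc.continuousAt
  refine ((((hA.div_const ε).exp).const_mul ε⁻¹).mul h1).congr_deriv ?_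
  rw [Real.exp_neg, transport]
  field_simp
  ring

theorem continuous_transport (hε : 0 < ε) (ha : Continuous a) (hr : Continuous r) :
    Continuous (transport ε a r) :=
  continuous_iff_continuousAt.2 fun x => (hasDerivAt_transport hε ha hr x).continuousAt

theorem transport_one : transport ε a r 1 = 0 := by simp [transport]

theorem transport_nonneg (hε : 0 < ε) (hr0 : ∀ x, 0 ≤ r x) {x : ℝ} (hx : x ≤ 1) :
    0 ≤ transport ε a r x := by
  unfold transport
  refine mul_nonneg (by positivity) (intervalIntegral.integral_nonneg hx fun t _ => ?_)
  exact mul_nonneg (Real.exp_pos _).le (hr0 t)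

/-- Integrate the equation: the boundary term `ε T(0)` is nonnegative and can be dropped, so no `ε`
remains. -/
theorem integral_transport_le (hε : 0 < ε) (ha : Continuous a) (hr : Continuous r)
    (hr0 : ∀ x, 0 ≤ r x) (haα : ∀ x ∈ Set.Icc (0 : ℝ) 1, α ≤ a x) :
    α * ∫ x in (0 : ℝ)..1, transport ε a r x ≤ ∫ x in (0 : ℝ)..1, r x := by
  have hT := continuous_transport hε ha hr
  have h1 := intervalIntegral.integral_eq_sub_of_hasDerivAt
    (fun x _ => hasDerivAt_transport hε ha hr x)
    (Continuous.intervalIntegrable (by fun_prop) 0 1)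
  rw [transport_one, intervalIntegral.integral_div, intervalIntegral.integral_sub
    (Continuous.intervalIntegrable (by fun_prop) _ _) (hr.intervalIntegrable _ _)] at h1
  have h0 := transport_nonneg (a := a) hε hr0 zero_le_one
  have h2 : α * ∫ x in (0 : ℝ)..1, transport ε a r x ≤
      ∫ x in (0 : ℝ)..1, a x * transport ε a r x := by
    rw [← intervalIntegral.integral_const_mul]
    refine intervalIntegral.integral_mono_on zero_le_one
      (Continuous.intervalIntegrable (by fun_prop) _ _)
      (Continuous.intervalIntegrable (by fun_prop) _ _) fun x hx => ?_
    exact mul_le_mul_of_nonneg_right (haα x hx) (transport_nonneg hε hr0 hx.2)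
  rw [div_eq_iff hε.ne'] at h1
  nlinarith

/-- Energy estimate: multiply the equation by `2T`, apply Young's inequality to `2 T r`, and drop
the boundary term `ε T(0)²`, which has the favourable sign. -/
theorem integral_transport_sq_le (hε : 0 < ε) (hα : 0 < α) (ha : Continuous a) (hr : Continuous r)
    (haα : ∀ x ∈ Set.Icc (0 : ℝ) 1, α ≤ a x) :
    α ^ 2 * ∫ x in (0 : ℝ)..1, transport ε a r x ^ 2 ≤ ∫ x in (0 : ℝ)..1, r x ^ 2 := by
  have hT := continuous_transport hε ha hr
  have h1 := intervalIntegral.integral_eq_sub_of_hasDerivAt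
    (fun x _ => (hasDerivAt_transport hε ha hr x).pow 2)
    (Continuous.intervalIntegrable (by fun_prop) 0 1)
  simp only [Pi.pow_apply, transport_one] at h1
  have h2 : (∫ x in (0 : ℝ)..1, α * (α * transport ε a r x ^ 2 - α⁻¹ * r x ^ 2)) ≤
      ∫ x in (0 : ℝ)..1, α * (ε * (((2 : ℕ) : ℝ) * transport ε a r x ^ (2 - 1) *
        ((a x * transport ε a r x - r x) / ε))) := by
    refine intervalIntegral.integral_mono_on zero_le_one
      (Continuous.intervalIntegrable (by fun_prop) _ _)
      (Continuous.intervalIntegrable (by fun_prop) _ _) fun x hx => ?_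
    refine mul_le_mul_of_nonneg_left ?_ hα.le
    have e1 := haα x hx
    set T := transport ε a r x
    have e2 : ε * (((2 : ℕ) : ℝ) * T ^ (2 - 1) * ((a x * T - r x) / ε)) =
        2 * a x * T ^ 2 - 2 * T * r x := by
      field_simp; push_cast; ring
    have e3 : α * T ^ 2 - α⁻¹ * r x ^ 2 ≤ 2 * α * T ^ 2 - 2 * T * r x := by
      have : α * T ^ 2 - 2 * T * r x + α⁻¹ * r x ^ 2 = α * (T - α⁻¹ * r x) ^ 2 := by
        field_simp; ring
      nlinarith [mul_nonneg hα.le (sq_nonneg (T - α⁻¹ * r x))]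
    rw [e2]
    nlinarith [sq_nonneg T]
  rw [intervalIntegral.integral_const_mul, intervalIntegral.integral_const_mul,
    intervalIntegral.integral_const_mul, h1, intervalIntegral.integral_sub
    (Continuous.intervalIntegrable (by fun_prop) _ _)
    (Continuous.intervalIntegrable (by fun_prop) _ _), intervalIntegral.integral_const_mul,
    intervalIntegral.integral_const_mul] at h2
  have h3 : α * (α * (∫ x in (0 : ℝ)..1, transport ε a r x ^ 2) -
      α⁻¹ * ∫ x in (0 : ℝ)..1, r x ^ 2) =
      α ^ 2 * (∫ x in (0 : ℝ)..1, transport ε a r x ^ 2) - ∫ x in (0 : ℝ)..1, r x ^ 2 := by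
    field_simp
  rw [h3] at h2
  have h4 : α * (ε * (0 ^ 2 - transport ε a r 0 ^ 2)) ≤ 0 := by
    have : 0 ≤ α * ε * transport ε a r 0 ^ 2 := by positivity
    linarith
  linarith

/-- The comparison principle for `-ε w' + a w ≥ 0`, `w 1 ≥ 0`. -/
theorem nonneg_of_transport_nonneg (hε : 0 < ε) (ha : Continuous a) {w : ℝ → ℝ}
    (hw : ∀ x ∈ Set.Icc (0 : ℝ) 1, HasDerivAt w ((a x * w x - r x) / ε) x)
    (hr0 : ∀ x ∈ Set.Icc (0 : ℝ) 1, 0 ≤ r x) (h1 : 0 ≤ w 1) {x : ℝ}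
    (hx : x ∈ Set.Icc (0 : ℝ) 1) : 0 ≤ w x := by
  -- With the integrating factor `exp (-A / ε)`, where `A' = a`, the function becomes antitone, so
  -- its sign at `1` propagates to the left.
  have hd : ∀ x ∈ Set.Icc (0 : ℝ) 1,
      HasDerivAt (fun x => w x * Real.exp (-((∫ s in (0 : ℝ)..x, a s) / ε)))
        (-(r x / ε * Real.exp (-((∫ s in (0 : ℝ)..x, a s) / ε)))) x := fun x hx => by
    refine ((hw x hx).mul (((hasDerivAt_primitive ha x).div_const ε).fun_neg.exp)).congr_deriv ?_
    field_simp
    ring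
  have hanti : AntitoneOn (fun x => w x * Real.exp (-((∫ s in (0 : ℝ)..x, a s) / ε)))
      (Set.Icc 0 1) := by
    refine antitoneOn_of_deriv_nonpos (convex_Icc 0 1)
      (fun x hx => (hd x hx).continuousAt.continuousWithinAt)
      (fun x hx => (hd x (interior_subset hx)).differentiableAt.differentiableWithinAt)
      fun x hx => ?_
    rw [(hd x (interior_subset hx)).deriv, neg_nonpos]
    exact mul_nonneg (div_nonneg (hr0 x (interior_subset hx)) hε.le) (Real.exp_pos _).le
  have h2 := hanti hx (Set.right_mem_Icc.2 zero_le_one) hx.2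
  have h3 : 0 ≤ w x * Real.exp (-((∫ s in (0 : ℝ)..x, a s) / ε)) :=
    (mul_nonneg h1 (Real.exp_pos _).le).trans h2
  exact nonneg_of_mul_nonneg_left h3 (Real.exp_pos _)

theorem abs_le_of_transport_abs_le (hε : 0 < ε) (ha : Continuous a) {y Y R : ℝ → ℝ}
    (hy : ∀ x ∈ Set.Icc (0 : ℝ) 1, HasDerivAt y ((a x * y x - r x) / ε) x)
    (hY : ∀ x ∈ Set.Icc (0 : ℝ) 1, HasDerivAt Y ((a x * Y x - R x) / ε) x)
    (hr : ∀ x ∈ Set.Icc (0 : ℝ) 1, |r x| ≤ R x) (h1 : |y 1| ≤ Y 1) {x : ℝ}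
    (hx : x ∈ Set.Icc (0 : ℝ) 1) : |y x| ≤ Y x := by
  rw [abs_le] at h1 ⊢
  constructor
  · have := nonneg_of_transport_nonneg (r := fun x => R x + r x) (w := fun x => Y x + y x) hε ha
      (fun x hx => ((hY x hx).add (hy x hx)).congr_deriv (by ring))
      (fun x hx => by linarith [(abs_le.1 (hr x hx)).1]) (by linarith) hx
    linarith
  · have := nonneg_of_transport_nonneg (r := fun x => R x - r x) (w := fun x => Y x - y x) hε ha
      (fun x hx => ((hY x hx).sub (hy x hx)).congr_deriv (by ring))
      (fun x hx => by linarith [(abs_le.1 (hr x hx)).2]) (by linarith) hx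
    linarith

end Transport

/-! ### Integral inequalities on the unit interval -/

theorem integral_abs_le_of_integral_sq_le {g : ℝ → ℝ} (hg : Continuous g) {M : ℝ} (hM : 0 ≤ M)
    (h : ∫ x in (0 : ℝ)..1, g x ^ 2 ≤ M ^ 2) : ∫ x in (0 : ℝ)..1, |g x| ≤ M := by
  set c := ∫ x in (0 : ℝ)..1, |g x| with hc
  have h1 : 0 ≤ ∫ x in (0 : ℝ)..1, (|g x| - c) ^ 2 :=
    intervalIntegral.integral_nonneg zero_le_one fun x _ => sq_nonneg _
  have h2 : ∫ x in (0 : ℝ)..1, (|g x| - c) ^ 2 =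
      (∫ x in (0 : ℝ)..1, g x ^ 2) - 2 * c * c + c ^ 2 := by
    have : ∀ x, (|g x| - c) ^ 2 = g x ^ 2 - 2 * c * |g x| + c ^ 2 := fun x => by
      rw [← sq_abs (g x)]; ring
    simp_rw [this]
    rw [intervalIntegral.integral_add (Continuous.intervalIntegrable (by fun_prop) _ _)
      (Continuous.intervalIntegrable (by fun_prop) _ _), intervalIntegral.integral_sub
      (Continuous.intervalIntegrable (by fun_prop) _ _)
      (Continuous.intervalIntegrable (by fun_prop) _ _), intervalIntegral.integral_const_mul]
    simp [hc]
  exact le_of_sq_le_sq (by nlinarith) hM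

/-- The embedding of `W^{1,1}` into `L^∞`: average `|g x| - ∫ |g'| ≤ |g t|` over `t`. -/
theorem abs_le_integral_abs_add {g g' : ℝ → ℝ} (hg : ∀ x, HasDerivAt g (g' x) x)
    (hg' : Continuous g') {x : ℝ} (hx : x ∈ Set.Icc (0 : ℝ) 1) :
    |g x| ≤ (∫ t in (0 : ℝ)..1, |g t|) + ∫ t in (0 : ℝ)..1, |g' t| := by
  have hgc : Continuous g := continuous_iff_continuousAt.2 fun x => (hg x).continuousAt
  have h1 : ∀ t ∈ Set.Icc (0 : ℝ) 1, |g x| - (∫ t in (0 : ℝ)..1, |g' t|) ≤ |g t| := fun t ht => by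
    have h2 : ∫ s in t..x, g' s = g x - g t :=
      intervalIntegral.integral_eq_sub_of_hasDerivAt (fun s _ => hg s) (hg'.intervalIntegrable _ _)
    have h3 : |∫ s in t..x, g' s| ≤ |(∫ s in t..x, |g' s|)| :=
      intervalIntegral.norm_integral_le_abs_integral_norm (f := g')
    have h4 : |(∫ s in t..x, |g' s|)| ≤ |(∫ s in (0 : ℝ)..1, |g' s|)| := by
      refine intervalIntegral.abs_integral_mono_interval ?_
        (Filter.Eventually.of_forall fun s => abs_nonneg _) (hg'.abs.intervalIntegrable _ _)
      rw [Set.uIoc_of_le zero_le_one]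
      exact Set.uIoc_subset_uIoc_of_uIcc_subset_uIcc (by
        rw [Set.uIcc_of_le zero_le_one]
        exact Set.uIcc_subset_Icc ht hx) |>.trans (by rw [Set.uIoc_of_le zero_le_one])
    have h5 : |(∫ s in (0 : ℝ)..1, |g' s|)| = ∫ s in (0 : ℝ)..1, |g' s| :=
      abs_of_nonneg (intervalIntegral.integral_nonneg zero_le_one fun s _ => abs_nonneg _)
    rw [h2] at h3
    have := abs_sub_abs_le_abs_sub (g x) (g t)
    linarith
  have h6 := intervalIntegral.integral_mono_on (μ := volume) zero_le_one
    (continuous_const.intervalIntegrable 0 1) (hgc.abs.intervalIntegrable 0 1) h1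
  simp only [intervalIntegral.integral_const, sub_zero, one_smul] at h6
  linarith

/-! ### A priori estimates, uniform in `ε` -/

/-- Coefficients of class `C¹` on the line, with bounds on the unit interval. -/
structure Coefficients (a a' b b' : ℝ → ℝ) (α B : ℝ) : Prop where
  pos : 0 < α
  hasDerivAt_a : ∀ x, HasDerivAt a (a' x) x
  hasDerivAt_b : ∀ x, HasDerivAt b (b' x) x
  le_a : ∀ x ∈ Set.Icc (0 : ℝ) 1, α ≤ a x
  abs_a_le : ∀ x ∈ Set.Icc (0 : ℝ) 1, |a x| ≤ B
  abs_b_le : ∀ x ∈ Set.Icc (0 : ℝ) 1, |b x| ≤ B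
  abs_a'_le : ∀ x ∈ Set.Icc (0 : ℝ) 1, |a' x| ≤ B
  abs_b'_le : ∀ x ∈ Set.Icc (0 : ℝ) 1, |b' x| ≤ B

/-- `u` is a classical solution of the boundary value problem, with derivative `z`. -/
structure IsClassicalSolution (ε : ℝ) (a b g u z : ℝ → ℝ) : Prop where
  continuous_z : Continuous z
  hasDerivAt_u : ∀ x, HasDerivAt u (z x) x
  hasDerivAt_z : ∀ x ∈ Set.Icc (0 : ℝ) 1, HasDerivAt z ((a x * z x + b x * u x - g x) / ε) x
  left : u 0 = 0
  right : u 1 = 0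

/-- The bound for the boundary layer part of the second derivative, of thickness `δ`. -/
def layerBound (α δ x : ℝ) : ℝ := (δ ^ 2)⁻¹ * Real.exp (-(α * (1 - x) / δ))

section

variable {a a' b b' g u z : ℝ → ℝ} {α B ε L : ℝ}

theorem Coefficients.continuous_a (h : Coefficients a a' b b' α B) : Continuous a :=
  continuous_iff_continuousAt.2 fun x => (h.hasDerivAt_a x).continuousAt

theorem Coefficients.continuous_b (h : Coefficients a a' b b' α B) : Continuous b :=
  continuous_iff_continuousAt.2 fun x => (h.hasDerivAt_b x).continuousAt

theorem Coefficients.bound_nonneg (h : Coefficients a a' b b' α B) : 0 ≤ B :=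
  (abs_nonneg _).trans (h.abs_a_le 0 (Set.left_mem_Icc.2 zero_le_one))

theorem IsClassicalSolution.continuous_u (h : IsClassicalSolution ε a b g u z) : Continuous u :=
  continuous_iff_continuousAt.2 fun x => (h.hasDerivAt_u x).continuousAt

/-- The `L¹` norm of `g - b u` bounds the solution and the outflow derivative. -/
theorem IsClassicalSolution.abs_le_integral (hc : Coefficients a a' b b' α B) (hε : 0 < ε)
    (hg : Continuous g) (h : IsClassicalSolution ε a b g u z) :
    (∀ x ∈ Set.Icc (0 : ℝ) 1, |u x| ≤ 2 / α * ∫ t in (0 : ℝ)..1, |g t - b t * u t|) ∧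
    |z 1| ≤ Real.exp B / (α * min ε 1) * ∫ t in (0 : ℝ)..1, |g t - b t * u t| := by
  have ha := hc.continuous_a
  have hb := hc.continuous_b
  have hu := h.continuous_u
  have hz := h.continuous_z
  have hα := hc.pos
  set F : ℝ → ℝ := fun x => g x - b x * u x with hF
  have hFc : Continuous F := by fun_prop
  set Φ := ∫ t in (0 : ℝ)..1, |F t| with hΦ
  set T := transport ε a fun x => |F x| with hT
  have hTc : Continuous T := continuous_transport hε ha hFc.abs
  -- The homogeneous solution with `E 1 = 1`. Then `z - z 1 * E` vanishes at `1`, so comparison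
  -- bounds it by `T` although `z 1` is still unknown.
  set E : ℝ → ℝ := fun x =>
    Real.exp (((∫ s in (0 : ℝ)..x, a s) - ∫ s in (0 : ℝ)..1, a s) / ε) with hE
  have hEc : Continuous E := by fun_prop
  have hE0 : ∀ x, 0 < E x := fun x => Real.exp_pos _
  have hE1 : E 1 = 1 := by simp [hE]
  have hEd : ∀ x, HasDerivAt E (a x * E x / ε) x := fun x => by
    refine ((((hasDerivAt_primitive ha x).sub_const _).div_const ε).exp).congr_deriv ?_
    simp only [hE]
    ring
  have hzE : ∀ x ∈ Set.Icc (0 : ℝ) 1, |z x - z 1 * E x| ≤ T x := fun x hx => by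
    refine abs_le_of_transport_abs_le (r := F) (R := fun x => |F x|)
      (y := fun x => z x - z 1 * E x) hε ha (fun x hx => ?_)
      (fun x _ => hasDerivAt_transport hε ha hFc.abs x) (fun x _ => le_rfl) ?_ hx
    · refine ((h.hasDerivAt_z x hx).sub ((hEd x).const_mul (z 1))).congr_deriv ?_
      simp only [hF]
      ring
    · simp [hE1, transport_one]
  have hTint : ∫ x in (0 : ℝ)..1, T x ≤ Φ / α := by
    rw [le_div_iff₀' hα]
    exact integral_transport_le hε ha hFc.abs (fun x => abs_nonneg _) hc.le_a
  have hzint : ∫ x in (0 : ℝ)..1, z x = 0 := by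
    rw [intervalIntegral.integral_eq_sub_of_hasDerivAt (fun x _ => h.hasDerivAt_u x)
      (hz.intervalIntegrable _ _), h.left, h.right, sub_zero]
  -- Both boundary conditions together say that `z` has integral `0`, which determines the multiple
  -- of `E`.
  have hEint : |z 1| * ∫ x in (0 : ℝ)..1, E x ≤ Φ / α := by
    have h1 : (∫ x in (0 : ℝ)..1, (z x - z 1 * E x)) = -(z 1 * ∫ x in (0 : ℝ)..1, E x) := by
      rw [intervalIntegral.integral_sub (hz.intervalIntegrable _ _)
        (Continuous.intervalIntegrable (by fun_prop) _ _), hzint,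
        intervalIntegral.integral_const_mul, zero_sub]
    have h2 : |∫ x in (0 : ℝ)..1, (z x - z 1 * E x)| ≤ ∫ x in (0 : ℝ)..1, T x := by
      refine (intervalIntegral.abs_integral_le_integral_abs zero_le_one).trans ?_
      exact intervalIntegral.integral_mono_on zero_le_one
        (Continuous.intervalIntegrable (by fun_prop) _ _) (hTc.intervalIntegrable _ _) hzE
    rw [h1, abs_neg, abs_mul, abs_of_nonneg (a := ∫ x in (0 : ℝ)..1, E x)
      (intervalIntegral.integral_nonneg zero_le_one fun x _ => (hE0 x).le)] at h2
    exact h2.trans hTint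
  have hzabs : ∫ x in (0 : ℝ)..1, |z x| ≤ 2 / α * Φ := by
    have h1 : ∫ x in (0 : ℝ)..1, |z x| ≤ ∫ x in (0 : ℝ)..1, (|z 1| * E x + T x) := by
      refine intervalIntegral.integral_mono_on zero_le_one
        (Continuous.intervalIntegrable (by fun_prop) _ _)
        (Continuous.intervalIntegrable (by fun_prop) _ _) fun x hx => ?_
      have h2 := abs_add_le (z x - z 1 * E x) (z 1 * E x)
      rw [sub_add_cancel, abs_mul, abs_of_pos (hE0 x)] at h2
      linarith [hzE x hx]
    rw [intervalIntegral.integral_add (Continuous.intervalIntegrable (by fun_prop) _ _)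
      (hTc.intervalIntegrable _ _), intervalIntegral.integral_const_mul] at h1
    have : 2 / α * Φ = Φ / α + Φ / α := by ring
    linarith
  constructor
  · intro x hx
    have h1 : ∫ t in (0 : ℝ)..x, z t = u x := by
      rw [intervalIntegral.integral_eq_sub_of_hasDerivAt (fun x _ => h.hasDerivAt_u x)
        (hz.intervalIntegrable _ _), h.left, sub_zero]
    rw [← h1]
    refine (intervalIntegral.abs_integral_le_integral_abs hx.1).trans (le_trans ?_ hzabs)
    exact intervalIntegral.integral_mono_interval le_rfl hx.1 hx.2
      (Filter.Eventually.of_forall fun t => abs_nonneg _) (hz.abs.intervalIntegrable _ _)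
  · set δ := min ε 1 with hδ
    have hδ0 : 0 < δ := lt_min hε one_pos
    -- On the last interval of length `δ ≤ ε` the exponent of `E` is at least `-B`.
    have h1 : δ * Real.exp (-B) ≤ ∫ x in (0 : ℝ)..1, E x := by
      have h2 : ∫ x in (1 - δ)..1, E x ≤ ∫ x in (0 : ℝ)..1, E x :=
        intervalIntegral.integral_mono_interval (by linarith [min_le_right ε 1])
          (by linarith) le_rfl (Filter.Eventually.of_forall fun t => (hE0 t).le)
          (hEc.intervalIntegrable _ _)
      refine le_trans ?_ h2
      have h3 : ∫ _x in (1 - δ)..1, Real.exp (-B) ≤ ∫ x in (1 - δ)..1, E x := by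
        refine intervalIntegral.integral_mono_on (by linarith)
          (continuous_const.intervalIntegrable _ _) (hEc.intervalIntegrable _ _) fun x hx => ?_
        simp only [hE, Real.exp_le_exp]
        have hx0 : 0 ≤ x := by linarith [hx.1, min_le_right ε 1]
        have h4 : ∫ s in x..1, a s ≤ B * (1 - x) := by
          have : ∫ s in x..1, a s ≤ ∫ _s in x..1, B :=
            intervalIntegral.integral_mono_on hx.2 (ha.intervalIntegrable _ _)
              (continuous_const.intervalIntegrable _ _) fun s hs =>
                (le_abs_self _).trans (hc.abs_a_le s ⟨hx0.trans hs.1, hs.2⟩)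
          rw [intervalIntegral.integral_const, smul_eq_mul] at this
          linarith
        have h5 := intervalIntegral.integral_add_adjacent_intervals
          (ha.intervalIntegrable (μ := volume) 0 x) (ha.intervalIntegrable x 1)
        rw [le_div_iff₀ hε]
        have h6 : 1 - x ≤ ε := by linarith [hx.1, min_le_left ε 1]
        have h7 := mul_le_mul_of_nonneg_left h6 hc.bound_nonneg
        linarith
      rw [intervalIntegral.integral_const, smul_eq_mul] at h3
      linarith
    have h2 := (mul_le_mul_of_nonneg_left h1 (abs_nonneg (z 1))).trans hEint
    rw [Real.exp_neg] at h2
    have h3 : Real.exp B / (α * δ) * Φ = (Φ / α) * (Real.exp B / δ) := by field_simp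
    rw [h3]
    have h4 := mul_le_mul_of_nonneg_right h2 (by positivity : 0 ≤ Real.exp B / δ)
    refine le_trans (le_of_eq ?_) h4
    field_simp

set_option maxHeartbeats 1600000 in
/-- The second derivative of a solution is the sum of a boundary layer term and of a term that is
bounded in `L²`, uniformly in `ε`. -/
theorem exists_bound_second_deriv (hc : Coefficients a a' b b' α B) (hL : 0 ≤ L) :
    ∃ C : ℝ, 0 < C ∧ ∀ (ε M : ℝ) (g g' u z : ℝ → ℝ), 0 < ε → 0 ≤ M →
      Continuous g' → (∀ x, HasDerivAt g (g' x) x) →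
      (∫ x in (0 : ℝ)..1, g x ^ 2 ≤ M ^ 2) → (∫ x in (0 : ℝ)..1, g' x ^ 2 ≤ M ^ 2) →
      IsClassicalSolution ε a b g u z → (∫ x in (0 : ℝ)..1, u x ^ 2 ≤ (L * M) ^ 2) →
      ∃ R : ℝ → ℝ, Continuous R ∧ (∀ x ∈ Set.Icc (0 : ℝ) 1, 0 ≤ R x) ∧
        (∫ x in (0 : ℝ)..1, R x ^ 2 ≤ (C * M) ^ 2) ∧
        ∀ x ∈ Set.Icc (0 : ℝ) 1, |(a x * z x + b x * u x - g x) / ε| ≤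
          C * M * layerBound α (min ε 1) x + R x := by
  have hα := hc.pos
  have hB := hc.bound_nonneg
  -- Up to the factor `M`: `C₁` bounds the `L¹` norm of `g - b u`, `C₂` bounds `|u|`, `C₃` bounds
  -- `|g - b u|`; `C₄` and `C₅ / δ` are the regular part and the layer amplitude of `u'`. For `ε ≤
  -- 1`, `C₆` is the constant part of the bound on `u''` and `C₇` its layer amplitude; `C₈` bounds
  -- `u''` for `ε > 1`.
  set C₁ := 1 + B * L with hC₁
  set C₂ := 2 / α * C₁ with hC₂
  set C₃ := 2 + B * C₂ with hC₃
  set C₄ := C₃ / α with hC₄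
  set C₅ := Real.exp B / α * C₁ with hC₅
  set C₆ := (B * C₂ + (B + B) * C₄) / α with hC₆
  set C₇ := B * C₅ + C₃ + (B + B) * C₅ with hC₇
  set C₈ := B * (C₄ + C₅) + C₃ with hC₈
  have p1 : 0 ≤ C₁ := by positivity
  have p2 : 0 ≤ C₂ := by positivity
  have p3 : 0 ≤ C₃ := by positivity
  have p4 : 0 ≤ C₄ := by positivity
  have p5 : 0 ≤ C₅ := by positivity
  have p6 : 0 ≤ C₆ := by positivity
  have p7 : 0 ≤ C₇ := by positivity
  have p8 : 0 ≤ C₈ := by positivity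
  refine ⟨C₇ + C₈ + 2 * (1 / α + C₆) + 1, by positivity, ?_⟩
  intro ε M g g' u z hε hM hg'c hg hgM hg'M h huM
  set C := C₇ + C₈ + 2 * (1 / α + C₆) + 1 with hC
  have ha := hc.continuous_a
  have hb := hc.continuous_b
  have hu := h.continuous_u
  have hz := h.continuous_z
  have hgc : Continuous g := continuous_iff_continuousAt.2 fun x => (hg x).continuousAt
  set δ := min ε 1 with hδ
  have hδ0 : 0 < δ := lt_min hε one_pos
  have hδε : δ ≤ ε := min_le_left _ _
  have hg1 := integral_abs_le_of_integral_sq_le hgc hM hgM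
  have hg'1 := integral_abs_le_of_integral_sq_le hg'c hM hg'M
  have hu1 := integral_abs_le_of_integral_sq_le hu (by positivity) huM
  have hgs : ∀ x ∈ Set.Icc (0 : ℝ) 1, |g x| ≤ 2 * M := fun x hx => by
    linarith [abs_le_integral_abs_add hg hg'c hx]
  have hΦ : ∫ t in (0 : ℝ)..1, |g t - b t * u t| ≤ C₁ * M := by
    have h1 : ∫ t in (0 : ℝ)..1, |g t - b t * u t| ≤ ∫ t in (0 : ℝ)..1, (|g t| + B * |u t|) := by
      refine intervalIntegral.integral_mono_on zero_le_one
        (Continuous.intervalIntegrable (by fun_prop) _ _)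
        (Continuous.intervalIntegrable (by fun_prop) _ _) fun x hx => ?_
      refine (abs_sub _ _).trans ?_
      rw [abs_mul]
      gcongr
      exact hc.abs_b_le x hx
    rw [intervalIntegral.integral_add (Continuous.intervalIntegrable (by fun_prop) _ _)
      (Continuous.intervalIntegrable (by fun_prop) _ _), intervalIntegral.integral_const_mul] at h1
    have h2 := mul_le_mul_of_nonneg_left hu1 hB
    rw [hC₁]
    linarith
  obtain ⟨hub, hz1⟩ := h.abs_le_integral hc hε hgc
  have hus : ∀ x ∈ Set.Icc (0 : ℝ) 1, |u x| ≤ C₂ * M := fun x hx => by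
    refine (hub x hx).trans ?_
    rw [hC₂, mul_assoc]
    gcongr
  have hz1' : |z 1| ≤ C₅ * M / δ := by
    refine hz1.trans ?_
    have : C₅ * M / δ = Real.exp B / (α * δ) * (C₁ * M) := by rw [hC₅]; field_simp
    rw [this]
    gcongr
  have hFs : ∀ x ∈ Set.Icc (0 : ℝ) 1, |g x - b x * u x| ≤ C₃ * M := fun x hx => by
    refine (abs_sub _ _).trans ?_
    rw [abs_mul]
    have h1 := mul_le_mul (hc.abs_b_le x hx) (hus x hx) (abs_nonneg _) hB
    rw [hC₃]
    linarith [hgs x hx]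
  have h01 : (1 : ℝ) ∈ Set.Icc (0 : ℝ) 1 := Set.right_mem_Icc.2 zero_le_one
  set E : ℝ → ℝ := fun x => Real.exp (-(α * (1 - x) / ε)) with hE
  have hE0 : ∀ x, 0 < E x := fun x => Real.exp_pos _
  have hE1 : E 1 = 1 := by simp [hE]
  have hEd : ∀ x, HasDerivAt E (α * E x / ε) x := fun x => by
    have h1 : HasDerivAt (fun x : ℝ => -(α * (1 - x) / ε)) (α / ε) x := by
      have := ((((hasDerivAt_id x).const_sub 1).const_mul α).div_const ε).fun_neg
      refine this.congr_deriv ?_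
      ring
    refine h1.exp.congr_deriv ?_
    simp only [hE]
    ring
  have hEle : ∀ x ∈ Set.Icc (0 : ℝ) 1, E x ≤ 1 := fun x hx => by
    rw [hE, Real.exp_le_one_iff, neg_nonpos]
    exact div_nonneg (mul_nonneg hα.le (by linarith [hx.2])) hε.le
  -- Barrier for `-ε z' + a z = g - b u`: the constant dominates the source because `a ≥ α`, the
  -- layer function is a supersolution for the same reason, and it dominates `|z 1|` at the
  -- endpoint.
  have hzs : ∀ x ∈ Set.Icc (0 : ℝ) 1, |z x| ≤ C₄ * M + C₅ * M / δ * E x := fun x hx => by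
    refine abs_le_of_transport_abs_le (a := a) (r := fun x => g x - b x * u x)
      (Y := fun x => C₄ * M + C₅ * M / δ * E x)
      (R := fun x => a x * (C₄ * M) + (a x - α) * (C₅ * M / δ * E x)) hε ha
      (fun x hx => ?_) (fun x hx => ?_) (fun x hx => ?_) ?_ hx
    · refine (h.hasDerivAt_z x hx).congr_deriv ?_
      ring
    · refine (((hEd x).const_mul (C₅ * M / δ)).const_add (C₄ * M)).congr_deriv ?_
      ring
    · refine (hFs x hx).trans ?_
      have h1 := hc.le_a x hx
      have h2 : C₃ * M = α * (C₄ * M) := by rw [hC₄]; field_simp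
      have h3 : α * (C₄ * M) ≤ a x * (C₄ * M) := by gcongr
      have h4 : 0 ≤ (a x - α) * (C₅ * M / δ * E x) :=
        mul_nonneg (by linarith) (mul_nonneg (by positivity) (hE0 x).le)
      linarith
    · simp only [hE1, mul_one]
      have : 0 ≤ C₄ * M := by positivity
      linarith
  set y : ℝ → ℝ := fun x => (a x * z x + b x * u x - g x) / ε with hy
  have hyle : ∀ x ∈ Set.Icc (0 : ℝ) 1, |y x| ≤ (B * |z x| + C₃ * M) / ε := fun x hx => by
    rw [hy]
    simp only
    rw [abs_div, abs_of_pos hε]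
    gcongr
    have : a x * z x + b x * u x - g x = a x * z x - (g x - b x * u x) := by ring
    rw [this]
    refine (abs_sub _ _).trans (add_le_add ?_ (hFs x hx))
    rw [abs_mul]
    gcongr
    exact hc.abs_a_le x hx
  rcases le_or_gt ε 1 with hε1 | hε1
  · have hδe : δ = ε := min_eq_left hε1
    rw [hδe] at hzs hz1' ⊢
    set G : ℝ → ℝ := fun x => |g' x| with hG
    have hGc : Continuous G := hg'c.abs
    set T := transport ε a G with hT
    have hTc : Continuous T := continuous_transport hε ha hGc
    have hT0 : ∀ x ∈ Set.Icc (0 : ℝ) 1, 0 ≤ T x :=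
      fun x hx => transport_nonneg hε (fun x => abs_nonneg _) hx.2
    refine ⟨fun x => T x + C₆ * M, by fun_prop, fun x hx => ?_, ?_, fun x hx => ?_⟩
    · exact add_nonneg (hT0 x hx) (by positivity)
    · have h1 : ∫ x in (0 : ℝ)..1, (T x + C₆ * M) ^ 2 ≤
          ∫ x in (0 : ℝ)..1, (2 * T x ^ 2 + 2 * (C₆ * M) ^ 2) := by
        refine intervalIntegral.integral_mono_on zero_le_one
          (Continuous.intervalIntegrable (by fun_prop) _ _)
          (Continuous.intervalIntegrable (by fun_prop) _ _) fun x _ => ?_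
        nlinarith [sq_nonneg (T x - C₆ * M)]
      rw [intervalIntegral.integral_add (Continuous.intervalIntegrable (by fun_prop) _ _)
        (Continuous.intervalIntegrable (by fun_prop) _ _),
        intervalIntegral.integral_const_mul] at h1
      simp only [intervalIntegral.integral_const, sub_zero, one_smul] at h1
      have h2 := integral_transport_sq_le hε hα ha hGc hc.le_a
      simp only [hG, sq_abs] at h2
      have h3 : ∫ x in (0 : ℝ)..1, T x ^ 2 ≤ (1 / α * M) ^ 2 := by
        have : (1 / α * M) ^ 2 = M ^ 2 / α ^ 2 := by ring
        rw [this, le_div_iff₀' (by positivity)]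
        exact h2.trans hg'M
      have h4 : 2 * (1 / α * M) ^ 2 + 2 * (C₆ * M) ^ 2 ≤ (2 * (1 / α + C₆) * M) ^ 2 := by
        have q1 : 0 ≤ 1 / α * M := by positivity
        have q2 : 0 ≤ C₆ * M := by positivity
        nlinarith [mul_nonneg q1 q2]
      have h5 : (2 * (1 / α + C₆) * M) ^ 2 ≤ (C * M) ^ 2 := by
        refine pow_le_pow_left₀ (by positivity) (mul_le_mul_of_nonneg_right ?_ hM) 2
        linarith
      linarith
    · set c₀ := (B * C₅ + C₃) * M / ε ^ 2 with hc₀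
      set c₁ := (B + B) * C₅ * M / ε ^ 2 with hc₁
      have q0 : 0 ≤ c₀ := by positivity
      have q1 : 0 ≤ c₁ := by positivity
      have hWd : ∀ x, HasDerivAt (fun x => (1 - x) * E x)
          ((1 - x) * (α * E x / ε) - E x) x := fun x => by
        refine (((hasDerivAt_id x).const_sub 1).mul (hEd x)).congr_deriv ?_
        simp only [id]
        ring
      -- Differentiating the equation gives `-ε y' + a y = g' - b' u - (b + a') z`. In the barrier,
      -- `T` absorbs `|g'|`, the constant absorbs the bounded sources, and `c₀` dominates the value
      -- at `1`. The layer part of `z` is resonant with `E` (which solves the homogeneous equation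
      -- when `a = α`), so it needs the factor `1 - x`, whose derivative produces the extra `ε * c₁
      -- * E`.
      have hmain : |y x| ≤ T x + C₆ * M + c₀ * E x + c₁ * ((1 - x) * E x) := by
        refine abs_le_of_transport_abs_le (a := a)
          (r := fun x => g' x - b' x * u x - (b x + a' x) * z x)
          (Y := fun x => T x + C₆ * M + c₀ * E x + c₁ * ((1 - x) * E x))
          (R := fun x => G x + a x * (C₆ * M) + (a x - α) * (c₀ * E x) +
            (a x - α) * (c₁ * ((1 - x) * E x)) + ε * c₁ * E x) hε ha
          (fun x hx => ?_) (fun x hx => ?_) (fun x hx => ?_) ?_ hx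
        · refine (((((hc.hasDerivAt_a x).mul (h.hasDerivAt_z x hx)).add
            ((hc.hasDerivAt_b x).mul (h.hasDerivAt_u x))).sub (hg x)).div_const ε).congr_deriv ?_
          simp only [hy]
          ring
        · refine ((((hasDerivAt_transport hε ha hGc x).add_const (C₆ * M)).add
            ((hEd x).const_mul c₀)).add ((hWd x).const_mul c₁)).congr_deriv ?_
          simp only [hT]
          field_simp
          ring
        · have e1 := hc.le_a x hx
          have e2 := hE0 x
          have e3 : 0 ≤ (a x - α) * (c₀ * E x) :=
            mul_nonneg (by linarith) (mul_nonneg q0 e2.le)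
          have e4 : 0 ≤ (a x - α) * (c₁ * ((1 - x) * E x)) :=
            mul_nonneg (by linarith) (mul_nonneg q1 (mul_nonneg (by linarith [hx.2]) e2.le))
          have e5 : |b' x * u x| ≤ B * (C₂ * M) := by
            rw [abs_mul]
            exact mul_le_mul (hc.abs_b'_le x hx) (hus x hx) (abs_nonneg _) hB
          have e6 : |(b x + a' x) * z x| ≤ (B + B) * (C₄ * M + C₅ * M / ε * E x) := by
            rw [abs_mul]
            refine mul_le_mul ((abs_add_le _ _).trans ?_) (hzs x hx) (abs_nonneg _) (by positivity)
            exact add_le_add (hc.abs_b_le x hx) (hc.abs_a'_le x hx)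
          have e7 : α * (C₆ * M) = B * (C₂ * M) + (B + B) * (C₄ * M) := by
            rw [hC₆]; field_simp
          have e8 : α * (C₆ * M) ≤ a x * (C₆ * M) := by gcongr
          have e9 : ε * c₁ * E x = (B + B) * (C₅ * M / ε * E x) := by
            rw [hc₁]; field_simp
          have e10 := abs_sub (g' x - b' x * u x) ((b x + a' x) * z x)
          have e11 := abs_sub (g' x) (b' x * u x)
          simp only [hG]
          linarith
        · simp only [hE1, sub_self, mul_zero, mul_one, add_zero, hT, transport_one,
            zero_add]
          have e1 := hyle 1 h01
          have e2 : (B * |z 1| + C₃ * M) / ε ≤ c₀ := by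
            rw [hc₀, div_le_div_iff₀ hε (by positivity)]
            have e3 : B * |z 1| ≤ B * (C₅ * M / ε) := by gcongr
            have e4 : B * (C₅ * M / ε) * ε = B * C₅ * M := by field_simp
            have e5 : C₃ * M * ε ≤ C₃ * M := mul_le_of_le_one_right (by positivity) hε1
            have e6 : (B * |z 1| + C₃ * M) * ε ≤ (B * C₅ + C₃) * M := by
              have := mul_le_mul_of_nonneg_right e3 hε.le
              linarith
            calc (B * |z 1| + C₃ * M) * ε ^ 2 = (B * |z 1| + C₃ * M) * ε * ε := by ring
              _ ≤ _ := mul_le_mul_of_nonneg_right e6 hε.le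
          have e3 : 0 ≤ C₆ * M := by positivity
          linarith
      refine hmain.trans ?_
      have e1 : c₁ * ((1 - x) * E x) ≤ c₁ * E x := by
        refine mul_le_mul_of_nonneg_left ?_ q1
        exact mul_le_of_le_one_left (hE0 x).le (by linarith [hx.1])
      have e2 : c₀ * E x + c₁ * E x = C₇ * M * layerBound α ε x := by
        rw [hc₀, hc₁, hC₇, layerBound]
        simp only [hE]
        field_simp
      have e3 : C₇ * M * layerBound α ε x ≤ C * M * layerBound α ε x := by
        refine mul_le_mul_of_nonneg_right (mul_le_mul_of_nonneg_right ?_ hM) ?_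
        · have : 0 ≤ 1 / α := by positivity
          linarith
        · unfold layerBound; positivity
      linarith
  -- For `ε > 1` there is no layer: `u'` is bounded, and the equation itself bounds `u''`.
  · have hδe : δ = 1 := min_eq_right hε1.le
    rw [hδe] at hzs
    refine ⟨fun _ => C₈ * M, continuous_const, fun x _ => by positivity, ?_, fun x hx => ?_⟩
    · simp only [intervalIntegral.integral_const, sub_zero, one_smul]
      refine pow_le_pow_left₀ (by positivity) (mul_le_mul_of_nonneg_right ?_ hM) 2
      have : 0 ≤ 1 / α := by positivity
      linarith
    · have e1 : |z x| ≤ (C₄ + C₅) * M := by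
        refine (hzs x hx).trans ?_
        have : C₅ * M / 1 * E x ≤ C₅ * M / 1 * 1 := by
          refine mul_le_mul_of_nonneg_left (hEle x hx) (by positivity)
        linarith
      have e2 : (B * |z x| + C₃ * M) / ε ≤ C₈ * M := by
        rw [div_le_iff₀ hε]
        have : B * |z x| + C₃ * M ≤ C₈ * M := by
          have := mul_le_mul_of_nonneg_left e1 hB
          rw [hC₈]
          linarith
        refine this.trans ?_
        exact le_mul_of_one_le_right (by positivity) hε1.le
      have e3 : 0 ≤ C * M * layerBound α δ x := by
        have : 0 ≤ C := by positivity
        unfold layerBound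
        positivity
      exact (hyle x hx).trans (by linarith)

end

/-! ### Piecewise linear interpolation -/

/-- The piecewise linear interpolant of `u` with the nodes `t 0 ≤ ⋯ ≤ t N`, as a combination of
ReLU functions. -/
def pwLinear (t : ℕ → ℝ) (N : ℕ) (u : ℝ → ℝ) (x : ℝ) : ℝ :=
  u (t 0) + ∑ j ∈ Finset.range N, (u (t (j + 1)) - u (t j)) / (t (j + 1) - t j) *
    (max 0 (x - t j) - max 0 (x - t (j + 1)))

theorem continuous_pwLinear (t : ℕ → ℝ) (N : ℕ) (u : ℝ → ℝ) : Continuous (pwLinear t N u) := by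
  unfold pwLinear
  fun_prop

theorem pwLinear_sum (t : ℕ → ℝ) (N : ℕ) {ι : Type*} (s : Finset ι) (c : ι → ℝ)
    (u : ι → ℝ → ℝ) (x : ℝ) :
    pwLinear t N (fun y => ∑ i ∈ s, c i * u i y) x = ∑ i ∈ s, c i * pwLinear t N (u i) x := by
  simp only [pwLinear, mul_add, Finset.sum_add_distrib, Finset.mul_sum]
  congr 1
  rw [Finset.sum_comm]
  refine Finset.sum_congr rfl fun j _ => ?_
  rw [← Finset.sum_sub_distrib, Finset.sum_div, Finset.sum_mul]
  refine Finset.sum_congr rfl fun i _ => ?_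
  ring

theorem pwLinear_eq {t : ℕ → ℝ} (ht : Monotone t) {N i : ℕ} (hi : i < N) (u : ℝ → ℝ) {x : ℝ}
    (hx : x ∈ Set.Icc (t i) (t (i + 1))) : pwLinear t N u x =
      u (t i) + (u (t (i + 1)) - u (t i)) / (t (i + 1) - t i) * (x - t i) := by
  obtain ⟨k, rfl⟩ : ∃ k, N = i + 1 + k := ⟨N - (i + 1), by lia⟩
  rw [pwLinear, Finset.sum_range_add, Finset.sum_range_succ]
  have h1 : ∀ j ∈ Finset.range i, (u (t (j + 1)) - u (t j)) / (t (j + 1) - t j) *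
      (max 0 (x - t j) - max 0 (x - t (j + 1))) = u (t (j + 1)) - u (t j) := fun j hj => by
    have hj := Finset.mem_range.1 hj
    have h2 : t (j + 1) ≤ x := (ht (by lia)).trans hx.1
    have h3 : t j ≤ t (j + 1) := ht (by lia)
    rw [max_eq_right (by linarith), max_eq_right (by linarith)]
    -- Cells of length zero do occur in the Shishkin mesh; there division by zero gives `0`, the
    -- correct increment.
    rcases h3.eq_or_lt with h4 | h4
    · simp [h4]
    · have : t (j + 1) - t j ≠ 0 := by linarith
      field_simp
      ring
  have h2 : ∀ j ∈ Finset.range k,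
      (u (t (i + 1 + j + 1)) - u (t (i + 1 + j))) / (t (i + 1 + j + 1) - t (i + 1 + j)) *
      (max 0 (x - t (i + 1 + j)) - max 0 (x - t (i + 1 + j + 1))) = 0 := fun j _ => by
    have h3 : x ≤ t (i + 1 + j) := hx.2.trans (ht (by lia))
    have h4 : x ≤ t (i + 1 + j + 1) := hx.2.trans (ht (by lia))
    rw [max_eq_left (by linarith), max_eq_left (by linarith), sub_self, mul_zero]
  rw [Finset.sum_congr rfl h1, Finset.sum_range_sub fun j => u (t j), Finset.sum_eq_zero h2,
    max_eq_right (by linarith [hx.1]), max_eq_left (by linarith [hx.2])]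
  ring

/-- The error is the integral of `u''` against the Green's function of the cell, which is at most `q
- s`. This one-sided weight suits a layer at the right end: its integral against the layer term does
not depend on the cell length. -/
theorem abs_sub_linear_le {u z y : ℝ → ℝ} {p q x : ℝ} (hx : x ∈ Set.Icc p q)
    (hu : ∀ s ∈ Set.Icc p q, HasDerivAt u (z s) s) (hz : ∀ s ∈ Set.Icc p q, HasDerivAt z (y s) s)
    (hy : Continuous y) :
    |u x - (u p + (u q - u p) / (q - p) * (x - p))| ≤ ∫ s in p..q, (q - s) * |y s| := by
  rcases (hx.1.trans hx.2).eq_or_lt with hpq | hpq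
  · subst hpq
    have : x = p := le_antisymm hx.2 hx.1
    simp [this]
  have hpx := hx.1
  have hxq := hx.2
  have h1 : ∫ s in p..x, (s - p) * y s = (x - p) * z x - u x + u p := by
    rw [intervalIntegral.integral_eq_sub_of_hasDerivAt (f := fun s => (s - p) * z s - u s)
      (fun s hs => ?_) (Continuous.intervalIntegrable (by fun_prop) _ _)]
    · ring
    · rw [Set.uIcc_of_le hpx] at hs
      have hs' : s ∈ Set.Icc p q := ⟨hs.1, hs.2.trans hxq⟩
      refine ((((hasDerivAt_id s).sub_const p).mul (hz s hs')).sub (hu s hs')).congr_deriv ?_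
      simp only [id]
      ring
  have h2 : ∫ s in x..q, (q - s) * y s = u q - (q - x) * z x - u x := by
    rw [intervalIntegral.integral_eq_sub_of_hasDerivAt (f := fun s => (q - s) * z s + u s)
      (fun s hs => ?_) (Continuous.intervalIntegrable (by fun_prop) _ _)]
    · ring
    · rw [Set.uIcc_of_le hxq] at hs
      have hs' : s ∈ Set.Icc p q := ⟨hpx.trans hs.1, hs.2⟩
      refine ((((hasDerivAt_id s).const_sub q).mul (hz s hs')).add (hu s hs')).congr_deriv ?_
      simp only [id]
      ring
  have h3 : |∫ s in p..x, (s - p) * y s| ≤ ∫ s in p..x, (s - p) * |y s| := by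
    refine (intervalIntegral.abs_integral_le_integral_abs hpx).trans (le_of_eq ?_)
    refine intervalIntegral.integral_congr fun s hs => ?_
    rw [Set.uIcc_of_le hpx] at hs
    simp only [abs_mul, abs_of_nonneg (sub_nonneg.2 hs.1)]
  have h4 : |∫ s in x..q, (q - s) * y s| ≤ ∫ s in x..q, (q - s) * |y s| := by
    refine (intervalIntegral.abs_integral_le_integral_abs hxq).trans (le_of_eq ?_)
    refine intervalIntegral.integral_congr fun s hs => ?_
    rw [Set.uIcc_of_le hxq] at hs
    simp only [abs_mul, abs_of_nonneg (sub_nonneg.2 hs.2)]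
  have h5 : (q - x) * ∫ s in p..x, (s - p) * |y s| ≤ (q - p) * ∫ s in p..x, (q - s) * |y s| := by
    rw [← intervalIntegral.integral_const_mul, ← intervalIntegral.integral_const_mul]
    refine intervalIntegral.integral_mono_on hpx (Continuous.intervalIntegrable (by fun_prop) _ _)
      (Continuous.intervalIntegrable (by fun_prop) _ _) fun s hs => ?_
    rw [← mul_assoc, ← mul_assoc]
    refine mul_le_mul_of_nonneg_right ?_ (abs_nonneg _)
    rw [mul_comm]
    exact mul_le_mul (by linarith [hs.2]) (by linarith [hs.2]) (by linarith) (by linarith)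
  have h6 : 0 ≤ ∫ s in x..q, (q - s) * |y s| :=
    intervalIntegral.integral_nonneg hxq fun s hs => mul_nonneg (by linarith [hs.2]) (abs_nonneg _)
  have h7 := intervalIntegral.integral_add_adjacent_intervals (μ := volume)
    (Continuous.intervalIntegrable (u := fun s => (q - s) * |y s|) (by fun_prop) p x)
    (Continuous.intervalIntegrable (by fun_prop) x q)
  have h8 : 0 < q - p := by linarith
  have h9 : u x - (u p + (u q - u p) / (q - p) * (x - p)) =
      -((q - x) * (∫ s in p..x, (s - p) * y s) + (x - p) * ∫ s in x..q, (q - s) * y s) /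
        (q - p) := by
    rw [h1, h2]
    field_simp
    ring
  rw [h9, abs_div, abs_neg, abs_of_pos h8, div_le_iff₀ h8, ← h7]
  refine (abs_add_le _ _).trans ?_
  rw [abs_mul, abs_mul, abs_of_nonneg (sub_nonneg.2 hxq), abs_of_nonneg (sub_nonneg.2 hpx)]
  have h10 := mul_le_mul_of_nonneg_left h3 (sub_nonneg.2 hxq)
  have h11 := mul_le_mul_of_nonneg_left h4 (sub_nonneg.2 hpx)
  have h12 : (x - p) * ∫ s in x..q, (q - s) * |y s| ≤ (q - p) * ∫ s in x..q, (q - s) * |y s| :=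
    mul_le_mul_of_nonneg_right (by linarith) h6
  linarith

theorem sq_integral_le {R : ℝ → ℝ} (hR : Continuous R) {p q : ℝ} (hpq : p ≤ q) :
    (∫ s in p..q, R s) ^ 2 ≤ (q - p) * ∫ s in p..q, R s ^ 2 := by
  rcases hpq.eq_or_lt with h | h
  · simp [h]
  have h0 : 0 < q - p := by linarith
  set I := ∫ s in p..q, R s with hI
  have h1 : 0 ≤ ∫ s in p..q, (R s - I / (q - p)) ^ 2 :=
    intervalIntegral.integral_nonneg hpq fun s _ => sq_nonneg _
  have h2 : ∫ s in p..q, (R s - I / (q - p)) ^ 2 = (∫ s in p..q, R s ^ 2) - I ^ 2 / (q - p) := by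
    have : ∀ s, (R s - I / (q - p)) ^ 2 =
        R s ^ 2 - 2 * (I / (q - p)) * R s + (I / (q - p)) ^ 2 := fun s => by ring
    simp_rw [this]
    rw [intervalIntegral.integral_add (Continuous.intervalIntegrable (by fun_prop) _ _)
      (Continuous.intervalIntegrable (by fun_prop) _ _), intervalIntegral.integral_sub
      (Continuous.intervalIntegrable (by fun_prop) _ _)
      (Continuous.intervalIntegrable (by fun_prop) _ _), intervalIntegral.integral_const_mul,
      intervalIntegral.integral_const, ← hI, smul_eq_mul]
    field_simp
    ring
  rw [h2, sub_nonneg, div_le_iff₀ h0] at h1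
  linarith

/-- The layer part `D` is treated pointwise, through its weighted integral on each cell. For the
`L²` part, Cauchy–Schwarz on a cell gives `h ^ 3` and integration over the cell the fourth power. -/
theorem integral_sq_sub_pwLinear_le {u z y D R : ℝ → ℝ} {t : ℕ → ℝ} {N : ℕ} {A η h : ℝ}
    (ht : Monotone t) (ht0 : t 0 = 0) (htN : t N = 1) (hA : 0 ≤ A)
    (hh : ∀ i < N, t (i + 1) - t i ≤ h)
    (huc : Continuous u) (hu : ∀ s ∈ Set.Icc (0 : ℝ) 1, HasDerivAt u (z s) s)
    (hz : ∀ s ∈ Set.Icc (0 : ℝ) 1, HasDerivAt z (y s) s) (hy : Continuous y)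
    (hD : Continuous D) (hR : Continuous R) (hR0 : ∀ s ∈ Set.Icc (0 : ℝ) 1, 0 ≤ R s)
    (hyb : ∀ s ∈ Set.Icc (0 : ℝ) 1, |y s| ≤ A * D s + R s)
    (hη : ∀ i < N, ∫ s in (t i)..(t (i + 1)), (t (i + 1) - s) * D s ≤ η) :
    ∫ x in (0 : ℝ)..1, (u x - pwLinear t N u x) ^ 2 ≤
      2 * (A * η) ^ 2 + 2 * h ^ 4 * ∫ x in (0 : ℝ)..1, R x ^ 2 := by
  have hpc := continuous_pwLinear t N u
  have hsum : ∀ f : ℝ → ℝ, Continuous f →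
      ∫ x in (0 : ℝ)..1, f x = ∑ i ∈ Finset.range N, ∫ x in (t i)..(t (i + 1)), f x := fun f hf => by
    rw [intervalIntegral.sum_integral_adjacent_intervals fun i _ => hf.intervalIntegrable _ _,
      ht0, htN]
  rw [hsum _ (by fun_prop), hsum _ (by fun_prop)]
  have hlen : ∑ i ∈ Finset.range N, (t (i + 1) - t i) = 1 := by
    rw [Finset.sum_range_sub, ht0, htN, sub_zero]
  have hterm : ∀ i ∈ Finset.range N, ∫ x in (t i)..(t (i + 1)), (u x - pwLinear t N u x) ^ 2 ≤
      2 * (A * η) ^ 2 * (t (i + 1) - t i) +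
        2 * h ^ 4 * ∫ x in (t i)..(t (i + 1)), R x ^ 2 := fun i hi => by
    have hi := Finset.mem_range.1 hi
    have hpq : t i ≤ t (i + 1) := ht (by lia)
    have hsub : Set.Icc (t i) (t (i + 1)) ⊆ Set.Icc 0 1 :=
      Set.Icc_subset_Icc (ht0 ▸ ht (by lia)) (htN ▸ ht (by lia))
    have hhi := hh i hi
    have hh0 : 0 ≤ h := by linarith
    set p := t i with hp
    set q := t (i + 1) with hq
    set J := ∫ x in p..q, R x ^ 2 with hJ
    have hJ0 : 0 ≤ J := intervalIntegral.integral_nonneg hpq fun s _ => sq_nonneg _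
    have h1 : ∫ s in p..q, (q - s) * |y s| ≤ A * η + h * ∫ s in p..q, R s := by
      have h2 : ∫ s in p..q, (q - s) * |y s| ≤
          ∫ s in p..q, (A * ((q - s) * D s) + h * R s) := by
        refine intervalIntegral.integral_mono_on hpq
          (Continuous.intervalIntegrable (by fun_prop) _ _)
          (Continuous.intervalIntegrable (by fun_prop) _ _) fun s hs => ?_
        have e1 := mul_le_mul_of_nonneg_left (hyb s (hsub hs)) (sub_nonneg.2 hs.2)
        have e2 : (q - s) * R s ≤ h * R s :=
          mul_le_mul_of_nonneg_right (by linarith [hs.1]) (hR0 s (hsub hs))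
        linarith
      rw [intervalIntegral.integral_add (Continuous.intervalIntegrable (by fun_prop) _ _)
        (Continuous.intervalIntegrable (by fun_prop) _ _), intervalIntegral.integral_const_mul,
        intervalIntegral.integral_const_mul] at h2
      have := mul_le_mul_of_nonneg_left (hη i hi) hA
      linarith
    have h3 : ∀ x ∈ Set.Icc p q, (u x - pwLinear t N u x) ^ 2 ≤
        2 * (A * η) ^ 2 + 2 * h ^ 3 * J := fun x hx => by
      have e1 := abs_sub_linear_le hx (fun s hs => hu s (hsub hs)) (fun s hs => hz s (hsub hs)) hy
      rw [← pwLinear_eq ht hi u hx] at e1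
      have e2 := pow_le_pow_left₀ (abs_nonneg _) (e1.trans h1) 2
      rw [sq_abs] at e2
      have e3 := sq_integral_le hR hpq
      have e4 : (q - p) * J ≤ h * J := mul_le_mul_of_nonneg_right hhi hJ0
      have e5 := mul_le_mul_of_nonneg_left (e3.trans e4) (sq_nonneg h)
      nlinarith [sq_nonneg (A * η - h * ∫ s in p..q, R s)]
    have h4 := intervalIntegral.integral_mono_on (μ := volume) hpq
      (Continuous.intervalIntegrable (by fun_prop) _ _)
      (continuous_const.intervalIntegrable _ _) h3
    rw [intervalIntegral.integral_const, smul_eq_mul] at h4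
    have h5 : (q - p) * (2 * h ^ 3 * J) ≤ h * (2 * h ^ 3 * J) :=
      mul_le_mul_of_nonneg_right hhi (by positivity)
    linarith
  refine (Finset.sum_le_sum hterm).trans (le_of_eq ?_)
  rw [Finset.sum_add_distrib, ← Finset.mul_sum, ← Finset.mul_sum, hlen, mul_one]

/-! ### The Shishkin mesh -/

/-- The piecewise equidistant mesh with `n` intervals on each of `[0, 1 - σ]` and `[1 - σ, 1]`. -/
def shishkinNode (σ : ℝ) (n j : ℕ) : ℝ :=
  (1 - σ) * ((min j n : ℕ) / n) + σ * ((j - n : ℕ) / n)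

theorem monotone_shishkinNode {σ : ℝ} (h0 : 0 ≤ σ) (h1 : σ ≤ 1) (n : ℕ) :
    Monotone (shishkinNode σ n) := by
  intro i j hij
  unfold shishkinNode
  have e1 : min i n ≤ min j n := by lia
  have e2 : i - n ≤ j - n := by lia
  have e3 : 0 ≤ 1 - σ := by linarith
  gcongr

theorem shishkinNode_zero (σ : ℝ) (n : ℕ) : shishkinNode σ n 0 = 0 := by
  simp [shishkinNode]

theorem shishkinNode_last (σ : ℝ) {n : ℕ} (hn : 1 ≤ n) : shishkinNode σ n (2 * n) = 1 := by
  have hn0 : (n : ℝ) ≠ 0 := by exact_mod_cast (by lia : n ≠ 0)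
  have e1 : min (2 * n) n = n := by lia
  have e2 : 2 * n - n = n := by lia
  rw [shishkinNode, e1, e2]
  field_simp
  ring

theorem shishkinNode_step_coarse (σ : ℝ) {n i : ℕ} (hi : i < n) :
    shishkinNode σ n (i + 1) - shishkinNode σ n i = (1 - σ) / n := by
  have e1 : min (i + 1) n = i + 1 := by lia
  have e2 : min i n = i := by lia
  have e3 : i + 1 - n = 0 := by lia
  have e4 : i - n = 0 := by lia
  rw [shishkinNode, shishkinNode, e1, e2, e3, e4]
  push_cast
  ring

theorem shishkinNode_step_fine (σ : ℝ) {n i : ℕ} (hi : n ≤ i) :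
    shishkinNode σ n (i + 1) - shishkinNode σ n i = σ / n := by
  have e1 : min (i + 1) n = n := by lia
  have e2 : min i n = n := by lia
  have e3 : i + 1 - n = (i - n) + 1 := by lia
  rw [shishkinNode, shishkinNode, e1, e2, e3]
  push_cast
  ring

theorem shishkinNode_coarse_le {σ : ℝ} (h1 : σ ≤ 1) {n i : ℕ} (hi : i < n) :
    shishkinNode σ n (i + 1) ≤ 1 - σ := by
  have hn0 : (0 : ℝ) < n := by exact_mod_cast (by lia : 0 < n)
  have e1 : min (i + 1) n = i + 1 := by lia
  have e3 : i + 1 - n = 0 := by lia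
  rw [shishkinNode, e1, e3]
  simp only [Nat.cast_zero, zero_div, mul_zero, add_zero]
  refine mul_le_of_le_one_right (by linarith) ?_
  rw [div_le_one hn0]
  exact_mod_cast hi

/-! ### The layer term on the cells of the mesh. -/

@[fun_prop]
theorem continuous_layerBound (α δ : ℝ) : Continuous (layerBound α δ) := by
  unfold layerBound
  fun_prop

/-- An explicit antiderivative, whose contribution at `p` has a sign. For coarse cells, where the
length is large compared with `δ` but the layer has decayed. -/
theorem integral_layerBound_le_exp {α δ p q : ℝ} (hα : 0 < α) (hδ : 0 < δ) (hpq : p ≤ q) :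
    ∫ s in p..q, (q - s) * layerBound α δ s ≤ Real.exp (-(α * (1 - q) / δ)) / α ^ 2 := by
  have hd : ∀ s, HasDerivAt (fun s => Real.exp (-(α * (1 - s) / δ)) *
      ((q - s) / (α * δ) + (α ^ 2)⁻¹)) ((q - s) * layerBound α δ s) s := fun s => by
    have h1 : HasDerivAt (fun x : ℝ => -(α * (1 - x) / δ)) (α / δ) s := by
      have := ((((hasDerivAt_id s).const_sub 1).const_mul α).div_const δ).fun_neg
      refine this.congr_deriv ?_
      ring
    have h2 : HasDerivAt (fun s => (q - s) / (α * δ) + (α ^ 2)⁻¹) (-1 / (α * δ)) s := by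
      simpa using (((hasDerivAt_id s).const_sub q).div_const (α * δ)).add_const (α ^ 2)⁻¹
    refine (h1.exp.mul h2).congr_deriv ?_
    unfold layerBound
    field_simp
    ring
  rw [intervalIntegral.integral_eq_sub_of_hasDerivAt (fun s _ => hd s)
    (Continuous.intervalIntegrable (by fun_prop) _ _)]
  have h1 : 0 ≤ Real.exp (-(α * (1 - p) / δ)) * ((q - p) / (α * δ) + (α ^ 2)⁻¹) := by
    have : 0 ≤ q - p := by linarith
    positivity
  have h2 : Real.exp (-(α * (1 - q) / δ)) * ((q - q) / (α * δ) + (α ^ 2)⁻¹) =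
      Real.exp (-(α * (1 - q) / δ)) / α ^ 2 := by
    rw [sub_self, zero_div, zero_add, ← div_eq_mul_inv]
  linarith

theorem integral_layerBound_le_sq {α δ p q : ℝ} (hα : 0 < α) (hδ : 0 < δ) (hpq : p ≤ q)
    (hq : q ≤ 1) :
    ∫ s in p..q, (q - s) * layerBound α δ s ≤ ((q - p) / δ) ^ 2 := by
  have h1 : ∫ s in p..q, (q - s) * layerBound α δ s ≤ ∫ _s in p..q, (q - p) * (δ ^ 2)⁻¹ := by
    refine intervalIntegral.integral_mono_on hpq (Continuous.intervalIntegrable (by fun_prop) _ _)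
      (continuous_const.intervalIntegrable _ _) fun s hs => ?_
    have h2 : layerBound α δ s ≤ (δ ^ 2)⁻¹ := by
      unfold layerBound
      refine mul_le_of_le_one_right (by positivity) ?_
      rw [Real.exp_le_one_iff, neg_nonpos]
      exact div_nonneg (mul_nonneg hα.le (by linarith [hs.2])) hδ.le
    have h3 : 0 ≤ layerBound α δ s := by unfold layerBound; positivity
    exact mul_le_mul (by linarith [hs.1]) h2 h3 (by linarith)
  rw [intervalIntegral.integral_const, smul_eq_mul] at h1
  refine h1.trans (le_of_eq ?_)
  field_simp

/-- The transition point of the Shishkin mesh is `1 - shishkinWidth`. -/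
def shishkinWidth (α δ : ℝ) (n : ℕ) : ℝ := min 1 (2 * δ / α * Real.log n)

theorem shishkinWidth_nonneg {α δ : ℝ} (hα : 0 < α) (hδ : 0 < δ) (n : ℕ) :
    0 ≤ shishkinWidth α δ n :=
  le_min zero_le_one (mul_nonneg (by positivity) (Real.log_natCast_nonneg n))

theorem integral_layerBound_shishkin_le {α δ γ : ℝ} (hα : 0 < α) (hδ : 0 < δ) (hγ : 0 < γ) {n : ℕ}
    (hn : 1 ≤ n) {i : ℕ} (hi : i < 2 * n) :
    ∫ s in (shishkinNode (shishkinWidth α δ n) n i)..(shishkinNode (shishkinWidth α δ n) n (i + 1)),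
      (shishkinNode (shishkinWidth α δ n) n (i + 1) - s) * layerBound α δ s ≤
      (1 + 16 / γ ^ 2) / α ^ 2 * (n : ℝ) ^ (γ - 2) := by
  set σ := shishkinWidth α δ n with hσ
  have hσ0 : 0 ≤ σ := shishkinWidth_nonneg hα hδ n
  have hσ1 : σ ≤ 1 := min_le_left _ _
  have hn0 : (0 : ℝ) < n := by exact_mod_cast (by lia : 0 < n)
  have hn1 : (1 : ℝ) ≤ n := by exact_mod_cast hn
  have hm := monotone_shishkinNode hσ0 hσ1 n
  have hpq : shishkinNode σ n i ≤ shishkinNode σ n (i + 1) := hm (by lia)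
  have hpow : (n : ℝ) ^ (γ - 2) = (n : ℝ) ^ γ / (n : ℝ) ^ 2 := by
    rw [Real.rpow_sub hn0, Real.rpow_ofNat]
  have hpow1 : 1 / (n : ℝ) ^ 2 ≤ (n : ℝ) ^ (γ - 2) := by
    rw [hpow]
    gcongr
    exact Real.one_le_rpow hn1 hγ.le
  have hpow0 : 0 ≤ (n : ℝ) ^ (γ - 2) := by positivity
  rcases lt_or_ge i n with hin | hin
  · have hfin : 1 / α ^ 2 * (1 / (n : ℝ) ^ 2) ≤ (1 + 16 / γ ^ 2) / α ^ 2 * (n : ℝ) ^ (γ - 2) := by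
      refine mul_le_mul ?_ hpow1 (by positivity) (by positivity)
      gcongr
      have : 0 ≤ 16 / γ ^ 2 := by positivity
      linarith
    refine le_trans ?_ hfin
    -- If `σ = 1`, the coarse cells have length zero.
    rcases hσ1.eq_or_lt with h1 | h1
    · have := shishkinNode_step_coarse σ hin
      rw [h1, sub_self, zero_div, sub_eq_zero] at this
      rw [h1, this, intervalIntegral.integral_same]
      positivity
    · have h2 : σ = 2 * δ / α * Real.log n := by
        rcases min_choice 1 (2 * δ / α * Real.log n) with h3 | h3
        · exact absurd h3 h1.ne
        · exact h3
      refine (integral_layerBound_le_exp hα hδ hpq).trans ?_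
      rw [div_eq_mul_one_div, mul_comm]
      refine mul_le_mul_of_nonneg_left ?_ (by positivity)
      have h3 := shishkinNode_coarse_le hσ1 hin
      -- The factor `2` in `shishkinWidth` is chosen so that the layer has decayed to `n⁻²` at the
      -- transition point.
      have h4 : 1 / (n : ℝ) ^ 2 = Real.exp (-(α * σ / δ)) := by
        have : α * σ / δ = Real.log ((n : ℝ) ^ 2) := by
          rw [h2, Real.log_pow]; field_simp; push_cast; ring
        rw [this, Real.exp_neg, Real.exp_log (by positivity), one_div]
      rw [h4, Real.exp_le_exp, neg_le_neg_iff]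
      gcongr
      linarith
  · have hq1 : shishkinNode σ n (i + 1) ≤ 1 := by
      rw [← shishkinNode_last σ hn]
      exact hm (by lia)
    refine (integral_layerBound_le_sq hα hδ hpq hq1).trans ?_
    rw [shishkinNode_step_fine σ hin]
    -- On fine cells the step divided by `δ` is of order `log n / n`; squaring the bound on the
    -- logarithm costs `n ^ γ`.
    have h1 : Real.log n ≤ 2 / γ * (n : ℝ) ^ (γ / 2) := by
      refine (Real.log_le_rpow_div hn0.le (half_pos hγ)).trans (le_of_eq ?_)
      field_simp
    have h2 : σ / n / δ ≤ 4 / (α * γ) * (n : ℝ) ^ (γ / 2) / n := by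
      rw [div_right_comm]
      gcongr
      rw [div_le_iff₀ hδ]
      refine (min_le_right _ _).trans ?_
      calc 2 * δ / α * Real.log n ≤ 2 * δ / α * (2 / γ * (n : ℝ) ^ (γ / 2)) := by gcongr
        _ = _ := by field_simp; ring
    have h3 : ((n : ℝ) ^ (γ / 2)) ^ 2 = (n : ℝ) ^ γ := by
      rw [← Real.rpow_natCast, ← Real.rpow_mul hn0.le]
      congr 1
      push_cast
      ring
    refine (pow_le_pow_left₀ (by positivity) h2 2).trans ?_
    have h4 : (4 / (α * γ) * (n : ℝ) ^ (γ / 2) / n) ^ 2 =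
        16 / γ ^ 2 / α ^ 2 * (n : ℝ) ^ (γ - 2) := by
      rw [hpow, ← h3]
      field_simp
      ring
    rw [h4]
    gcongr
    linarith

/-- The error of interpolation on the Shishkin mesh, uniformly in `ε`. -/
theorem exists_interpolation_error_bound {a a' b b' : ℝ → ℝ} {α B L γ : ℝ}
    (hc : Coefficients a a' b b' α B) (hL : 0 ≤ L) (hγ : 0 < γ) :
    ∃ C : ℝ, 0 < C ∧ ∀ (ε : ℝ) (n : ℕ), 0 < ε → 1 ≤ n → ∃ t : ℕ → ℝ,
      ∀ (M : ℝ) (g g' u z : ℝ → ℝ), 0 ≤ M → Continuous g' → (∀ x, HasDerivAt g (g' x) x) →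
      (∫ x in (0 : ℝ)..1, g x ^ 2 ≤ M ^ 2) → (∫ x in (0 : ℝ)..1, g' x ^ 2 ≤ M ^ 2) →
      IsClassicalSolution ε a b g u z → (∫ x in (0 : ℝ)..1, u x ^ 2 ≤ (L * M) ^ 2) →
      ∫ x in (0 : ℝ)..1, (u x - pwLinear t (2 * n) u x) ^ 2 ≤ (C * M * (n : ℝ) ^ (γ - 2)) ^ 2 := by
  obtain ⟨C, hC, hbound⟩ := exists_bound_second_deriv hc hL
  have hα := hc.pos
  set c := (1 + 16 / γ ^ 2) / α ^ 2 with hcd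
  have hc0 : 0 < c := by positivity
  refine ⟨2 * C * (c + 1), by positivity, fun ε n hε hn => ?_⟩
  set δ := min ε 1 with hδ
  have hδ0 : 0 < δ := lt_min hε one_pos
  set σ := shishkinWidth α δ n with hσ
  have hσ0 : 0 ≤ σ := shishkinWidth_nonneg hα hδ0 n
  have hσ1 : σ ≤ 1 := min_le_left _ _
  -- The mesh is fixed before the data, so one trunk net serves all inputs.
  refine ⟨shishkinNode σ n, fun M g g' u z hM hg'c hg hgM hg'M h huM => ?_⟩
  have hn0 : (0 : ℝ) < n := by exact_mod_cast (by lia : 0 < n)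
  have hn1 : (1 : ℝ) ≤ n := by exact_mod_cast hn
  obtain ⟨R, hRc, hR0, hRM, hy⟩ := hbound ε M g g' u z hε hM hg'c hg hgM hg'M h huM
  have hgc : Continuous g := continuous_iff_continuousAt.2 fun x => (hg x).continuousAt
  have ha := hc.continuous_a
  have hb := hc.continuous_b
  have hu := h.continuous_u
  have hz := h.continuous_z
  have hstep : ∀ i < 2 * n, shishkinNode σ n (i + 1) - shishkinNode σ n i ≤ 1 / n := by
    intro i _
    rcases lt_or_ge i n with hin | hin
    · rw [shishkinNode_step_coarse σ hin]
      gcongr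
      linarith
    · rw [shishkinNode_step_fine σ hin]
      gcongr
  have hmain := integral_sq_sub_pwLinear_le (monotone_shishkinNode hσ0 hσ1 n)
    (shishkinNode_zero σ n) (shishkinNode_last σ hn) (A := C * M) (by positivity) hstep hu
    (fun s _ => h.hasDerivAt_u s) h.hasDerivAt_z (by fun_prop) (continuous_layerBound α δ) hRc hR0
    hy (fun i hi => integral_layerBound_shishkin_le hα hδ0 hγ hn hi)
  refine hmain.trans ?_
  set ρ := (n : ℝ) ^ (γ - 2) with hρ
  have hρ0 : 0 < ρ := by positivity
  have h1 : (1 / (n : ℝ)) ^ 4 ≤ ρ ^ 2 := by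
    have : 1 / (n : ℝ) ^ 2 ≤ ρ := by
      rw [hρ, Real.rpow_sub hn0, Real.rpow_ofNat]
      gcongr
      exact Real.one_le_rpow hn1 hγ.le
    calc (1 / (n : ℝ)) ^ 4 = (1 / (n : ℝ) ^ 2) ^ 2 := by field_simp
      _ ≤ ρ ^ 2 := pow_le_pow_left₀ (by positivity) this 2
  have hRi : 0 ≤ ∫ x in (0 : ℝ)..1, R x ^ 2 :=
    intervalIntegral.integral_nonneg zero_le_one fun s _ => sq_nonneg _
  have h2 : (1 / (n : ℝ)) ^ 4 * ∫ x in (0 : ℝ)..1, R x ^ 2 ≤ ρ ^ 2 * (C * M) ^ 2 :=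
    mul_le_mul h1 hRM hRi (by positivity)
  have h3 : (2 * C * (c + 1) * M * ρ) ^ 2 =
      4 * (C * M * (c * ρ)) ^ 2 + 4 * (ρ ^ 2 * (C * M) ^ 2) + 8 * (c * (ρ ^ 2 * (C * M) ^ 2)) := by
    ring
  have h4 : 0 ≤ c * (ρ ^ 2 * (C * M) ^ 2) := by positivity
  have h5 : 0 ≤ (C * M * (c * ρ)) ^ 2 := sq_nonneg _
  have h6 : 0 ≤ ρ ^ 2 * (C * M) ^ 2 := by positivity
  rw [h3]
  linarith

/-! ### Extension of the coefficients -/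

/-- Extend the derivative by its endpoint values and integrate. -/
theorem exists_C1_extension {c : ℝ → ℝ} (hc : ContDiffOn ℝ 2 c (Set.Icc 0 1)) :
    ∃ a a' : ℝ → ℝ, Continuous a' ∧ (∀ x, HasDerivAt a (a' x) x) ∧
      Set.EqOn a c (Set.Icc 0 1) := by
  have hud : UniqueDiffOn ℝ (Set.Icc (0 : ℝ) 1) := uniqueDiffOn_Icc zero_lt_one
  have hd : ContinuousOn (derivWithin c (Set.Icc 0 1)) (Set.Icc 0 1) :=
    hc.continuousOn_derivWithin hud (by norm_num)
  set a' : ℝ → ℝ := Set.IccExtend zero_le_one ((Set.Icc (0 : ℝ) 1).domRestrict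
    (derivWithin c (Set.Icc 0 1))) with ha'
  have ha'c : Continuous a' := (continuousOn_iff_continuous_domRestrict.1 hd).Icc_extend'
  refine ⟨fun x => c 0 + ∫ s in (0 : ℝ)..x, a' s, a', ha'c,
    fun x => (hasDerivAt_primitive ha'c x).const_add _, fun x hx => ?_⟩
  have h1 : ∫ s in (0 : ℝ)..x, a' s = c x - c 0 := by
    refine intervalIntegral.integral_eq_sub_of_hasDerivAt_of_le hx.1
      (hc.continuousOn.mono (Set.Icc_subset_Icc le_rfl hx.2)) (fun s hs => ?_)
      (ha'c.intervalIntegrable _ _)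
    have hs' : s ∈ Set.Icc (0 : ℝ) 1 := ⟨hs.1.le, hs.2.le.trans hx.2⟩
    rw [ha', Set.IccExtend_of_mem _ _ hs']
    exact (hc.differentiableOn (by norm_num) s hs').hasDerivWithinAt.hasDerivAt
      (Icc_mem_nhds hs.1 (hs.2.trans_le hx.2))
  simp only [h1]
  ring

/-! ### Elements of `H_0^1` -/

theorem memLp_of_continuous {g : ℝ → ℝ} (hg : Continuous g) : MemLp g 2 unitVol := by
  obtain ⟨C, hC⟩ := (isCompact_Icc (a := (0 : ℝ)) (b := 1)).exists_bound_of_continuousOn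
    hg.continuousOn
  refine MemLp.of_bound hg.aestronglyMeasurable C ?_
  filter_upwards [ae_restrict_mem measurableSet_Icc] with x hx using hC x hx

theorem L2.intervalIntegrable (f : L2) : IntervalIntegrable f volume 0 1 := by
  rw [intervalIntegrable_iff_integrableOn_Icc_of_le zero_le_one]
  exact (Lp.memLp f).integrable (by norm_num)

theorem integral_primitive_mul {p q : ℝ → ℝ} (hp : IntervalIntegrable p volume 0 1)
    (hq : IntervalIntegrable q volume 0 1) :
    ∫ x in (0 : ℝ)..1, (∫ s in (0 : ℝ)..x, p s) * q x =
      (∫ s in (0 : ℝ)..1, p s) * (∫ s in (0 : ℝ)..1, q s) -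
        ∫ x in (0 : ℝ)..1, p x * ∫ s in (0 : ℝ)..x, q s := by
  have h0 : (0 : ℝ) ∈ Set.uIcc (0 : ℝ) 1 := Set.left_mem_uIcc
  have h := (hp.absolutelyContinuousOnInterval_intervalIntegral h0).integral_mul_deriv_eq_deriv_mul
    (hq.absolutelyContinuousOnInterval_intervalIntegral h0)
  have e1 : ∫ x in (0 : ℝ)..1, (∫ s in (0 : ℝ)..x, p s) * deriv (fun x => ∫ s in (0 : ℝ)..x, q s) x =
      ∫ x in (0 : ℝ)..1, (∫ s in (0 : ℝ)..x, p s) * q x := by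
    refine intervalIntegral.integral_congr_ae ?_
    filter_upwards [hq.ae_hasDerivAt_integral] with x hx hxI
    rw [(hx (Set.uIoc_subset_uIcc hxI) 0 h0).deriv]
  have e2 : ∫ x in (0 : ℝ)..1, deriv (fun x => ∫ s in (0 : ℝ)..x, p s) x * (∫ s in (0 : ℝ)..x, q s) =
      ∫ x in (0 : ℝ)..1, p x * ∫ s in (0 : ℝ)..x, q s := by
    refine intervalIntegral.integral_congr_ae ?_
    filter_upwards [hp.ae_hasDerivAt_integral] with x hx hxI
    rw [(hx (Set.uIoc_subset_uIcc hxI) 0 h0).deriv]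
  rw [e1, e2] at h
  rw [h]
  simp

theorem integral_primitive_congr {f g : ℝ → ℝ} (h : f =ᵐ[unitVol] g) {x : ℝ}
    (hx : x ∈ Set.Icc (0 : ℝ) 1) : ∫ s in (0 : ℝ)..x, f s = ∫ s in (0 : ℝ)..x, g s := by
  rw [intervalIntegral.integral_of_le hx.1, intervalIntegral.integral_of_le hx.1]
  refine integral_congr_ae (ae_restrict_of_ae_restrict_of_subset ?_ h)
  exact fun s hs => ⟨hs.1.le, hs.2.trans hx.2⟩

theorem integral_deriv_eq_of_tsupport {φ : ℝ → ℝ} (hφ : ContDiff ℝ ∞ φ)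
    (hs : tsupport φ ⊆ Set.Ioo 0 1) (x : ℝ) : ∫ s in (0 : ℝ)..x, deriv φ s = φ x := by
  have h0 : φ 0 = 0 := image_eq_zero_of_notMem_tsupport fun h => (hs h).1.false
  rw [intervalIntegral.integral_eq_sub_of_hasDerivAt
    (fun s _ => (hφ.differentiable (by norm_num) s).hasDerivAt)
    ((hφ.continuous_deriv (by norm_num)).intervalIntegrable _ _), h0, sub_zero]

/-- Zero mean of `dv` and integration by parts against every `cas k` are closed linear conditions,
valid on test pairs and hence on the closure. The primitive of `dv` satisfies the same relations, so
completeness of the Hartley system identifies it with `v`. -/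
theorem primitive_of_mem_H01 {v dv : L2} (h : (v, dv) ∈ H01) :
    (∫ s in (0 : ℝ)..1, dv s) = 0 ∧ v =ᵐ[unitVol] fun x => ∫ s in (0 : ℝ)..x, dv s := by
  set H : ℤ → ℝ → ℝ := fun k x => ∫ s in (0 : ℝ)..x, cas k s with hH
  have hHc : ∀ k, Continuous (H k) := fun k => continuous_primitive (continuous_cas k)
  set HL : ℤ → L2 := fun k => (memLp_of_continuous (hHc k)).toLp (H k) with hHL
  have hHLe : ∀ k, HL k =ᵐ[unitVol] H k := fun k => MemLp.coeFn_toLp _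
  have hcasi : ∀ k, IntervalIntegrable (cas k) volume 0 1 :=
    fun k => (continuous_cas k).intervalIntegrable _ _
  set S : Set (L2 × L2) := {w | (inner ℝ w.2 (casL 0) : ℝ) = 0 ∧
    ∀ k, (inner ℝ w.1 (casL k) : ℝ) + (inner ℝ w.2 (HL k) : ℝ) = 0} with hS
  have hSc : IsClosed S := by
    have : S = {w | (inner ℝ w.2 (casL 0) : ℝ) = 0} ∩
        ⋂ k, {w | (inner ℝ w.1 (casL k) : ℝ) + (inner ℝ w.2 (HL k) : ℝ) = 0} := by
      ext w; simp [hS]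
    rw [this]
    refine (isClosed_eq (by fun_prop) continuous_const).inter (isClosed_iInter fun k => ?_)
    exact isClosed_eq (by fun_prop) continuous_const
  have hsub : testPairs ⊆ S := by
    rintro w ⟨φ, hφ, -, hsupp, h1, h2⟩
    have h11 : φ 1 = 0 := image_eq_zero_of_notMem_tsupport fun h => (hsupp h).2.false
    have hd := integral_deriv_eq_of_tsupport hφ hsupp
    have hφ'i : IntervalIntegrable (deriv φ) volume 0 1 :=
      (hφ.continuous_deriv (by norm_num)).intervalIntegrable _ _
    refine ⟨?_, fun k => ?_⟩
    · rw [inner_L2_eq h2 (coeFn_casL 0)]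
      simp only [cas, Int.cast_zero, mul_zero, zero_mul, Real.cos_zero, Real.sin_zero, add_zero,
        mul_one]
      rw [hd, h11]
    · rw [inner_L2_eq h1 (coeFn_casL k), inner_L2_eq h2 (hHLe k)]
      have := integral_primitive_mul hφ'i (hcasi k)
      simp only [hd, h11] at this
      rw [this]
      ring
  have hmem : (v, dv) ∈ S := closure_minimal hsub hSc h
  obtain ⟨hm1, hm2⟩ := hmem
  have hdvi := L2.intervalIntegrable dv
  have hint : ∫ s in (0 : ℝ)..1, dv s = 0 := by
    rw [inner_L2_eq (Filter.EventuallyEq.refl _ _) (coeFn_casL 0)] at hm1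
    simpa [cas] using hm1
  refine ⟨hint, ?_⟩
  set V : ℝ → ℝ := fun x => ∫ s in (0 : ℝ)..x, dv s with hV
  have hVc : ContinuousOn V (Set.Icc 0 1) := by
    have := intervalIntegral.continuousOn_primitive_interval' hdvi Set.left_mem_uIcc
    rwa [Set.uIcc_of_le zero_le_one] at this
  have hVm : MemLp V 2 unitVol := by
    obtain ⟨C, hC⟩ := isCompact_Icc.exists_bound_of_continuousOn hVc
    refine MemLp.of_bound (hVc.aestronglyMeasurable measurableSet_Icc) C ?_
    filter_upwards [ae_restrict_mem measurableSet_Icc] with x hx using hC x hx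
  have hVL := hVm.coeFn_toLp
  have hz : v - hVm.toLp V = 0 := by
    refine eq_zero_of_inner_casL_eq_zero _ fun k => ?_
    have h1 := hm2 k
    rw [inner_sub_right, real_inner_comm, inner_L2_eq (coeFn_casL k) hVL]
    simp only at h1
    rw [inner_L2_eq (Filter.EventuallyEq.refl _ dv) (hHLe k)] at h1
    have h2 := integral_primitive_mul hdvi (hcasi k)
    rw [hint] at h2
    have h3 : ∫ x in (0 : ℝ)..1, cas k x * V x = ∫ x in (0 : ℝ)..1, V x * cas k x := by
      simp_rw [mul_comm]
    rw [h3, h2]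
    linarith
  rw [sub_eq_zero.1 hz]
  exact hVL

/-! ### The lemma of du Bois-Reymond -/

theorem exists_contDiff_integral_eq_one : ∃ ψ : ℝ → ℝ, ContDiff ℝ ∞ ψ ∧ HasCompactSupport ψ ∧
    tsupport ψ ⊆ Set.Ioo 0 1 ∧ ∫ x, ψ x = 1 := by
  let f : ContDiffBump (1 / 2 : ℝ) := ⟨1 / 8, 1 / 4, by norm_num, by norm_num⟩
  refine ⟨f.normed volume, f.contDiff_normed, f.hasCompactSupport_normed, ?_, f.integral_normed⟩
  rw [f.tsupport_normed_eq]
  intro x hx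
  rw [Metric.mem_closedBall, Real.dist_eq, abs_le] at hx
  have h1 : f.rOut = 1 / 4 := rfl
  rw [h1] at hx
  constructor <;> linarith [hx.1, hx.2]

theorem exists_antideriv_of_integral_eq_zero {θ : ℝ → ℝ} (hθ : ContDiff ℝ ∞ θ)
    (hc : HasCompactSupport θ) (hs : tsupport θ ⊆ Set.Ioo 0 1) (h0 : ∫ x, θ x = 0) :
    ∃ φ : ℝ → ℝ, ContDiff ℝ ∞ φ ∧ HasCompactSupport φ ∧ tsupport φ ⊆ Set.Ioo 0 1 ∧
      deriv φ = θ := by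
  rcases (tsupport θ).eq_empty_or_nonempty with he | hne
  · have : θ = 0 := tsupport_eq_empty_iff.1 he
    refine ⟨0, contDiff_const, HasCompactSupport.zero, by simp, ?_⟩
    rw [this]; ext x; simp
  have hK : IsCompact (tsupport θ) := hc
  obtain ⟨p, hp, hpl⟩ := hK.exists_isLeast hne
  obtain ⟨q, hq, hqg⟩ := hK.exists_isGreatest hne
  have hz : ∀ x, x ∉ Set.Icc p q → θ x = 0 := fun x hx =>
    image_eq_zero_of_notMem_tsupport fun h => hx ⟨hpl h, hqg h⟩
  have hsub : Set.Icc p q ⊆ Set.Ioo 0 1 := fun x hx =>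
    ⟨(hs hp).1.trans_le hx.1, hx.2.trans_lt (hs hq).2⟩
  -- Any base point below the support works; `p / 2 < p` because `p > 0`.
  set φ : ℝ → ℝ := fun x => ∫ s in (p / 2)..x, θ s with hφ
  have hd : ∀ x, HasDerivAt φ (θ x) x := fun x =>
    intervalIntegral.integral_hasDerivAt_right (hθ.continuous.intervalIntegrable _ _)
      (hθ.continuous.stronglyMeasurableAtFilter _ _) hθ.continuous.continuousAt
  have hderiv : deriv φ = θ := funext fun x => (hd x).deriv
  have hpq : p ≤ q := hpl hq
  have hφ0 : ∀ x, x ∉ Set.Icc p q → φ x = 0 := fun x hx => by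
    have hp0 : p / 2 < p := half_lt_self (hs hp).1
    simp only [hφ]
    rcases lt_or_ge x p with hxp | hxp
    · refine intervalIntegral.integral_zero_ae (Filter.Eventually.of_forall fun s hsx => ?_)
      exact hz s fun hsI => (hsx.2.trans_lt (max_lt hp0 hxp)).not_ge hsI.1
    · have hqx : q < x := not_le.1 fun h => hx ⟨hxp, h⟩
      rw [intervalIntegral.integral_of_le (by linarith), ← h0]
      refine setIntegral_eq_integral_of_forall_compl_eq_zero fun s hsx => hz s fun hsI => hsx ?_
      exact ⟨hp0.trans_le hsI.1, hsI.2.trans hqx.le⟩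
  have hts : tsupport φ ⊆ Set.Icc p q :=
    closure_minimal (fun x hx => by by_contra h; exact hx (hφ0 x h)) isClosed_Icc
  refine ⟨φ, ?_, ?_, hts.trans hsub, hderiv⟩
  · rw [contDiff_infty_iff_deriv, hderiv]
    exact ⟨fun x => (hd x).differentiableAt, hθ⟩
  · exact isCompact_Icc.of_isClosed_subset (isClosed_tsupport φ) hts

theorem ae_eq_const_of_integral_mul_deriv_eq_zero {q : ℝ → ℝ} (hq : IntegrableOn q (Set.Icc 0 1))
    (h : ∀ φ : ℝ → ℝ, ContDiff ℝ ∞ φ → HasCompactSupport φ → tsupport φ ⊆ Set.Ioo 0 1 →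
      ∫ x in (0 : ℝ)..1, q x * deriv φ x = 0) : ∃ c : ℝ, q =ᵐ[unitVol] fun _ => c := by
  obtain ⟨ψ, hψ, hψc, hψs, hψ1⟩ := exists_contDiff_integral_eq_one
  have hqi : IntervalIntegrable q volume 0 1 :=
    (intervalIntegrable_iff_integrableOn_Icc_of_le zero_le_one).2 hq
  have hglob : ∀ (θ r : ℝ → ℝ), tsupport θ ⊆ Set.Ioo 0 1 →
      ∫ x, θ x * r x = ∫ x in (0 : ℝ)..1, r x * θ x := fun θ r hθ => by
    rw [intervalIntegral.integral_of_le zero_le_one]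
    simp_rw [mul_comm (r _)]
    refine (setIntegral_eq_integral_of_forall_compl_eq_zero fun x hx => ?_).symm
    rw [image_eq_zero_of_notMem_tsupport fun h => hx ⟨(hθ h).1, (hθ h).2.le⟩, zero_mul]
  set c := ∫ x in (0 : ℝ)..1, q x * ψ x with hc
  refine ⟨c, ?_⟩
  have hli : LocallyIntegrableOn (fun x => q x - c) (Set.Ioo 0 1) := by
    refine IntegrableOn.locallyIntegrableOn ?_
    exact (hq.mono_set Set.Ioo_subset_Icc_self).sub (integrableOn_const (by simp))
  have hae := isOpen_Ioo.ae_eq_zero_of_integral_contDiff_smul_eq_zero hli fun θ hθ hθc hθs => by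
    set I := ∫ x, θ x with hI
    have hθi : Integrable θ := hθ.continuous.integrable_of_hasCompactSupport hθc
    have hψi : Integrable ψ := hψ.continuous.integrable_of_hasCompactSupport hψc
    -- Subtracting `I * ψ` makes the mean zero, so the difference is the derivative of a test
    -- function.
    obtain ⟨φ, hφ, hφc, hφs, hφd⟩ := exists_antideriv_of_integral_eq_zero
      (θ := fun x => θ x - I * ψ x) (hθ.sub (contDiff_const.mul hψ)) (hθc.sub (hψc.mul_left))
      ((tsupport_sub _ _).trans (Set.union_subset hθs
        ((tsupport_mul_subset_right).trans hψs))) (by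
        rw [integral_sub hθi (hψi.const_mul I), integral_const_mul, hψ1, mul_one, sub_self])
    have h1 := h φ hφ hφc hφs
    rw [hφd] at h1
    simp only [mul_sub] at h1
    have i1 : IntervalIntegrable (fun x => q x * θ x) volume 0 1 :=
      hqi.mul_continuousOn hθ.continuous.continuousOn
    have i2 : IntervalIntegrable (fun x => q x * (I * ψ x)) volume 0 1 :=
      hqi.mul_continuousOn (continuous_const.mul hψ.continuous).continuousOn
    rw [intervalIntegral.integral_sub i1 i2] at h1
    have h2 : ∫ x in (0 : ℝ)..1, q x * (I * ψ x) = I * c := by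
      rw [hc, ← intervalIntegral.integral_const_mul]
      exact intervalIntegral.integral_congr fun x _ => by ring
    have h3 : I = ∫ x in (0 : ℝ)..1, θ x := by
      have := hglob θ (fun _ => 1) hθs
      simpa using this
    simp only [smul_eq_mul]
    rw [hglob θ (fun x => q x - c) hθs]
    simp only [sub_mul]
    rw [intervalIntegral.integral_sub i1 (Continuous.intervalIntegrable (by fun_prop) _ _),
      intervalIntegral.integral_const_mul, ← h3]
    linarith
  rw [Filter.EventuallyEq, ae_restrict_congr_set Ioo_ae_eq_Icc.symm,
    ae_restrict_iff' measurableSet_Ioo]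
  filter_upwards [hae] with x hx hxI
  exact sub_eq_zero.1 (hx hxI)

/-! ### Weak solutions -/

theorem IsWeakSolution.congr {ε : ℝ} {a a₀ b b₀ : ℝ → ℝ} (ha : Set.EqOn a a₀ (Set.Icc 0 1))
    (hb : Set.EqOn b b₀ (Set.Icc 0 1)) {f u : L2} (h : IsWeakSolution ε a₀ b₀ f u) :
    IsWeakSolution ε a b f u := by
  obtain ⟨du, hdu, h⟩ := h
  refine ⟨du, hdu, fun v dv hv => ?_⟩
  rw [← h v dv hv]
  congr 1
  · congr 1
    exact setIntegral_congr_fun measurableSet_Icc fun x hx => by simp only [ha hx]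
  · exact setIntegral_congr_fun measurableSet_Icc fun x hx => by simp only [hb hx]

/-- A weak solution with a continuous right-hand side is classical. -/
theorem IsWeakSolution.exists_classical {ε : ℝ} (hε : 0 < ε) {a b g : ℝ → ℝ} (ha : Continuous a)
    (hb : Continuous b) (hg : Continuous g) {f U : L2} (hf : f =ᵐ[unitVol] g)
    (h : IsWeakSolution ε a b f U) :
    ∃ u z : ℝ → ℝ, IsClassicalSolution ε a b g u z ∧ U =ᵐ[unitVol] u := by
  obtain ⟨du, hdu, h⟩ := h
  obtain ⟨hdu0, hU⟩ := primitive_of_mem_H01 hdu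
  have hdui := L2.intervalIntegrable du
  have hUi := L2.intervalIntegrable U
  set w : ℝ → ℝ := fun x => a x * du x + b x * U x - g x with hw
  have hwi : IntervalIntegrable w volume 0 1 :=
    ((hdui.continuousOn_mul ha.continuousOn).add (hUi.continuousOn_mul hb.continuousOn)).sub
      (hg.intervalIntegrable _ _)
  set W : ℝ → ℝ := fun x => ∫ s in (0 : ℝ)..x, w s with hW
  have hWi : IntegrableOn W (Set.Icc 0 1) := by
    have := intervalIntegral.continuousOn_primitive_interval' hwi Set.left_mem_uIcc
    rw [Set.uIcc_of_le zero_le_one] at this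
    exact this.integrableOn_Icc
  have hWii : IntervalIntegrable W volume 0 1 :=
    (intervalIntegrable_iff_integrableOn_Icc_of_le zero_le_one).2 hWi
  have hq : IntegrableOn (fun x => ε * du x - W x) (Set.Icc 0 1) := by
    refine Integrable.sub (Integrable.const_mul ?_ ε) hWi
    exact (intervalIntegrable_iff_integrableOn_Icc_of_le zero_le_one).1 hdui
  -- Integrating the lower-order terms by parts turns the weak equation into orthogonality of `ε u'
  -- - W` to all derivatives of test functions.
  obtain ⟨c, hc⟩ := ae_eq_const_of_integral_mul_deriv_eq_zero hq fun φ hφ hφc hφs => by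
    have hφ' : Continuous (deriv φ) := hφ.continuous_deriv (by norm_num)
    set v : L2 := (memLp_of_continuous hφ.continuous).toLp φ with hv
    set dv : L2 := (memLp_of_continuous hφ').toLp (deriv φ) with hdv
    have hve : v =ᵐ[unitVol] φ := MemLp.coeFn_toLp _
    have hdve : dv =ᵐ[unitVol] deriv φ := MemLp.coeFn_toLp _
    have h1 := h v dv (subset_closure ⟨φ, hφ, hφc, hφs, hve, hdve⟩)
    have e1 : ∫ x in Set.Icc (0 : ℝ) 1, du x * dv x = ∫ x in (0 : ℝ)..1, du x * deriv φ x := by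
      rw [← integral_unitVol]
      exact integral_congr_ae (by filter_upwards [hdve] with x hx; rw [hx])
    have e2 : ∫ x in Set.Icc (0 : ℝ) 1, a x * du x * v x =
        ∫ x in (0 : ℝ)..1, a x * du x * φ x := by
      rw [← integral_unitVol]
      exact integral_congr_ae (by filter_upwards [hve] with x hx; rw [hx])
    have e3 : ∫ x in Set.Icc (0 : ℝ) 1, b x * U x * v x =
        ∫ x in (0 : ℝ)..1, b x * U x * φ x := by
      rw [← integral_unitVol]
      exact integral_congr_ae (by filter_upwards [hve] with x hx; rw [hx])
    have e4 : ∫ x in Set.Icc (0 : ℝ) 1, f x * v x = ∫ x in (0 : ℝ)..1, g x * φ x := by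
      rw [← integral_unitVol]
      exact integral_congr_ae (by filter_upwards [hve, hf] with x hx hx'; rw [hx, hx'])
    rw [e1, e2, e3, e4] at h1
    have hd := integral_deriv_eq_of_tsupport hφ hφs
    have h11 : φ 1 = 0 := image_eq_zero_of_notMem_tsupport fun h => (hφs h).2.false
    have h2 := integral_primitive_mul hwi (hφ'.intervalIntegrable 0 1)
    simp only [hd, h11, mul_zero, zero_sub] at h2
    have i1 : IntervalIntegrable (fun x => a x * du x * φ x) volume 0 1 :=
      (hdui.continuousOn_mul ha.continuousOn).mul_continuousOn hφ.continuous.continuousOn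
    have i2 : IntervalIntegrable (fun x => b x * U x * φ x) volume 0 1 :=
      (hUi.continuousOn_mul hb.continuousOn).mul_continuousOn hφ.continuous.continuousOn
    have i3 : IntervalIntegrable (fun x => g x * φ x) volume 0 1 :=
      (hg.mul hφ.continuous).intervalIntegrable _ _
    have h3 : ∫ x in (0 : ℝ)..1, w x * φ x = (∫ x in (0 : ℝ)..1, a x * du x * φ x) +
        (∫ x in (0 : ℝ)..1, b x * U x * φ x) - ∫ x in (0 : ℝ)..1, g x * φ x := by
      rw [← intervalIntegral.integral_add i1 i2, ← intervalIntegral.integral_sub (i1.add i2) i3]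
      exact intervalIntegral.integral_congr fun x _ => by simp only [hw]; ring
    simp only [sub_mul]
    have i4 : IntervalIntegrable (fun x => ε * du x * deriv φ x) volume 0 1 :=
      (hdui.const_mul ε).mul_continuousOn hφ'.continuousOn
    have i5 : IntervalIntegrable (fun x => W x * deriv φ x) volume 0 1 :=
      hWii.mul_continuousOn hφ'.continuousOn
    rw [intervalIntegral.integral_sub i4 i5, h2, h3]
    simp only [mul_assoc]
    rw [intervalIntegral.integral_const_mul]
    simp only [← mul_assoc]
    linarith
  -- Bootstrap: first `u'` has a continuous representative `z₀`, then the integrand has a continuous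
  -- representative `w₁`, whose primitive is differentiable. The cut-off makes `z₀` continuous on
  -- the whole line.
  set w₀ : ℝ → ℝ := (Set.Icc (0 : ℝ) 1).indicator w with hw₀
  have hw₀i : Integrable w₀ := by
    rw [hw₀, integrable_indicator_iff measurableSet_Icc]
    exact (intervalIntegrable_iff_integrableOn_Icc_of_le zero_le_one).1 hwi
  have hw₀e : w₀ =ᵐ[unitVol] w := indicator_ae_eq_restrict measurableSet_Icc
  set z₀ : ℝ → ℝ := fun x => (c + ∫ s in (0 : ℝ)..x, w₀ s) / ε with hz₀
  have hz₀c : Continuous z₀ := by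
    have := intervalIntegral.continuous_primitive (fun p q => hw₀i.intervalIntegrable) (0 : ℝ)
    fun_prop
  have hduz : du =ᵐ[unitVol] z₀ := by
    filter_upwards [hc, ae_restrict_mem measurableSet_Icc] with x hx hxI
    rw [hz₀]
    simp only
    rw [integral_primitive_congr hw₀e hxI, eq_div_iff hε.ne']
    simp only [hW] at hx
    linarith
  set u₀ : ℝ → ℝ := fun x => ∫ s in (0 : ℝ)..x, z₀ s with hu₀
  have hu₀c : Continuous u₀ := continuous_primitive hz₀c
  have hUu : U =ᵐ[unitVol] u₀ := by
    filter_upwards [hU, ae_restrict_mem measurableSet_Icc] with x hx hxI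
    rw [hx, integral_primitive_congr hduz hxI]
  set w₁ : ℝ → ℝ := fun x => a x * z₀ x + b x * u₀ x - g x with hw₁
  have hw₁c : Continuous w₁ := by fun_prop
  have hww : w₀ =ᵐ[unitVol] w₁ := by
    filter_upwards [hw₀e, hduz, hUu] with x h1 h2 h3
    rw [h1, hw, hw₁]
    simp only [h2, h3]
  set z : ℝ → ℝ := fun x => (c + ∫ s in (0 : ℝ)..x, w₁ s) / ε with hz
  have hzz : ∀ x ∈ Set.Icc (0 : ℝ) 1, z x = z₀ x := fun x hx => by
    simp only [hz, hz₀, integral_primitive_congr hww hx]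
  have hzc : Continuous z := by fun_prop
  have hzae : z =ᵐ[unitVol] z₀ := by
    filter_upwards [ae_restrict_mem measurableSet_Icc] with x hx using hzz x hx
  set u : ℝ → ℝ := fun x => ∫ s in (0 : ℝ)..x, z s with hu
  have huu : ∀ x ∈ Set.Icc (0 : ℝ) 1, u x = u₀ x := fun x hx => integral_primitive_congr hzae hx
  refine ⟨u, z, ⟨hzc, hasDerivAt_primitive hzc, fun x hx => ?_, ?_, ?_⟩, ?_⟩
  · refine (((hasDerivAt_primitive hw₁c x).const_add c).div_const ε).congr_deriv ?_
    rw [hw₁]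
    simp only [hzz x hx, huu x hx]
  · simp [hu]
  · have h1 : (1 : ℝ) ∈ Set.Icc (0 : ℝ) 1 := Set.right_mem_Icc.2 zero_le_one
    rw [huu 1 h1]
    simp only [hu₀]
    rw [← integral_primitive_congr hduz h1, hdu0]
  · filter_upwards [hUu, ae_restrict_mem measurableSet_Icc] with x hx hxI
    rw [hx, huu x hxI]

/-! ### Linearity of the solution operator -/

theorem smul_add_mem_testPairs (c : ℝ) {v w : L2 × L2} (hv : v ∈ testPairs) (hw : w ∈ testPairs) :
    c • v + w ∈ testPairs := by
  obtain ⟨φ, hφ, hφc, hφs, h1, h2⟩ := hv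
  obtain ⟨ψ, hψ, hψc, hψs, h3, h4⟩ := hw
  refine ⟨c • φ + ψ, (hφ.const_smul c).add hψ, ?_, ?_, ?_, ?_⟩
  · exact (hφc.smul_left (f := fun _ => c)).add hψc
  · refine (tsupport_add _ _).trans (Set.union_subset ?_ hψs)
    exact (tsupport_smul_subset_right (fun _ => c) φ).trans hφs
  · filter_upwards [Lp.coeFn_add (c • v.1) w.1, Lp.coeFn_smul c v.1, h1, h3] with x e1 e2 e3 e4
    simp only [Prod.fst_add, Prod.smul_fst, e1, Pi.add_apply, e2, Pi.smul_apply, e3, e4]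
  · filter_upwards [Lp.coeFn_add (c • v.2) w.2, Lp.coeFn_smul c v.2, h2, h4] with x e1 e2 e3 e4
    have hd : deriv (c • φ + ψ) x = c • deriv φ x + deriv ψ x :=
      (((hφ.differentiable (by norm_num) x).hasDerivAt.const_smul c).add
        (hψ.differentiable (by norm_num) x).hasDerivAt).deriv
    simp only [Prod.snd_add, Prod.smul_snd, e1, Pi.add_apply, e2, Pi.smul_apply, e3, e4, hd]

theorem smul_add_mem_H01 (c : ℝ) {v w : L2 × L2} (hv : v ∈ H01) (hw : w ∈ H01) :
    c • v + w ∈ H01 :=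
  map_mem_closure₂ (f := fun v w : L2 × L2 => c • v + w) (by fun_prop) hv hw
    fun _ hv _ hw => smul_add_mem_testPairs c hv hw

theorem integrable_mul_L2 {a : ℝ → ℝ} (ha : Continuous a) (f g : L2) :
    Integrable (fun x => a x * f x * g x) unitVol := by
  have h := (Lp.memLp f).integrable_mul (Lp.memLp g)
  obtain ⟨C, hC⟩ := (isCompact_Icc (a := (0 : ℝ)) (b := 1)).exists_bound_of_continuousOn
    ha.continuousOn
  refine (h.bdd_mul (c := C) ha.aestronglyMeasurable ?_).congr
    (Filter.Eventually.of_forall fun x => by simp [mul_assoc])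
  filter_upwards [ae_restrict_mem measurableSet_Icc] with x hx using hC x hx

theorem integral_mul_smul_add {a : ℝ → ℝ} (ha : Continuous a) (c : ℝ) (f₁ f₂ g : L2) :
    ∫ x, a x * (c • f₁ + f₂ : L2) x * g x ∂unitVol =
      c * (∫ x, a x * f₁ x * g x ∂unitVol) + ∫ x, a x * f₂ x * g x ∂unitVol := by
  rw [← integral_const_mul, ← integral_add ((integrable_mul_L2 ha f₁ g).const_mul c)
    (integrable_mul_L2 ha f₂ g)]
  refine integral_congr_ae ?_
  filter_upwards [Lp.coeFn_add (c • f₁) f₂, Lp.coeFn_smul c f₁] with x e1 e2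
  simp only [e1, Pi.add_apply, e2, Pi.smul_apply, smul_eq_mul]
  ring

theorem IsWeakSolution.smul_add {ε : ℝ} {a b : ℝ → ℝ} (ha : Continuous a) (hb : Continuous b)
    {f₁ f₂ u₁ u₂ : L2} (c : ℝ) (h₁ : IsWeakSolution ε a b f₁ u₁)
    (h₂ : IsWeakSolution ε a b f₂ u₂) : IsWeakSolution ε a b (c • f₁ + f₂) (c • u₁ + u₂) := by
  obtain ⟨du₁, hdu₁, h₁⟩ := h₁
  obtain ⟨du₂, hdu₂, h₂⟩ := h₂
  refine ⟨c • du₁ + du₂, smul_add_mem_H01 c hdu₁ hdu₂, fun v dv hv => ?_⟩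
  have e1 := integral_mul_smul_add (continuous_const (y := (1 : ℝ))) c du₁ du₂ dv
  have e4 := integral_mul_smul_add (continuous_const (y := (1 : ℝ))) c f₁ f₂ v
  simp only [one_mul] at e1 e4
  rw [e1, e4, integral_mul_smul_add ha, integral_mul_smul_add hb, ← h₁ v dv hv, ← h₂ v dv hv]
  ring

/-- The solution operator as a linear map. -/
theorem IsSolutionOperator.exists_linearMap {ε : ℝ} {a b : ℝ → ℝ} {G : L2 → L2}
    (ha : ContinuousOn a (Set.Icc 0 1)) (hb : ContinuousOn b (Set.Icc 0 1))
    (hG : IsSolutionOperator ε a b G) : ∃ T : L2 →ₗ[ℝ] L2, ⇑T = G := by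
  set ac := Set.IccExtend zero_le_one ((Set.Icc (0 : ℝ) 1).domRestrict a)
  set bc := Set.IccExtend zero_le_one ((Set.Icc (0 : ℝ) 1).domRestrict b)
  have hac : Continuous ac := (continuousOn_iff_continuous_domRestrict.1 ha).Icc_extend'
  have hbc : Continuous bc := (continuousOn_iff_continuous_domRestrict.1 hb).Icc_extend'
  have ea : Set.EqOn ac a (Set.Icc 0 1) := fun x hx => Set.IccExtend_of_mem _ _ hx
  have eb : Set.EqOn bc b (Set.Icc 0 1) := fun x hx => Set.IccExtend_of_mem _ _ hx
  have hs : ∀ f, IsWeakSolution ε ac bc f (G f) := fun f => ((hG f _).2 rfl).congr ea eb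
  -- The left-hand side is a weak solution, and weak solutions are unique.
  have key : ∀ (c : ℝ) (f₁ f₂ : L2), c • G f₁ + G f₂ = G (c • f₁ + f₂) := fun c f₁ f₂ =>
    (hG _ _).1 (((hs f₁).smul_add hac hbc c (hs f₂)).congr ea.symm eb.symm)
  have h0 : G 0 = 0 := by
    have := key 1 0 0
    simpa using this
  refine ⟨{ toFun := G, map_add' := fun f₁ f₂ => ?_, map_smul' := fun c f => ?_ }, rfl⟩
  · simpa using (key 1 f₁ f₂).symm
  · simpa [h0] using (key c f 0).symm

/-! ### The networks -/

/-- The weight of the `j`-th ReLU in the piecewise linear interpolant of `u`. -/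
def pwLinearWeight (t : ℕ → ℝ) (N : ℕ) (u : ℝ → ℝ) (j : ℕ) : ℝ :=
  (if j < N then (u (t (j + 1)) - u (t j)) / (t (j + 1) - t j) else 0) -
    if 0 < j then (u (t (j - 1 + 1)) - u (t (j - 1))) / (t (j - 1 + 1) - t (j - 1)) else 0

/-- Summation by parts: each node carries the slope on its right minus the slope on its left, which
puts the interpolant in the form of one hidden layer. -/
theorem pwLinear_eq_sum_weight (t : ℕ → ℝ) (N : ℕ) (u : ℝ → ℝ) (x : ℝ) :
    pwLinear t N u x = u (t 0) +
      ∑ j ∈ Finset.range (N + 1), pwLinearWeight t N u j * max 0 (x - t j) := by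
  simp only [pwLinear, pwLinearWeight, sub_mul, Finset.sum_sub_distrib, mul_sub]
  congr 2
  · rw [Finset.sum_range_succ]
    simp only [lt_self_iff_false, if_false, zero_mul, add_zero]
    refine Finset.sum_congr rfl fun j hj => ?_
    rw [if_pos (Finset.mem_range.1 hj)]
  · rw [Finset.sum_range_succ']
    simp

theorem sum_fin_eq_sum_Icc {n P : ℕ} (hP : 2 * n + 1 ≤ P) (h : ℤ → ℝ) :
    ∑ k : Fin P, (if (k : ℕ) < 2 * n + 1 then h ((k : ℕ) - (n : ℤ)) else 0) =
      ∑ i ∈ Finset.Icc (-(n : ℤ)) n, h i := by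
  rw [Fin.sum_univ_eq_sum_range
    (fun k : ℕ => if k < 2 * n + 1 then h ((k : ℤ) - (n : ℤ)) else 0) P]
  obtain ⟨r, rfl⟩ := Nat.exists_eq_add_of_le hP
  rw [Finset.sum_range_add, Finset.sum_eq_zero (s := Finset.range r) fun j _ =>
    if_neg (by lia), add_zero]
  refine Finset.sum_bij' (fun k _ => (k : ℤ) - n) (fun i _ => (i + n).toNat) ?_ ?_ ?_ ?_ ?_
  · intro k hk
    have := Finset.mem_range.1 hk
    exact Finset.mem_Icc.2 ⟨by lia, by lia⟩
  · intro i hi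
    have := Finset.mem_Icc.1 hi
    exact Finset.mem_range.2 (by lia)
  · intro k _
    lia
  · intro i hi
    have := Finset.mem_Icc.1 hi
    lia
  · intro k hk
    rw [if_pos (Finset.mem_range.1 hk)]

/-- Output `k` stands for the frequency `k - n`; the branch vanishes on the outputs beyond `2n`, and
`τ_0 = 0`. -/
theorem exists_nets {m n P : ℕ} (hP : 2 * n + 1 ≤ P) (t : ℕ → ℝ) (N : ℕ) (U : ℤ → ℝ → ℝ) :
    ∃ (τ : ReLUNet 1 (P + 1)) (β : ReLUNet m P), τ.depth = 1 ∧
      τ.width = max 1 (max (N + 1) (P + 1)) ∧ β.depth = 0 ∧ β.width = max m P ∧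
      ∀ v x, trunkSum τ (β.eval v) x =
        ∑ i ∈ Finset.Icc (-(n : ℤ)) n, sampleCoeff m i v * pwLinear t N (U i) x := by
  refine ⟨.layer (fun (_ : Fin (N + 1)) _ => 1) (fun j => -t j)
    (.affine (Fin.cons (fun _ => 0) fun (k : Fin P) j =>
      pwLinearWeight t N (U ((k : ℕ) - (n : ℤ))) j)
      (Fin.cons 0 fun k : Fin P => U ((k : ℕ) - (n : ℤ)) (t 0))),
    .affine (fun k j => if (k : ℕ) < 2 * n + 1 then
      1 / m * cas ((k : ℕ) - (n : ℤ)) (((j : ℝ) + 1) / m) else 0) 0, rfl, rfl, rfl, rfl, ?_⟩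
  intro v x
  rw [← sum_fin_eq_sum_Icc hP]
  simp only [trunkSum, ReLUNet.eval, Pi.add_apply, Matrix.mulVec, dotProduct, Fin.cons_zero,
    Fin.cons_succ, zero_mul, Finset.sum_const_zero, add_zero, zero_add, Pi.zero_apply, one_mul,
    Finset.univ_unique, Finset.sum_singleton]
  refine Finset.sum_congr rfl fun k _ => ?_
  by_cases hk : (k : ℕ) < 2 * n + 1
  · simp only [hk, if_true]
    congr 1
    · rw [sampleCoeff, Finset.mul_sum]
      exact Finset.sum_congr rfl fun j _ => by ring
    · rw [pwLinear_eq_sum_weight, add_comm, ← Fin.sum_univ_eq_sum_range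
        (fun j => pwLinearWeight t N (U ((k : ℕ) - (n : ℤ))) j * max 0 (x - t j))]
      simp only [sub_eq_add_neg]
  · simp [hk]

/-! ### The error for trigonometric polynomials -/

theorem coeFn_sum_smul {ι : Type*} (s : Finset ι) (c : ι → ℝ) {fL : ι → L2} {f : ι → ℝ → ℝ}
    (h : ∀ i, fL i =ᵐ[unitVol] f i) :
    (∑ i ∈ s, c i • fL i : L2) =ᵐ[unitVol] fun x => ∑ i ∈ s, c i * f i x := by
  classical
  induction s using Finset.induction_on with
  | empty =>
    simp only [Finset.sum_empty]
    exact Lp.coeFn_zero ℝ 2 unitVol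
  | insert i s hi ih =>
    rw [Finset.sum_insert hi]
    filter_upwards [Lp.coeFn_add (c i • fL i) (∑ i ∈ s, c i • fL i), Lp.coeFn_smul (c i) (fL i),
      h i, ih] with x e1 e2 e3 e4
    simp only [e1, Pi.add_apply, e2, Pi.smul_apply, e3, e4, Finset.sum_insert hi, smul_eq_mul]

theorem norm_sq_sum_casL_neg (s : Finset ℤ) (c : ℤ → ℝ) :
    ‖∑ i ∈ s, c i • casL (-i)‖ ^ 2 = ∑ i ∈ s, c i ^ 2 := by
  have h := (orthonormal_casL.comp (fun i : ℤ => -i) neg_injective).inner_sum c c s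
  rw [← real_inner_self_eq_norm_sq]
  simpa [sq] using h

theorem IsClassicalSolution.sum {ε : ℝ} {a b : ℝ → ℝ} {ι : Type*} (s : Finset ι) (c : ι → ℝ)
    {g u z : ι → ℝ → ℝ} (h : ∀ i, IsClassicalSolution ε a b (g i) (u i) (z i)) :
    IsClassicalSolution ε a b (fun x => ∑ i ∈ s, c i * g i x) (fun x => ∑ i ∈ s, c i * u i x)
      (fun x => ∑ i ∈ s, c i * z i x) where
  continuous_z := continuous_finsetSum _ fun i _ => continuous_const.mul (h i).continuous_z
  hasDerivAt_u x := HasDerivAt.fun_sum fun i _ => ((h i).hasDerivAt_u x).const_mul (c i)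
  hasDerivAt_z x hx := by
    refine (HasDerivAt.fun_sum fun i _ => ((h i).hasDerivAt_z x hx).const_mul (c i)).congr_deriv ?_
    rw [Finset.mul_sum, Finset.mul_sum, ← Finset.sum_add_distrib, ← Finset.sum_sub_distrib,
      Finset.sum_div]
    exact Finset.sum_congr rfl fun i _ => by ring
  left := by simp [(h _).left]
  right := by simp [(h _).right]

/-- Piecewise linear interpolation of the solutions with trigonometric right-hand sides. -/
theorem exists_interpolated_solutions {a b : ℝ → ℝ} {α : ℝ} (hα : 0 < α)
    (ha : ContDiffOn ℝ 2 a (Set.Icc 0 1)) (hb : ContDiffOn ℝ 2 b (Set.Icc 0 1))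
    (haα : ∀ x ∈ Set.Icc (0 : ℝ) 1, α ≤ a x) (Λ : ℝ≥0) {γ : ℝ} (hγ : 0 < γ) :
    ∃ C : ℝ, 0 < C ∧ ∀ (ε : ℝ) (G : L2 → L2), 0 < ε → IsSolutionOperator ε a b G →
      LipschitzWith Λ G → ∀ N : ℕ, 1 ≤ N → ∃ (t : ℕ → ℝ) (U : ℤ → ℝ → ℝ) (p : ℤ → L2),
        (∀ i, p i =ᵐ[unitVol] pwLinear t (2 * N) (U i)) ∧
        ∀ (P n : ℕ) (c : ℤ → ℝ), 1 ≤ P → n ≤ P →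
          ‖G (∑ i ∈ Finset.Icc (-(n : ℤ)) n, c i • casL i) -
            ∑ i ∈ Finset.Icc (-(n : ℤ)) n, c i • p i‖ ≤
          C * (P * (N : ℝ) ^ (γ - 2)) * ‖∑ i ∈ Finset.Icc (-(n : ℤ)) n, c i • casL i‖ := by
  obtain ⟨ae, a', ha'c, ha'd, hae⟩ := exists_C1_extension ha
  obtain ⟨be, b', hb'c, hb'd, hbe⟩ := exists_C1_extension hb
  have haec : Continuous ae := continuous_iff_continuousAt.2 fun x => (ha'd x).continuousAt
  have hbec : Continuous be := continuous_iff_continuousAt.2 fun x => (hb'd x).continuousAt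
  have hbd : ∀ f : ℝ → ℝ, Continuous f → ∃ C, ∀ x ∈ Set.Icc (0 : ℝ) 1, |f x| ≤ C := fun f hf =>
    isCompact_Icc.exists_bound_of_continuousOn hf.continuousOn
  obtain ⟨B₁, hB₁⟩ := hbd ae haec
  obtain ⟨B₂, hB₂⟩ := hbd be hbec
  obtain ⟨B₃, hB₃⟩ := hbd a' ha'c
  obtain ⟨B₄, hB₄⟩ := hbd b' hb'c
  have hc : Coefficients ae a' be b' α (max (max B₁ B₂) (max B₃ B₄)) :=
    { pos := hα
      hasDerivAt_a := ha'd
      hasDerivAt_b := hb'd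
      le_a := fun x hx => by rw [hae hx]; exact haα x hx
      abs_a_le := fun x hx => (hB₁ x hx).trans (by simp)
      abs_b_le := fun x hx => (hB₂ x hx).trans (by simp)
      abs_a'_le := fun x hx => (hB₃ x hx).trans (by simp)
      abs_b'_le := fun x hx => (hB₄ x hx).trans (by simp) }
  obtain ⟨C, hC, hmain⟩ := exists_interpolation_error_bound hc Λ.coe_nonneg hγ
  refine ⟨C * (2 * Real.pi), by positivity, fun ε G hε hG hGL N hN => ?_⟩
  obtain ⟨t, ht⟩ := hmain ε N hε hN
  obtain ⟨T, hT⟩ := hG.exists_linearMap ha.continuousOn hb.continuousOn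
  have hex : ∀ i, ∃ u z : ℝ → ℝ, IsClassicalSolution ε ae be (cas i) u z ∧
      G (casL i) =ᵐ[unitVol] u := fun i =>
    (((hG (casL i) _).2 rfl).congr hae hbe).exists_classical hε haec hbec (continuous_cas i)
      (coeFn_casL i)
  choose u z hu hGu using hex
  have hpm : ∀ i, MemLp (pwLinear t (2 * N) (u i)) 2 unitVol :=
    fun i => memLp_of_continuous (continuous_pwLinear t (2 * N) (u i))
  refine ⟨t, u, fun i => (hpm i).toLp _, fun i => (hpm i).coeFn_toLp, fun P n c hP hn => ?_⟩
  set s := Finset.Icc (-(n : ℤ)) n with hs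
  set g : L2 := ∑ i ∈ s, c i • casL i with hg
  have hge := coeFn_sum_smul s c coeFn_casL
  have hGg : G g = ∑ i ∈ s, c i • G (casL i) := by
    rw [← hT, hg, map_sum]
    exact Finset.sum_congr rfl fun i _ => map_smul T _ _
  have hGe : G g =ᵐ[unitVol] fun x => ∑ i ∈ s, c i * u i x := by
    rw [hGg]; exact coeFn_sum_smul s c hGu
  have hpe := coeFn_sum_smul s c fun i => (hpm i).coeFn_toLp
  have hP1 : (1 : ℝ) ≤ P := by exact_mod_cast hP
  have hpi : (1 : ℝ) ≤ 2 * Real.pi := by linarith [Real.pi_gt_three]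
  -- Bernstein's inequality: `M` bounds both `g` and its derivative in `L²`, since `n ≤ P`.
  set M := 2 * Real.pi * P * ‖g‖ with hM
  have hgM : ‖g‖ ≤ M := by
    rw [hM]
    refine le_mul_of_one_le_left (norm_nonneg _) ?_
    nlinarith
  have hM0 : 0 ≤ M := (norm_nonneg _).trans hgM
  have h1 : ∫ x in (0 : ℝ)..1, (∑ i ∈ s, c i * cas i x) ^ 2 ≤ M ^ 2 := by
    rw [← norm_sq_L2_eq hge]
    exact pow_le_pow_left₀ (norm_nonneg _) hgM 2
  have h2 : ∫ x in (0 : ℝ)..1, (∑ i ∈ s, c i * (2 * Real.pi * i * cas (-i) x)) ^ 2 ≤ M ^ 2 := by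
    have e1 := coeFn_sum_smul s (fun i => c i * (2 * Real.pi * i)) fun i => coeFn_casL (-i)
    simp only [mul_assoc (c _)] at e1
    rw [← norm_sq_L2_eq e1, norm_sq_sum_casL_neg, hM, mul_pow, hg, norm_sq_sum_casL,
      Finset.mul_sum]
    refine Finset.sum_le_sum fun i hi => ?_
    rw [mul_pow, mul_comm]
    refine mul_le_mul_of_nonneg_right (sq_le_sq' ?_ ?_) (sq_nonneg _)
    all_goals
      have hi' := Finset.mem_Icc.1 hi
      have hi1 : -(P : ℝ) ≤ i := by exact_mod_cast (by lia : -(P : ℤ) ≤ i)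
      have hi2 : (i : ℝ) ≤ P := by exact_mod_cast (by lia : i ≤ (P : ℤ))
      nlinarith [Real.pi_pos]
  have h3 : ∫ x in (0 : ℝ)..1, (∑ i ∈ s, c i * u i x) ^ 2 ≤ (Λ * M) ^ 2 := by
    rw [← norm_sq_L2_eq hGe]
    refine pow_le_pow_left₀ (norm_nonneg _) ?_ 2
    have h0 : G 0 = 0 := by rw [← hT, map_zero]
    have := hGL.norm_sub_le g 0
    rw [h0, sub_zero, sub_zero] at this
    exact this.trans (mul_le_mul_of_nonneg_left hgM Λ.coe_nonneg)
  -- The estimate is applied to the combined solution, not to each frequency, so no sum of absolute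
  -- coefficients appears.
  have h4 := ht M _ (fun x => ∑ i ∈ s, c i * (2 * Real.pi * i * cas (-i) x)) _ _ hM0 (by fun_prop)
    (fun x => HasDerivAt.fun_sum fun i _ => (hasDerivAt_cas i x).const_mul (c i)) h1 h2
    (IsClassicalSolution.sum s c hu) h3
  have h5 : (G g - ∑ i ∈ s, c i • (hpm i).toLp _ : L2) =ᵐ[unitVol] fun x =>
      (∑ i ∈ s, c i * u i x) -
        pwLinear t (2 * N) (fun y => ∑ i ∈ s, c i * u i y) x := by
    filter_upwards [Lp.coeFn_sub (G g) (∑ i ∈ s, c i • (hpm i).toLp _), hGe, hpe] with x e1 e2 e3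
    rw [e1, Pi.sub_apply, e2, e3, pwLinear_sum]
  have h6 := le_of_sq_le_sq ((norm_sq_L2_eq h5).trans_le h4) (by positivity)
  refine h6.trans (le_of_eq ?_)
  rw [hM]
  ring

/-! ### The mean-square error of the DeepONet. -/

theorem exists_deepONet_error_bound {a b : ℝ → ℝ} {α : ℝ} (hα : 0 < α)
    (ha : ContDiffOn ℝ 2 a (Set.Icc 0 1)) (hb : ContDiffOn ℝ 2 b (Set.Icc 0 1))
    (haα : ∀ x ∈ Set.Icc (0 : ℝ) 1, α ≤ a x) (Λ : ℝ≥0) {γ : ℝ} (hγ : 0 < γ) :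
    ∃ C : ℝ, 0 < C ∧ ∀ (ε : ℝ) (G : L2 → L2), 0 < ε → IsSolutionOperator ε a b G →
      LipschitzWith Λ G → ∀ (l : ℝ) (μ : Measure L2), 0 < l → IsRBFGaussian l μ →
      ∀ (m P n N : ℕ) (κ : ℝ), 2 * n + 1 ≤ m → 2 * n + 1 ≤ P → 1 ≤ N → 0 ≤ κ →
        κ ≤ n + 1 / 2 →
      ∃ (τ : ReLUNet 1 (P + 1)) (β : ReLUNet m P),
        τ.depth = 1 ∧ τ.width = max 1 (max (2 * N + 1) (P + 1)) ∧
        β.depth = 0 ∧ β.width = max m P ∧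
        MemLp (fun f : L2 => G f - deepONet τ β f) 2 μ ∧
        ∫ f : L2, ‖G f - deepONet τ β f‖ ^ 2 ∂μ ≤
          72 * Λ ^ 2 * Real.exp (-(2 * Real.pi ^ 2 * l ^ 2 * κ ^ 2)) +
            8 * (3 * l + 4) * (C * (P * (N : ℝ) ^ (γ - 2))) ^ 2 := by
  obtain ⟨C, hC, hmain⟩ := exists_interpolated_solutions hα ha hb haα Λ hγ
  refine ⟨C, hC, fun ε G hε hG hGL l μ hl hμ m P n N κ hm hP hN hκ hκn => ?_⟩
  obtain ⟨t, U, p, hp, hbound⟩ := hmain ε G hε hG hGL N hN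
  obtain ⟨τ, β, hτd, hτw, hβd, hβw, heval⟩ := exists_nets (m := m) hP t (2 * N) U
  refine ⟨τ, β, hτd, hτw, hβd, hβw, ?_⟩
  set s := Finset.Icc (-(n : ℤ)) n with hs
  set S : L2 → L2 := fun f => sampleProj m n (encoder m f) with hS
  set Φ : L2 → L2 := fun g => ∑ i ∈ s, (inner ℝ (casL i) g : ℝ) • p i with hΦ
  have hΦc : Continuous Φ := by fun_prop
  have hcoef : ∀ v, ∀ i ∈ s, (inner ℝ (casL i) (sampleProj m n v) : ℝ) = sampleCoeff m i v :=
    fun v i hi => by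
      rw [sampleProj_apply, orthonormal_casL.inner_right_sum _ hi]
  have hnet : ∀ f, deepONet τ β f = Φ (S f) := fun f => by
    have h1 : Φ (S f) = ∑ i ∈ s, sampleCoeff m i (encoder m f) • p i :=
      Finset.sum_congr rfl fun i hi => by rw [hS]; simp only [hcoef _ i hi]
    rw [h1]
    refine Lp.ext ((memLp_trunkSum τ (β.eval (encoder m f))).coeFn_toLp.trans ?_)
    refine Filter.EventuallyEq.trans (Filter.Eventually.of_forall fun x => ?_)
      (coeFn_sum_smul s _ hp).symm
    exact heval _ x
  set ρ := C * (P * (N : ℝ) ^ (γ - 2)) with hρ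
  have hρ0 : 0 ≤ ρ := by positivity
  have herr : ∀ f, ‖G (S f) - Φ (S f)‖ ≤ ρ * ‖S f‖ := fun f => by
    have h1 : Φ (S f) = ∑ i ∈ s, sampleCoeff m i (encoder m f) • p i :=
      Finset.sum_congr rfl fun i hi => by rw [hS]; simp only [hcoef _ i hi]
    rw [h1]
    exact hbound P n (fun i => sampleCoeff m i (encoder m f)) (by lia) (by lia)
  obtain ⟨hSm, hSb⟩ := memLp_sampleProj_encoder hl hμ hm
  obtain ⟨hRm, hRb⟩ := memLp_sub_sampleProj_encoder hl hμ hm hκ hκn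
  have hGc : Continuous G := hGL.continuous
  have hpoint : ∀ f, ‖G f - Φ (S f)‖ ≤ Λ * ‖f - S f‖ + ρ * ‖S f‖ := fun f => by
    have h1 : G f - Φ (S f) = (G f - G (S f)) + (G (S f) - Φ (S f)) := by abel
    rw [h1]
    exact (norm_add_le _ _).trans (add_le_add (hGL.norm_sub_le _ _) (herr f))
  simp only [hnet]
  have hmeas : AEStronglyMeasurable (fun f => G f - Φ (S f)) μ :=
    hGc.aestronglyMeasurable.sub (hΦc.comp_aestronglyMeasurable hSm.1)
  have hdom : MemLp (fun f : L2 => (Λ : ℝ) * ‖f - S f‖ + ρ * ‖S f‖) 2 μ :=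
    (hRm.norm.const_mul _).add (hSm.norm.const_mul _)
  have hm2 : MemLp (fun f => G f - Φ (S f)) 2 μ :=
    hdom.mono' hmeas (Filter.Eventually.of_forall hpoint)
  refine ⟨hm2, ?_⟩
  have i1 : Integrable (fun f : L2 => ‖f - S f‖ ^ 2) μ := hRm.integrable_norm_pow (by norm_num)
  have i2 : Integrable (fun f : L2 => ‖S f‖ ^ 2) μ := hSm.integrable_norm_pow (by norm_num)
  have hint : ∫ f : L2, ‖G f - Φ (S f)‖ ^ 2 ∂μ ≤
      ∫ f : L2, (2 * Λ ^ 2 * ‖f - S f‖ ^ 2 + 2 * ρ ^ 2 * ‖S f‖ ^ 2) ∂μ := by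
    refine integral_mono (hm2.integrable_norm_pow (by norm_num))
      ((i1.const_mul _).add (i2.const_mul _)) fun f => ?_
    have h1 := pow_le_pow_left₀ (norm_nonneg _) (hpoint f) 2
    simp only
    nlinarith [sq_nonneg (Λ * ‖f - S f‖ - ρ * ‖S f‖)]
  rw [integral_add (i1.const_mul _) (i2.const_mul _), integral_const_mul,
    integral_const_mul] at hint
  have e1 := mul_le_mul_of_nonneg_left hRb (by positivity : (0 : ℝ) ≤ 2 * Λ ^ 2)
  have e2 := mul_le_mul_of_nonneg_left hSb (by positivity : (0 : ℝ) ≤ 2 * ρ ^ 2)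
  linarith

/-- The `9` comes from `72 ≤ 9²`; the `5` is slack, reserved for the width bounds. -/
theorem rpow_half_le_of_le_sq {I Λ D e E η : ℝ} (hΛ : 0 ≤ Λ) (hD : 0 ≤ D) (he : 0 ≤ e)
    (hη : 0 ≤ η) (heE : e ≤ E) (hI : I ≤ 72 * Λ ^ 2 * e ^ 2 + (D * η) ^ 2) :
    I ^ (1 / 2 : ℝ) ≤ (5 + 9 * Λ + D) * (η + E) := by
  have h2 : I ≤ (9 * Λ * e + D * η) ^ 2 := by
    have q1 : 0 ≤ (9 * Λ * e) * (D * η) := by positivity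
    nlinarith [sq_nonneg (Λ * e)]
  rw [← Real.sqrt_eq_rpow]
  refine (Real.sqrt_le_sqrt h2).trans ?_
  rw [Real.sqrt_sq (by positivity)]
  have q1 : 9 * Λ * e ≤ 9 * Λ * E := by gcongr
  have q2 : 0 ≤ (5 + D) * E := mul_nonneg (by positivity) (he.trans heE)
  have q3 : 0 ≤ (5 + 9 * Λ) * η := by positivity
  linarith

end DeepONetSPP

end

/-! ### Choice of the mesh size and of the degree. -/

open DeepONetSPP in
theorem theorem3p1 (a b : ℝ → ℝ) (α : ℝ) (hα : 0 < α)
    (ha : ContDiffOn ℝ 2 a (Set.Icc 0 1)) (hb : ContDiffOn ℝ 2 b (Set.Icc 0 1))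
    (haα : ∀ x ∈ Set.Icc (0 : ℝ) 1, α ≤ a x)
    (Λ : ℝ≥0) (γ : ℝ) (hγ0 : 0 < γ) (hγ1 : γ < 1) (lmax : ℝ) :
    ∃ C : ℝ, 0 < C ∧
      ∀ (ε : ℝ) (G : L2 → L2), 0 < ε → IsSolutionOperator ε a b G → LipschitzWith Λ G →
      ∀ (l : ℝ) (μ : Measure L2), 0 < l → l ≤ lmax → IsRBFGaussian l μ →
      ∀ (m P : ℕ) (η : ℝ), 1 ≤ m → 1 ≤ P → 0 < η →
      ∃ (τ : ReLUNet 1 (P + 1)) (β : ReLUNet m P),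
        τ.depth ≤ 1 ∧ (τ.width : ℝ) ≤ C * max (P : ℝ) ((η / P) ^ (1 / (γ - 2))) ∧
        β.depth ≤ 1 ∧ (β.width : ℝ) ≤ C * max (m : ℝ) (P : ℝ) ∧
        MemLp (fun f : L2 => G f - deepONet τ β f) 2 μ ∧
        (∫ f : L2, ‖G f - deepONet τ β f‖ ^ 2 ∂μ) ^ (1 / 2 : ℝ) ≤
          C * (η + Real.exp (-(Real.pi ^ 2 * l ^ 2 * (((P : ℝ) - 1) / 2) ^ 2))
            + Real.exp (-(Real.pi ^ 2 * l ^ 2 * (((m : ℝ) - 1) / 2) ^ 2))) := by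
  obtain ⟨C, hC, hmain⟩ := exists_deepONet_error_bound hα ha hb haα Λ hγ0
  set D := 3 * (3 * |lmax| + 4) * C with hD
  have hD0 : 0 ≤ D := by positivity
  have hΛ : (0 : ℝ) ≤ Λ := Λ.coe_nonneg
  refine ⟨5 + 9 * Λ + D, by positivity, ?_⟩
  intro ε G hε hG hGL l μ hl hlm hμ m P η hm hP hη
  have hP1 : (1 : ℝ) ≤ P := by exact_mod_cast hP
  have hm1 : (1 : ℝ) ≤ m := by exact_mod_cast hm
  set X := max (P : ℝ) ((η / P) ^ (1 / (γ - 2))) with hX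
  have hX1 : 1 ≤ X := hP1.trans (le_max_left _ _)
  -- Large enough for `P * N ^ (γ - 2) ≤ η`, and `2 * N + 1 ≤ 2 * X + 3 ≤ 5 * X`.
  set N := ⌈X⌉₊ with hN
  have hNX : X ≤ N := Nat.le_ceil X
  have hNX' : (N : ℝ) ≤ X + 1 := (Nat.ceil_lt_add_one (by linarith)).le
  have hN1 : 1 ≤ N := by exact_mod_cast hX1.trans hNX
  set κ := min (((P : ℝ) - 1) / 2) (((m : ℝ) - 1) / 2) with hκ
  have hκ0 : 0 ≤ κ := le_min (by linarith) (by linarith)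
  set n := min ((P - 1) / 2) ((m - 1) / 2) with hn
  -- The degree `n` is the integer part of `κ`, and `κ` is a half-integer when the smaller of `m`
  -- and `P` is even; hence the slack `1/2` in the tail estimate.
  have hκn : κ ≤ n + 1 / 2 := by
    have key : ∀ q : ℕ, 1 ≤ q → ((q : ℝ) - 1) / 2 ≤ ((q - 1) / 2 : ℕ) + 1 / 2 := fun q hq => by
      have : (q : ℝ) ≤ 2 * ((q - 1) / 2 : ℕ) + 2 := by
        exact_mod_cast (by lia : q ≤ 2 * ((q - 1) / 2) + 2)
      linarith
    rcases min_choice ((P - 1) / 2) ((m - 1) / 2) with h | h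
    · rw [hn, h]; exact (min_le_left _ _).trans (key P hP)
    · rw [hn, h]; exact (min_le_right _ _).trans (key m hm)
  obtain ⟨τ, β, hτd, hτw, hβd, hβw, hmem, hint⟩ := hmain ε G hε hG hGL l μ hl hμ m P n N κ
    (by lia) (by lia) hN1 hκ0 hκn
  refine ⟨τ, β, hτd.le, ?_, by lia, ?_, hmem, ?_⟩
  · rw [hτw]
    have h1 : ((max 1 (max (2 * N + 1) (P + 1)) : ℕ) : ℝ) ≤ 5 * X := by
      push_cast
      refine max_le (by linarith) (max_le (by linarith) ?_)
      have : (P : ℝ) ≤ X := le_max_left _ _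
      linarith
    nlinarith
  · rw [hβw]
    push_cast
    have h1 : (0 : ℝ) ≤ max (m : ℝ) P := le_max_of_le_left (by linarith)
    nlinarith
  · have hPN : P * (N : ℝ) ^ (γ - 2) ≤ η := by
      have hP0 : (0 : ℝ) < P := by linarith
      have h0 : 0 < (η / P) ^ (1 / (γ - 2)) := by positivity
      have h1 : (N : ℝ) ^ (γ - 2) ≤ ((η / P) ^ (1 / (γ - 2))) ^ (γ - 2) :=
        Real.rpow_le_rpow_of_nonpos h0 ((le_max_right _ _).trans hNX) (by linarith)
      have h2 : γ - 2 ≠ 0 := by linarith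
      rw [← Real.rpow_mul (by positivity), one_div_mul_cancel h2, Real.rpow_one] at h1
      calc P * (N : ℝ) ^ (γ - 2) ≤ P * (η / P) := by gcongr
        _ = η := by field_simp
    set e := Real.exp (-(Real.pi ^ 2 * l ^ 2 * κ ^ 2)) with he
    have he2 : Real.exp (-(2 * Real.pi ^ 2 * l ^ 2 * κ ^ 2)) = e ^ 2 := by
      rw [he, ← Real.exp_nat_mul]
      congr 1
      push_cast
      ring
    have he0 : 0 < e := Real.exp_pos _
    have hle : e ≤ Real.exp (-(Real.pi ^ 2 * l ^ 2 * (((P : ℝ) - 1) / 2) ^ 2)) +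
        Real.exp (-(Real.pi ^ 2 * l ^ 2 * (((m : ℝ) - 1) / 2) ^ 2)) := by
      rcases min_choice (((P : ℝ) - 1) / 2) (((m : ℝ) - 1) / 2) with h | h
      · rw [he, hκ, h]
        linarith [Real.exp_pos (-(Real.pi ^ 2 * l ^ 2 * (((m : ℝ) - 1) / 2) ^ 2))]
      · rw [he, hκ, h]
        linarith [Real.exp_pos (-(Real.pi ^ 2 * l ^ 2 * (((P : ℝ) - 1) / 2) ^ 2))]
    have hl' : l ≤ |lmax| := hlm.trans (le_abs_self _)
    have h1 : 8 * (3 * l + 4) * (C * (P * (N : ℝ) ^ (γ - 2))) ^ 2 ≤ (D * η) ^ 2 := by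
      have q1 : (C * (P * (N : ℝ) ^ (γ - 2))) ^ 2 ≤ (C * η) ^ 2 := by gcongr
      have q2 : 8 * (3 * l + 4) ≤ (3 * (3 * |lmax| + 4)) ^ 2 := by
        nlinarith [abs_nonneg lmax]
      calc 8 * (3 * l + 4) * (C * (P * (N : ℝ) ^ (γ - 2))) ^ 2
          ≤ (3 * (3 * |lmax| + 4)) ^ 2 * (C * η) ^ 2 := mul_le_mul q2 q1 (by positivity)
            (by positivity)
        _ = (D * η) ^ 2 := by rw [hD]; ring
    rw [he2] at hint
    rw [add_assoc η]
    exact rpow_half_le_of_le_sq hΛ hD0 he0.le hη.le hle (hint.trans (by gcongr))
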